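/- Let $M$ be a $C^\infty$-manifold with base point $x$, let $P_{x,x}M$ be the set of piecewise continuously differentiable loops $\lambda\colon[0,1]\to M$ at $x$, and let $E^1(M;\mathbb{C})$ be the space of smooth complex-valued $1$-forms on $M$. For $1$-forms $\eta_1,\dots,\eta_m$ and $\lambda\in P_{x,x}M$ with $\lambda^*\eta_i=F_i(t)\,dt$ put $$\int_\lambda\eta_1\cdots\eta_m=\int_{0\le t_1\le\dots\le t_m\le1}F_1(t_1)\cdots F_m(t_m)\,dt_1\cdots dt_m ,$$ and for $n\ge 1$, $\delta_1,\dots,\delta_n,\omega_{12},\dots,\omega_{(n-1)n}\in E^1(M;\mathbb{C})$ put $$\int_\lambda e^{\delta_1}\omega_{12}e^{\delta_2}\cdots\omega_{(n-1)n}e^{\delta_n}=\sum_{m_1,\dots,m_n\ge0}\int_\lambda\underbrace{\delta_1\cdots\delta_1}_{m_1}\,\omega_{12}\,\underbrace{\delta_2\cdots\delta_2}_{m_2}\cdots\omega_{(n-1)n}\,\underbrace{\delta_n\cdots\delta_n}_{m_n}$$ (an absolutely convergent series). For a $\mathbb{Z}$-module $L\subseteq E^1(M;\mathbb{C})$ let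 * $EB(M,x)^L$ be the complex vector space of functions $P_{x,x}M\to\mathbb{C}$ spanned by the functions $\int e^{\delta_1}\omega_{12}\cdots\omega_{(n-1)n}e^{\delta_n}$ with all $\delta_i\in L$ and arbitrary $\omega_{j(j+1)}\in E^1(M;\mathbb{C})$; * $H^0(EB(M,x)^L)\subseteq EB(M,x)^L$ be the subspace of the functions that are constant on homotopy classes of loops at $x$; * $\mathcal{E}(M,x)^L$ be the $\mathbb{C}$-algebra of functions on $P_{x,x}M$ generated by the functions $\int e^\delta$, $\delta\in L$. A space $V$ of functions on $P_{x,x}M$ is called a Hopf algebra here if it is closed under pointwise multiplication and is a Hopf algebra with comultiplication $\Delta$, counit $\varepsilon$ and antipode $i$ given by $\langle\Delta I,(\alpha,\beta)\rangle=\langle I,\alpha\beta\rangle$, $\varepsilon(I)=\langle I,\mathbf{1}_x\rangle$ and $\langle i(I),\alpha\rangle=\langle I,\alpha^{-1}\rangle$; then $\operatorname{Spec}V$ is an affine group scheme over $\mathbb{C}$. A diagonalizable group is a closed subgroup of some $(\mathbb{C}^*)^m$, a unipotent group is a closed subgroup of some group of unipotent upper triangular matrices, and prodiagonalizable (prounipotent)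 groups are inverse limits of diagonalizable (unipotent) groups. An epimorphism of affine group schemes is a faithfully flat homomorphism. **Theorem.** Let $L\subseteq E^1(M;\mathbb{C})$ be any $\mathbb{Z}$-module. Then $\mathcal{E}(M,x)^L$ and $EB(M,x)^L$ are Hopf algebras, the group $\operatorname{Spec}\mathcal{E}(M,x)^L$ is prodiagonalizable, and the inclusion $\mathcal{E}(M,x)^L\subseteq EB(M,x)^L$ induces an epimorphism $$\operatorname{Spec}EB(M,x)^L\to\operatorname{Spec}\mathcal{E}(M,x)^L$$ whose kernel is prounipotent. If $L$ consists of closed $1$-forms, then $H^0(EB(M,x)^L)$ is a Hopf algebra that contains $\mathcal{E}(M,x)^L$, and the inclusion induces an epimorphism $$\operatorname{Spec}H^0(EB(M,x)^L)\to\operatorname{Spec}\mathcal{E}(M,x)^L$$ whose kernel is prounipotent. -/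

import Mathlib

open scoped Manifold ContDiff TensorProduct

noncomputable section

namespace ExpIterInt

universe u

section Geometry

/-! ### Complex-valued 1-forms -/

/-- `E¹(M; ℂ)`: smooth sections of the bundle `Hom_ℝ(TM, M × ℂ)`, where `M` is a smooth manifold
modelled on `ℝⁿ`. -/
abbrev OneForm (n : ℕ) (M : Type u) [TopologicalSpace M]
    [ChartedSpace (EuclideanSpace ℝ (Fin n)) M] [IsManifold (𝓡 n) ∞ M] : Type u :=
  ContMDiffSection (𝓡 n) (EuclideanSpace ℝ (Fin n) →L[ℝ] ℂ) ∞
    (fun p : M => TangentSpace (𝓡 n) p →L[ℝ] Bundle.Trivial M ℂ p)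

variable {n : ℕ} {M : Type u} [TopologicalSpace M]
  [ChartedSpace (EuclideanSpace ℝ (Fin n)) M] [IsManifold (𝓡 n) ∞ M]

/-- The expression of the 1-form `η` in the preferred chart at `p`, i.e. the pullback of `η` along
the inverse of the chart. -/
def inChart (η : OneForm n M) (p : M) (y : EuclideanSpace ℝ (Fin n)) :
    EuclideanSpace ℝ (Fin n) →L[ℝ] ℂ :=
  (η ((extChartAt (𝓡 n) p).symm y)).comp
    (mfderiv 𝓘(ℝ, EuclideanSpace ℝ (Fin n)) (𝓡 n) (extChartAt (𝓡 n) p).symm y)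

/-- `η` is closed: `dη = 0`, where in a chart
`dη(v, w) = (D_v η)(w) - (D_w η)(v)`. -/
def IsClosedForm (η : OneForm n M) : Prop :=
  ∀ p : M, ∀ y ∈ (extChartAt (𝓡 n) p).target, ∀ v w : EuclideanSpace ℝ (Fin n),
    fderiv ℝ (inChart η p) y v w - fderiv ℝ (inChart η p) y w v = 0

/-! ### Piecewise differentiable loops -/

/-- A path is piecewise continuously differentiable: there is a finite set `S` of break points such
that the path is `C¹` (up to the end points) on every interval without break points inside. -/
def PiecewiseC1 (n : ℕ) {M : Type u} [TopologicalSpace M]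
    [ChartedSpace (EuclideanSpace ℝ (Fin n)) M] {x y : M} (γ : Path x y) : Prop :=
  ∃ S : Finset ℝ, ∀ a b : ℝ, 0 ≤ a → a < b → b ≤ 1 → (∀ s ∈ S, s ∉ Set.Ioo a b) →
    ContMDiffOn 𝓘(ℝ, ℝ) (𝓡 n) 1 γ.extend (Set.Icc a b)

theorem PiecewiseC1.refl (n : ℕ) {M : Type u} [TopologicalSpace M]
    [ChartedSpace (EuclideanSpace ℝ (Fin n)) M] (x : M) : PiecewiseC1 n (Path.refl x) := by
  refine ⟨∅, fun a b _ _ _ _ => ?_⟩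
  have h : ⇑(Path.refl x).extend = fun _ => x := by
    ext t
    simp
  rw [h]
  exact contMDiffOn_const

theorem PiecewiseC1.symm {n : ℕ} {M : Type u} [TopologicalSpace M]
    [ChartedSpace (EuclideanSpace ℝ (Fin n)) M] {x y : M} {γ : Path x y}
    (h : PiecewiseC1 n γ) : PiecewiseC1 n γ.symm := by
  obtain ⟨S, hS⟩ := h
  refine ⟨S.image (fun s => 1 - s), fun a b ha hab hb hs => ?_⟩
  have key := hS (1 - b) (1 - a) (by linarith) (by linarith) (by linarith) (by
    intro s hs' hmem
    exact hs (1 - s) (Finset.mem_image_of_mem _ hs')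
      ⟨by linarith [hmem.2], by linarith [hmem.1]⟩)
  have hφ : ContMDiffOn 𝓘(ℝ, ℝ) 𝓘(ℝ, ℝ) 1 (fun t : ℝ => 1 - t) (Set.Icc a b) :=
    (contDiff_const.sub contDiff_id).contMDiff.contMDiffOn
  refine (key.comp hφ (fun t ht => ⟨by linarith [ht.2], by linarith [ht.1]⟩)).congr ?_
  intro t ht
  simp [Path.extend_symm_apply]

theorem PiecewiseC1.trans {n : ℕ} {M : Type u} [TopologicalSpace M]
    [ChartedSpace (EuclideanSpace ℝ (Fin n)) M] {x y z : M} {α : Path x y} {β : Path y z}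
    (hα : PiecewiseC1 n α) (hβ : PiecewiseC1 n β) : PiecewiseC1 n (α.trans β) := by
  obtain ⟨S, hS⟩ := hα
  obtain ⟨T, hT⟩ := hβ
  refine ⟨insert (1 / 2) (S.image (fun s => s / 2) ∪ T.image (fun s => (s + 1) / 2)),
    fun a b ha hab hb hs => ?_⟩
  rcases le_or_gt b (1 / 2) with hb2 | hb2
  · have key := hS (2 * a) (2 * b) (by linarith) (by linarith) (by linarith) (by
      intro s hs' hmem
      refine hs (s / 2) ?_ ⟨by linarith [hmem.1], by linarith [hmem.2]⟩
      simp only [Finset.mem_insert, Finset.mem_union, Finset.mem_image]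
      exact Or.inr (Or.inl ⟨s, hs', rfl⟩))
    have hφ : ContMDiffOn 𝓘(ℝ, ℝ) 𝓘(ℝ, ℝ) 1 (fun t : ℝ => 2 * t) (Set.Icc a b) :=
      (contDiff_const.mul contDiff_id).contMDiff.contMDiffOn
    refine (key.comp hφ (fun t ht => ⟨by linarith [ht.1], by linarith [ht.2]⟩)).congr ?_
    intro t ht
    exact Path.extend_trans_of_le_half α β (ht.2.trans hb2)
  · have ha2 : 1 / 2 ≤ a := by
      by_contra hcon
      exact hs (1 / 2) (Finset.mem_insert_self _ _) ⟨not_le.mp hcon, hb2⟩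
    have key := hT (2 * a - 1) (2 * b - 1) (by linarith) (by linarith) (by linarith) (by
      intro s hs' hmem
      refine hs ((s + 1) / 2) ?_ ⟨by linarith [hmem.1], by linarith [hmem.2]⟩
      simp only [Finset.mem_insert, Finset.mem_union, Finset.mem_image]
      exact Or.inr (Or.inr ⟨s, hs', rfl⟩))
    have hφ : ContMDiffOn 𝓘(ℝ, ℝ) 𝓘(ℝ, ℝ) 1 (fun t : ℝ => 2 * t - 1) (Set.Icc a b) :=
      ((contDiff_const.mul contDiff_id).sub contDiff_const).contMDiff.contMDiffOn
    refine (key.comp hφ (fun t ht => ⟨by linarith [ht.1], by linarith [ht.2]⟩)).congr ?_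
    intro t ht
    exact Path.extend_trans_of_half_le α β (ha2.trans ht.1)

/-- The loop space `P_{x,x}M`: piecewise differentiable loops `[0,1] → M` based at `x`. -/
structure Loop (n : ℕ) {M : Type u} [TopologicalSpace M]
    [ChartedSpace (EuclideanSpace ℝ (Fin n)) M] (x : M) : Type u where
  path : Path x x
  piecewiseC1 : PiecewiseC1 n path

/-- Concatenation `αβ` of loops: first `α`, then `β`, each at double speed. -/
def Loop.concat {x : M} (α β : Loop n x) : Loop n x := ⟨α.path.trans β.path, α.piecewiseC1.trans β.piecewiseC1⟩

/-- The reversed loop. -/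
def Loop.inverse {x : M} (α : Loop n x) : Loop n x := ⟨α.path.symm, α.piecewiseC1.symm⟩

/-- The constant loop at `x`. -/
def Loop.const (n : ℕ) {M : Type u} [TopologicalSpace M]
    [ChartedSpace (EuclideanSpace ℝ (Fin n)) M] (x : M) : Loop n x :=
  ⟨Path.refl x, PiecewiseC1.refl n x⟩

/-! ### Iterated integrals and exponential iterated integrals -/

/-- The function `F` with `γ^* η = F(t) dt`. (It is meaningful away from the finitely many
break points of `γ`.) -/
def pullback {x : M} (γ : Loop n x) (η : OneForm n M) (t : ℝ) : ℂ :=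
  η (γ.path.extend t) (mfderiv 𝓘(ℝ, ℝ) (𝓡 n) γ.path.extend t (1 : ℝ))

/-- `iterIntFrom γ [η₁, …, ηₘ] s` is the integral of `F₁(t₁) ⋯ Fₘ(tₘ) dt₁ ⋯ dtₘ` over the simplex
`s ≤ t₁ ≤ ⋯ ≤ tₘ ≤ 1`, where `γ^* ηᵢ = Fᵢ(t) dt`. -/
def iterIntFrom {x : M} (γ : Loop n x) : List (OneForm n M) → ℝ → ℂ
  | [], _ => 1
  | η :: ws, s => ∫ t in s..1, pullback γ η t * iterIntFrom γ ws t

/-- The iterated integral `∫_γ η₁ η₂ ⋯ ηₘ`. -/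
def iterInt {x : M} (ws : List (OneForm n M)) (γ : Loop n x) : ℂ := iterIntFrom γ ws 0

/-- The word `δ₀ ⋯ δ₀ η₀ δ₁ ⋯ δ₁ η₁ ⋯ η_{k-1} δ_k ⋯ δ_k` in which `δᵢ` is repeated `mᵢ` times. -/
def expWord {k : ℕ} (δ : Fin (k + 1) → OneForm n M) (η : Fin k → OneForm n M)
    (m : Fin (k + 1) → ℕ) : List (OneForm n M) :=
  List.replicate (m 0) (δ 0) ++
    (List.ofFn fun i : Fin k => η i :: List.replicate (m i.succ) (δ i.succ)).flatten

/-- The exponential iterated integral `∫ e^{δ₀} η₀ e^{δ₁} η₁ ⋯ η_{k-1} e^{δ_k}`, as a function on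
loops: the (absolutely convergent) sum over all `m` of the iterated integrals of the words
`expWord δ η m`. -/
def expIterInt {x : M} {k : ℕ} (δ : Fin (k + 1) → OneForm n M) (η : Fin k → OneForm n M)
    (γ : Loop n x) : ℂ :=
  ∑' m : Fin (k + 1) → ℕ, iterInt (expWord δ η m) γ

/-- `EB(M,x)^L`: the vector space of functions on the loop space at `x` that are finite sums of
exponential iterated integrals with exponents in `L` and arbitrary linear 1-forms. -/
def EB (x : M) (L : Submodule ℤ (OneForm n M)) : Submodule ℂ (Loop n x → ℂ) :=
  Submodule.span ℂ {f | ∃ (k : ℕ) (δ : Fin (k + 1) → OneForm n M) (η : Fin k → OneForm n M),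
    (∀ i, δ i ∈ L) ∧ f = expIterInt δ η}

/-- The functions on the loop space that are constant on homotopy classes (relative to the
base point). -/
def homotopyInvariant (n : ℕ) {M : Type u} [TopologicalSpace M]
    [ChartedSpace (EuclideanSpace ℝ (Fin n)) M] (x : M) : Submodule ℂ (Loop n x → ℂ) where
  carrier := {f | ∀ α β : Loop n x, α.path.Homotopic β.path → f α = f β}
  add_mem' hf hg α β h := by simp [hf α β h, hg α β h]
  zero_mem' _ _ _ := rfl
  smul_mem' c f hf α β h := by simp [hf α β h]

/-- `H⁰(EB(M,x)^L)`: the closed exponential iterated integrals. -/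
def H0EB (x : M) (L : Submodule ℤ (OneForm n M)) : Submodule ℂ (Loop n x → ℂ) :=
  EB x L ⊓ homotopyInvariant n x

/-- The integral `∫ e^δ`, the exponential iterated integral of length zero with exponent `δ`. -/
def expInt {x : M} (δ : OneForm n M) : Loop n x → ℂ :=
  expIterInt (k := 0) (fun _ => δ) Fin.elim0

/-- `𝓔(M,x)^L`: the `ℂ`-algebra generated by the integrals `∫ e^δ` with `δ ∈ L`. -/
def expAlg (x : M) (L : Submodule ℤ (OneForm n M)) : Subalgebra ℂ (Loop n x → ℂ) :=
  Algebra.adjoin ℂ {f | ∃ δ ∈ L, f = expInt δ}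

/-- A space `V` of functions on the loop space, viewed as a Hopf algebra with pointwise
multiplication, in which comultiplication, counit and antipode are dual to concatenation of loops,
the constant loop and reversal of loops: `⟨Δ I, (α, β)⟩ = ⟨I, αβ⟩`, `ε(I) = ⟨I, 1_x⟩` and
`⟨i(I), α⟩ = ⟨I, α⁻¹⟩`. All of this is determined by `V`, up to a unique isomorphism that commutes
with `eval`; to give a term of this type is to show that `V` is such a Hopf algebra. -/
structure LoopHopfAlgebra {x : M} (V : Submodule ℂ (Loop n x → ℂ)) where
  carrier : Type u
  [commRing : CommRing carrier]
  [hopfAlgebra : HopfAlgebra ℂ carrier]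
  /-- Evaluation of the elements on loops. -/
  eval : carrier →ₐ[ℂ] (Loop n x → ℂ)
  eval_injective : Function.Injective eval
  range_eval : LinearMap.range eval.toLinearMap = V
  eval_comul : ∀ (a : carrier) (α β : Loop n x),
    Algebra.TensorProduct.lmul' ℂ (Algebra.TensorProduct.map
      ((Pi.evalAlgHom ℂ (fun _ : Loop n x => ℂ) α).comp eval)
      ((Pi.evalAlgHom ℂ (fun _ : Loop n x => ℂ) β).comp eval)
      (Coalgebra.comul (R := ℂ) a)) = eval a (α.concat β)
  counit_eq : ∀ a : carrier, Coalgebra.counit (R := ℂ) a = eval a (Loop.const n x)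
  eval_antipode : ∀ (a : carrier) (α : Loop n x),
    eval (HopfAlgebra.antipode ℂ a) α = eval a α.inverse

attribute [instance] LoopHopfAlgebra.commRing LoopHopfAlgebra.hopfAlgebra

end Geometry

section AffineGroups

/-! ### Affine group schemes over `ℂ`

An affine group scheme `Spec A` over `ℂ` is given by its coordinate ring, a commutative Hopf algebra
`A`; homomorphisms `Spec A → Spec B` are the homomorphisms `B → A` of bialgebras. -/

/-- `Spec A` is a diagonalizable algebraic group: it is isomorphic to a closed subgroup of
`(ℂ^*)^m` for some `m`. (The coordinate ring of `(ℂ^*)^m` is the group algebra of `ℤ^m`.) -/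
def IsDiagonalizable (A : Type u) [CommRing A] [HopfAlgebra ℂ A] : Prop :=
  ∃ (m : ℕ) (f : AddMonoidAlgebra ℂ (Fin m → ℤ) →ₐc[ℂ] A), Function.Surjective f

/-- `Spec A` is a unipotent algebraic group: it is isomorphic to a closed subgroup of the group of
unipotent upper triangular `m × m` matrices for some `m`. The matrix `a` below is the homomorphism
from `Spec A` to that group; it is a closed embedding when its entries generate `A`. -/
def IsUnipotent (A : Type u) [CommRing A] [HopfAlgebra ℂ A] : Prop :=
  ∃ (m : ℕ) (a : Matrix (Fin m) (Fin m) A),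
    (∀ i, a i i = 1) ∧ (∀ i j, j < i → a i j = 0) ∧
    (∀ i j, Coalgebra.comul (R := ℂ) (a i j) = ∑ k, a i k ⊗ₜ[ℂ] a k j) ∧
    Algebra.adjoin ℂ {b | ∃ i j, b = a i j} = ⊤

/-- `Spec A` is prodiagonalizable, i.e. an inverse limit of diagonalizable algebraic groups: `A` is
the directed union of Hopf subalgebras that are coordinate rings of diagonalizable groups. -/
def IsProdiagonalizable (A : Type u) [CommRing A] [HopfAlgebra ℂ A] : Prop :=
  ∀ s : Finset A, ∃ (B : Type u) (_ : CommRing B) (_ : HopfAlgebra ℂ B) (i : B →ₐc[ℂ] A),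
    Function.Injective i ∧ (s : Set A) ⊆ Set.range i ∧ IsDiagonalizable B

/-- `Spec A` is prounipotent, i.e. an inverse limit of unipotent algebraic groups: `A` is the
directed union of Hopf subalgebras that are coordinate rings of unipotent groups. -/
def IsProunipotent (A : Type u) [CommRing A] [HopfAlgebra ℂ A] : Prop :=
  ∀ s : Finset A, ∃ (B : Type u) (_ : CommRing B) (_ : HopfAlgebra ℂ B) (i : B →ₐc[ℂ] A),
    Function.Injective i ∧ (s : Set A) ⊆ Set.range i ∧ IsUnipotent B

variable {A B : Type u} [CommRing A] [HopfAlgebra ℂ A] [CommRing B] [HopfAlgebra ℂ B]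

/-- The homomorphism `Spec A → Spec B` with comorphism `φ` is an epimorphism (quotient map) of
affine group schemes: it is faithfully flat. -/
def SpecEpi (φ : B →ₐc[ℂ] A) : Prop :=
  ((φ : B →ₐ[ℂ] A) : B →+* A).FaithfullyFlat

/-- The closed subgroup `Spec K ⊆ Spec A` (with comorphism `q`) is the kernel of the homomorphism
`Spec A → Spec B` with comorphism `φ`, i.e. the fibre over the identity: `K = A / φ(ker ε) A`. -/
def IsSpecKernel (φ : B →ₐc[ℂ] A) {K : Type u} [CommRing K] [HopfAlgebra ℂ K]
    (q : A →ₐc[ℂ] K) : Prop :=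
  Function.Surjective q ∧
    RingHom.ker q = Ideal.map φ (RingHom.ker (Bialgebra.counitAlgHom ℂ B))

/-- The kernel of the homomorphism `Spec A → Spec B` with comorphism `φ` is prounipotent. -/
def HasProunipotentKernel (φ : B →ₐc[ℂ] A) : Prop :=
  ∃ (K : Type u) (_ : CommRing K) (_ : HopfAlgebra ℂ K) (q : A →ₐc[ℂ] K),
    IsSpecKernel φ q ∧ IsProunipotent K

end AffineGroups

end ExpIterInt

end

open ExpIterInt

noncomputable section
namespace ExpIterInt
universe u

/-! ### Hopf algebras of functions on a group -/

/-! Sequences of forms `δ i` in `L` and `η i` define an upper triangular connection, with the `δ i`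
on the diagonal and the `η i` just above it. An exponential iterated integral is an entry of its
parallel transport: summing the series block by block solves a linear integral equation
(`hasSum_transportWord`). Transport turns concatenation of loops into products of matrices and
reversal into inversion (`transport_concat`, `transport_reverse`). The loops thus map onto a group G
of transports (`transportGroup`), and `EB x L` becomes the span of the matrix entries, as functions
on G.

Integration by parts writes a product of two entries as a sum of entries whose exponents are sums of
the given ones (`isTransportSum_mul`), so the span is an algebra. The coproduct of an entry is read
off from the matrix product. The antipode comes from inverting a triangular matrix, where dividing
by ∫e^δ means multiplying by ∫e^(-δ). The Hopf identities hold because they hold at the points of G,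
and points separate tensors.

The rest concerns functions on an abstract group. The ∫e^δ form a group X of characters with span
`charAlg X`; finitely many elements of this span involve finitely many characters, which gives
prodiagonalizability. The entries in a column of a transport, together with the constants, span a
space that is stable under left translation and has a flag on whose quotients G acts through X
(`IsFlagged`). Hence every element of the Hopf algebra lies in such a space, and this has two
consequences.

Faithful flatness: passing up the flag, the `charAlg X`-module generated either does not change or
grows by a free summand of rank one, because characters are linearly independent
(`mem_of_smul_mem`). So these modules are free, and each has a functional that takes 1 to 1.

Prounipotence: in a basis adapted to the flag, translations act by a triangular matrix with diagonal
entries in X. On the kernel the elements of X become 1, so the matrix becomes unitriangular there,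
and its entries generate a Hopf subalgebra.

Homotopy invariant functions inherit both properties: matrix coefficients of an invariant function
can be chosen invariant, and a stable subspace of a flagged space that contains the constants is
flagged. Closedness of `L` serves only to make ∫e^δ homotopy invariant. -/

theorem eq_zero_of_separating {k V W I J : Type*} [Field k] [AddCommGroup V] [Module k V]
    [AddCommGroup W] [Module k W] (p : I → V →ₗ[k] k) (q : J → W →ₗ[k] k)
    (hp : ∀ v, (∀ i, p i v = 0) → v = 0) (hq : ∀ w, (∀ j, q j w = 0) → w = 0)
    (t : V ⊗[k] W) (h : ∀ i j, LinearMap.mul' k k (TensorProduct.map (p i) (q j) t) = 0) :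
    t = 0 := by
  classical
  obtain ⟨c, rfl⟩ := TensorProduct.eq_repr_basis_right (Module.Basis.ofVectorSpace k W) t
  set b := Module.Basis.ofVectorSpace k W
  -- Expand `t` along a basis of `W`. Applying `p i` to the coefficients leaves a vector of `W` that
  -- all `q j` kill, so each `p i (c l)` vanishes for every `i`.
  suffices c = 0 by simp [this]
  ext l
  refine hp _ fun i => ?_
  have key : ∑ x ∈ c.support, p i (c x) • b x = 0 := by
    refine hq _ fun j => ?_
    have := h i j
    simpa [Finsupp.sum, map_sum] using this
  by_cases hl : l ∈ c.support
  · exact linearIndependent_iff'.mp b.linearIndependent c.support (fun x => p i (c x)) key l hl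
  · simp [Finsupp.notMem_support_iff.mp hl]

theorem eq_of_separating {k V W I J : Type*} [Field k] [AddCommGroup V] [Module k V]
    [AddCommGroup W] [Module k W] (p : I → V →ₗ[k] k) (q : J → W →ₗ[k] k)
    (hp : ∀ v, (∀ i, p i v = 0) → v = 0) (hq : ∀ w, (∀ j, q j w = 0) → w = 0)
    {s t : V ⊗[k] W} (h : ∀ i j, LinearMap.mul' k k (TensorProduct.map (p i) (q j) s) =
      LinearMap.mul' k k (TensorProduct.map (p i) (q j) t)) : s = t := by
  rw [← sub_eq_zero]
  refine eq_zero_of_separating p q hp hq _ fun i j => ?_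
  rw [map_sub, map_sub, h, sub_self]

section FunctionHopf

variable {G : Type u}

/-- Evaluation at `a` on an algebra of functions. -/
def evalAt (V : Subalgebra ℂ (G → ℂ)) (a : G) : V →ₐ[ℂ] ℂ :=
  (Pi.evalAlgHom ℂ (fun _ : G => ℂ) a).comp V.val

@[simp] theorem evalAt_apply (V : Subalgebra ℂ (G → ℂ)) (a : G) (f : V) :
    evalAt V a f = (f : G → ℂ) a := rfl

/-- Evaluation at `(a, b)` on the tensor square of an algebra of functions. -/
def pairAt (V : Subalgebra ℂ (G → ℂ)) (a b : G) : V ⊗[ℂ] V →ₐ[ℂ] ℂ :=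
  (Algebra.TensorProduct.lmul' ℂ).comp (Algebra.TensorProduct.map (evalAt V a) (evalAt V b))

@[simp] theorem pairAt_tmul (V : Subalgebra ℂ (G → ℂ)) (a b : G) (f g : V) :
    pairAt V a b (f ⊗ₜ g) = (f : G → ℂ) a * (g : G → ℂ) b := rfl

/-- This reduces identities in `V ⊗ V` to identities between functions on `G × G`. In particular the
comultiplication, chosen by existence alone, is unique and hence a homomorphism of algebras. -/
theorem pairAt_separating (V : Subalgebra ℂ (G → ℂ)) {s t : V ⊗[ℂ] V}
    (h : ∀ a b, pairAt V a b s = pairAt V a b t) : s = t := by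
  have hs : ∀ v : V, (∀ a, (evalAt V a).toLinearMap v = 0) → v = 0 :=
    fun v hv => Subtype.ext (funext hv)
  exact eq_of_separating (fun a => (evalAt V a).toLinearMap)
    (fun a => (evalAt V a).toLinearMap) hs hs h

theorem assoc_eval (V : Subalgebra ℂ (G → ℂ)) (a b c : G) (t : V ⊗[ℂ] V) (w : V) :
    LinearMap.mul' ℂ ℂ (TensorProduct.map (evalAt V a).toLinearMap (pairAt V b c).toLinearMap
      (Algebra.TensorProduct.assoc ℂ ℂ ℂ V V V (t ⊗ₜ w))) = pairAt V a b t * (w : G → ℂ) c := by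
  induction t with
  | zero => simp
  | tmul x y => simp [mul_assoc]
  | add x y hx hy => simp only [TensorProduct.add_tmul, map_add, hx, hy, add_mul]

theorem map_counit_left (V : Subalgebra ℂ (G → ℂ)) (t : V ⊗[ℂ] V) (e a : G) :
    evalAt V a (Algebra.TensorProduct.lid ℂ V
      (Algebra.TensorProduct.map (evalAt V e) (AlgHom.id ℂ V) t)) = pairAt V e a t := by
  induction t with
  | zero => simp
  | tmul x y => simp
  | add x y hx hy => simp only [map_add, hx, hy]

theorem map_counit_right (V : Subalgebra ℂ (G → ℂ)) (t : V ⊗[ℂ] V) (e a : G) :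
    evalAt V a (Algebra.TensorProduct.rid ℂ ℂ V
      (Algebra.TensorProduct.map (AlgHom.id ℂ V) (evalAt V e) t)) = pairAt V a e t := by
  induction t with
  | zero => simp
  | tmul x y => simp [mul_comm]
  | add x y hx hy => simp only [map_add, hx, hy]

variable [Group G]

/-- A subalgebra `V` of the algebra of functions on `G` such that `f ↦ ((a, b) ↦ f (a * b))` takes
values in `V ⊗ V`, and that is closed under `f ↦ (a ↦ f a⁻¹)`. -/
class IsHopfSubalgebra (V : Subalgebra ℂ (G → ℂ)) : Prop where
  comul (f : V) : ∃ t : V ⊗[ℂ] V, ∀ a b, pairAt V a b t = (f : G → ℂ) (a * b)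
  inv (f : V) : (fun a => (f : G → ℂ) a⁻¹) ∈ V

variable (V : Subalgebra ℂ (G → ℂ)) [hV : IsHopfSubalgebra V]

/-- The comultiplication dual to the multiplication of `G`. -/
def comulFun (f : V) : V ⊗[ℂ] V := (hV.comul f).choose

@[simp] theorem pairAt_comulFun (f : V) (a b : G) :
    pairAt V a b (comulFun V f) = (f : G → ℂ) (a * b) := (hV.comul f).choose_spec a b

/-- The comultiplication dual to the multiplication of `G`, as a homomorphism of algebras. -/
def comulHom : V →ₐ[ℂ] V ⊗[ℂ] V where
  toFun := comulFun V
  map_one' := pairAt_separating V fun a b => by simp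
  map_mul' f g := pairAt_separating V fun a b => by simp
  map_zero' := pairAt_separating V fun a b => by simp
  map_add' f g := pairAt_separating V fun a b => by simp
  commutes' c := pairAt_separating V fun a b => by
    rw [pairAt_comulFun, AlgHom.commutes]; rfl

@[simp] theorem pairAt_comulHom (f : V) (a b : G) :
    pairAt V a b (comulHom V f) = (f : G → ℂ) (a * b) := pairAt_comulFun V f a b

theorem assoc_map_comul_eval (a b c : G) (t : V ⊗[ℂ] V) :
    LinearMap.mul' ℂ ℂ (TensorProduct.map (evalAt V a).toLinearMap (pairAt V b c).toLinearMap
      (Algebra.TensorProduct.assoc ℂ ℂ ℂ V V V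
        (Algebra.TensorProduct.map (comulHom V) (AlgHom.id ℂ V) t))) = pairAt V (a * b) c t := by
  induction t with
  | zero => simp
  | tmul x y => rw [Algebra.TensorProduct.map_tmul, assoc_eval]; simp
  | add x y hx hy => simp only [map_add, hx, hy]

theorem map_id_comul_eval (a b c : G) (t : V ⊗[ℂ] V) :
    LinearMap.mul' ℂ ℂ (TensorProduct.map (evalAt V a).toLinearMap (pairAt V b c).toLinearMap
        (Algebra.TensorProduct.map (AlgHom.id ℂ V) (comulHom V) t)) = pairAt V a (b * c) t := by
  induction t with
  | zero => simp
  | tmul x y => simp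
  | add x y hx hy => simp only [map_add, hx, hy]

-- Evaluated at a triple `(a, b, c)`, both sides give `f (a * b * c)`, so this is associativity in
-- `G`.
set_option synthInstance.maxHeartbeats 200000 in
theorem comulHom_coassoc :
    (Algebra.TensorProduct.assoc ℂ ℂ ℂ V V V).toAlgHom.comp
      ((Algebra.TensorProduct.map (comulHom V) (AlgHom.id ℂ V)).comp (comulHom V)) =
    (Algebra.TensorProduct.map (AlgHom.id ℂ V) (comulHom V)).comp (comulHom V) := by
  ext1 f
  refine eq_of_separating (fun a => (evalAt V a).toLinearMap)
    (fun p : G × G => (pairAt V p.1 p.2).toLinearMap)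
    (fun v hv => Subtype.ext (funext hv))
    (fun w hw => pairAt_separating V fun a b => (hw (a, b)).trans (map_zero _).symm)
    fun a p => ?_
  refine (assoc_map_comul_eval V a p.1 p.2 (comulHom V f)).trans
    (Eq.trans ?_ (map_id_comul_eval V a p.1 p.2 (comulHom V f)).symm)
  simp [mul_assoc]

instance functionBialgebra : Bialgebra ℂ V :=
  Bialgebra.ofAlgHom (comulHom V) (evalAt V 1) (comulHom_coassoc V)
    (by
      ext1 f
      apply (Algebra.TensorProduct.lid ℂ V).injective
      refine Subtype.ext (funext fun a => ?_)
      refine (map_counit_left V (comulHom V f) 1 a).trans ?_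
      simp)
    (by
      ext1 f
      apply (Algebra.TensorProduct.rid ℂ ℂ V).injective
      refine Subtype.ext (funext fun a => ?_)
      refine (map_counit_right V (comulHom V f) 1 a).trans ?_
      simp)

theorem pairAt_comul (f : V) (a b : G) :
    pairAt V a b (Coalgebra.comul (R := ℂ) f) = (f : G → ℂ) (a * b) := pairAt_comulFun V f a b

theorem counit_apply (f : V) : Coalgebra.counit (R := ℂ) f = (f : G → ℂ) 1 := rfl

/-- The antipode dual to the inversion of `G`. -/
def antipodeFun : V →ₗ[ℂ] V where
  toFun f := ⟨fun a => (f : G → ℂ) a⁻¹, hV.inv f⟩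
  map_add' _ _ := rfl
  map_smul' _ _ := rfl

theorem mul_antipodeFun_left (t : V ⊗[ℂ] V) (a : G) :
    evalAt V a (LinearMap.mul' ℂ V (LinearMap.rTensor V (antipodeFun V) t)) =
      pairAt V a⁻¹ a t := by
  induction t with
  | zero => simp
  | tmul x y => simp [antipodeFun]
  | add x y hx hy => simp only [map_add, hx, hy]

theorem mul_antipodeFun_right (t : V ⊗[ℂ] V) (a : G) :
    evalAt V a (LinearMap.mul' ℂ V (LinearMap.lTensor V (antipodeFun V) t)) =
      pairAt V a a⁻¹ t := by
  induction t with
  | zero => simp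
  | tmul x y => simp [antipodeFun]
  | add x y hx hy => simp only [map_add, hx, hy]

instance functionHopfAlgebra : HopfAlgebra ℂ V where
  antipode := antipodeFun V
  mul_antipode_rTensor_comul := by
    ext1 f
    refine Subtype.ext (funext fun a => ?_)
    refine (mul_antipodeFun_left V (Coalgebra.comul f) a).trans ?_
    rw [pairAt_comul, inv_mul_cancel]
    rfl
  mul_antipode_lTensor_comul := by
    ext1 f
    refine Subtype.ext (funext fun a => ?_)
    refine (mul_antipodeFun_right V (Coalgebra.comul f) a).trans ?_
    rw [pairAt_comul, mul_inv_cancel]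
    rfl

theorem antipode_apply (f : V) (a : G) :
    ((HopfAlgebra.antipode ℂ f : V) : G → ℂ) a = (f : G → ℂ) a⁻¹ := rfl

variable {V} {W : Subalgebra ℂ (G → ℂ)} [hW : IsHopfSubalgebra W]

/-- The inclusion of Hopf algebras of functions. -/
def inclusionHom (h : V ≤ W) : V →ₐc[ℂ] W :=
  BialgHom.ofAlgHom (Subalgebra.inclusion h) rfl (by
    ext1 f
    refine pairAt_separating W fun a b => ?_
    have key : ∀ t : V ⊗[ℂ] V, pairAt W a b (Algebra.TensorProduct.map
        (Subalgebra.inclusion h) (Subalgebra.inclusion h) t) = pairAt V a b t := by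
      intro t
      induction t with
      | zero => simp
      | tmul x y => simp
      | add x y hx hy => simp only [map_add, hx, hy]
    refine (key _).trans ((pairAt_comul V f a b).trans
      (pairAt_comul W (Subalgebra.inclusion h f) a b).symm))

end FunctionHopf

/-! ### Hopf subalgebras -/

section SubHopf

variable {K : Type u} [CommRing K] [HopfAlgebra ℂ K] (B : Subalgebra ℂ K)

/-- Modules over a field are flat. Injectivity allows the structure maps to be restricted to `B` and
their axioms to be checked in `K`. -/
theorem map_val_injective : Function.Injective
    (Algebra.TensorProduct.map B.val B.val : B ⊗[ℂ] B →ₐ[ℂ] K ⊗[ℂ] K) :=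
  TensorProduct.map_injective_of_flat_flat B.val.toLinearMap B.val.toLinearMap
    Subtype.val_injective Subtype.val_injective

/-- A subalgebra that is closed under comultiplication and antipode. -/
class IsSubHopf : Prop where
  comul (b : B) : Coalgebra.comul (R := ℂ) (b : K) ∈
    (Algebra.TensorProduct.map B.val B.val : B ⊗[ℂ] B →ₐ[ℂ] K ⊗[ℂ] K).range
  antipode (b : B) : HopfAlgebra.antipode ℂ (b : K) ∈ B

variable [hB : IsSubHopf B]

/-- The restriction of the comultiplication. -/
def subComul : B →ₐ[ℂ] B ⊗[ℂ] B :=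
  (AlgEquiv.ofInjective _ (map_val_injective B)).symm.toAlgHom.comp
    (((Bialgebra.comulAlgHom ℂ K).comp B.val).codRestrict _ hB.comul)

theorem map_val_subComul (b : B) :
    Algebra.TensorProduct.map B.val B.val (subComul B b) = Coalgebra.comul (R := ℂ) (b : K) := by
  have := AlgEquiv.apply_symm_apply (AlgEquiv.ofInjective _ (map_val_injective B))
    (((Bialgebra.comulAlgHom ℂ K).comp B.val).codRestrict _ hB.comul b)
  exact congrArg Subtype.val this

/-- Coassociativity is inherited: the identity is tested after the injection of `B ⊗ (B ⊗ B)` into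
`K ⊗ (K ⊗ K)`. -/
theorem subComul_coassoc :
    (Algebra.TensorProduct.assoc ℂ ℂ ℂ B B B : _ →ₐ[ℂ] _).comp
      ((Algebra.TensorProduct.map (subComul B) (AlgHom.id ℂ B)).comp (subComul B)) =
    (Algebra.TensorProduct.map (AlgHom.id ℂ B) (subComul B)).comp (subComul B) := by
  set i := B.val
  set ii := Algebra.TensorProduct.map i i
  have hinj : Function.Injective (Algebra.TensorProduct.map i ii) :=
    TensorProduct.map_injective_of_flat_flat i.toLinearMap ii.toLinearMap
      Subtype.val_injective (map_val_injective B)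
  have hc : ii.comp (subComul B) = (Bialgebra.comulAlgHom ℂ K).comp i :=
    AlgHom.ext (map_val_subComul B)
  have h1 : (Algebra.TensorProduct.map i ii).comp
      ((Algebra.TensorProduct.assoc ℂ ℂ ℂ B B B : _ →ₐ[ℂ] _).comp
        (Algebra.TensorProduct.map (subComul B) (AlgHom.id ℂ B))) =
      ((Algebra.TensorProduct.assoc ℂ ℂ ℂ K K K : _ →ₐ[ℂ] _).comp
        (Algebra.TensorProduct.map (Bialgebra.comulAlgHom ℂ K) (AlgHom.id ℂ K))).comp ii := by
    have h0 : (Algebra.TensorProduct.map i ii).comp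
        (Algebra.TensorProduct.assoc ℂ ℂ ℂ B B B : _ →ₐ[ℂ] _) =
        (Algebra.TensorProduct.assoc ℂ ℂ ℂ K K K : _ →ₐ[ℂ] _).comp
          (Algebra.TensorProduct.map ii i) := by
      refine Algebra.TensorProduct.ext (Algebra.TensorProduct.ext ?_ ?_) ?_ <;> ext x
      · rfl
      · rfl
      · rfl
    rw [← AlgHom.comp_assoc, h0, AlgHom.comp_assoc, AlgHom.comp_assoc,
      ← Algebra.TensorProduct.map_comp, ← Algebra.TensorProduct.map_comp, hc]
    rfl
  have h2 : (Algebra.TensorProduct.map i ii).comp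
      (Algebra.TensorProduct.map (AlgHom.id ℂ B) (subComul B)) =
      (Algebra.TensorProduct.map (AlgHom.id ℂ K) (Bialgebra.comulAlgHom ℂ K)).comp ii := by
    rw [← Algebra.TensorProduct.map_comp, ← Algebra.TensorProduct.map_comp, hc]
    rfl
  ext1 b
  apply hinj
  have e1 := DFunLike.congr_fun h1 (subComul B b)
  have e2 := DFunLike.congr_fun h2 (subComul B b)
  have e3 := map_val_subComul B b
  simp only [AlgHom.comp_apply] at e1 e2 ⊢
  refine e1.trans (Eq.trans ?_ e2.symm)
  simp only [ii, i, e3]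
  exact Coalgebra.coassoc_apply (R := ℂ) (b : K)

instance subBialgebra : Bialgebra ℂ B :=
  Bialgebra.ofAlgHom (subComul B) ((Bialgebra.counitAlgHom ℂ K).comp B.val) (subComul_coassoc B)
    (by
      have hinj : Function.Injective (Algebra.TensorProduct.map (AlgHom.id ℂ ℂ) B.val) :=
        TensorProduct.map_injective_of_flat_flat LinearMap.id B.val.toLinearMap
          Function.injective_id Subtype.val_injective
      ext1 b
      apply hinj
      have h : (Algebra.TensorProduct.map (AlgHom.id ℂ ℂ) B.val).comp
          (Algebra.TensorProduct.map ((Bialgebra.counitAlgHom ℂ K).comp B.val) (AlgHom.id ℂ B)) =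
          (Algebra.TensorProduct.map (Bialgebra.counitAlgHom ℂ K) (AlgHom.id ℂ K)).comp
            (Algebra.TensorProduct.map B.val B.val) := by
        rw [← Algebra.TensorProduct.map_comp, ← Algebra.TensorProduct.map_comp]; rfl
      have e := DFunLike.congr_fun h (subComul B b)
      simp only [AlgHom.comp_apply, map_val_subComul] at e ⊢
      refine e.trans ((Coalgebra.rTensor_counit_comul (R := ℂ) (b : K)).trans ?_)
      simp)
    (by
      have hinj : Function.Injective (Algebra.TensorProduct.map B.val (AlgHom.id ℂ ℂ)) :=
        TensorProduct.map_injective_of_flat_flat B.val.toLinearMap LinearMap.id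
          Subtype.val_injective Function.injective_id
      ext1 b
      apply hinj
      have h : (Algebra.TensorProduct.map B.val (AlgHom.id ℂ ℂ)).comp
          (Algebra.TensorProduct.map (AlgHom.id ℂ B) ((Bialgebra.counitAlgHom ℂ K).comp B.val)) =
          (Algebra.TensorProduct.map (AlgHom.id ℂ K) (Bialgebra.counitAlgHom ℂ K)).comp
            (Algebra.TensorProduct.map B.val B.val) := by
        rw [← Algebra.TensorProduct.map_comp, ← Algebra.TensorProduct.map_comp]; rfl
      have e := DFunLike.congr_fun h (subComul B b)
      simp only [AlgHom.comp_apply, map_val_subComul] at e ⊢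
      refine e.trans ((Coalgebra.lTensor_counit_comul (R := ℂ) (b : K)).trans ?_)
      simp)

theorem map_val_comul (b : B) :
    Algebra.TensorProduct.map B.val B.val (Coalgebra.comul (R := ℂ) b) =
      Coalgebra.comul (R := ℂ) (b : K) := map_val_subComul B b

/-- The restriction of the antipode. -/
def subAntipode : B →ₗ[ℂ] B :=
  ((HopfAlgebra.antipode ℂ).comp B.val.toLinearMap).codRestrict (Subalgebra.toSubmodule B)
    hB.antipode

instance subHopfAlgebra : HopfAlgebra ℂ B where
  antipode := subAntipode B
  mul_antipode_rTensor_comul := by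
    have key : ∀ t : B ⊗[ℂ] B,
        ((LinearMap.mul' ℂ B (LinearMap.rTensor B (subAntipode B) t) : B) : K) =
        LinearMap.mul' ℂ K (LinearMap.rTensor K (HopfAlgebra.antipode ℂ)
          (Algebra.TensorProduct.map B.val B.val t)) := by
      intro t
      induction t with
      | zero => simp
      | tmul x y => rfl
      | add x y hx hy => simp only [map_add, Subalgebra.coe_add, hx, hy]
    ext1 b
    refine Subtype.ext ((key _).trans ?_)
    rw [map_val_comul]
    exact HopfAlgebra.mul_antipode_rTensor_comul_apply (R := ℂ) (b : K)
  mul_antipode_lTensor_comul := by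
    have key : ∀ t : B ⊗[ℂ] B,
        ((LinearMap.mul' ℂ B (LinearMap.lTensor B (subAntipode B) t) : B) : K) =
        LinearMap.mul' ℂ K (LinearMap.lTensor K (HopfAlgebra.antipode ℂ)
          (Algebra.TensorProduct.map B.val B.val t)) := by
      intro t
      induction t with
      | zero => simp
      | tmul x y => rfl
      | add x y hx hy => simp only [map_add, Subalgebra.coe_add, hx, hy]
    ext1 b
    refine Subtype.ext ((key _).trans ?_)
    rw [map_val_comul]
    exact HopfAlgebra.mul_antipode_lTensor_comul_apply (R := ℂ) (b : K)

/-- The inclusion of a Hopf subalgebra. -/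
def subHopfVal : B →ₐc[ℂ] K :=
  BialgHom.ofAlgHom B.val rfl (AlgHom.ext (map_val_comul B))

end SubHopf

end ExpIterInt

end

noncomputable section
namespace ExpIterInt
universe u

/-! ### Groups of characters and the algebras they span. -/

section Characters

variable {G : Type u} [Group G]

/-- Characters of `G`, as functions. -/
def charFun : (G →* ℂˣ) →* (G → ℂ) where
  toFun χ a := χ a
  map_one' := rfl
  map_mul' _ _ := rfl

@[simp] theorem charFun_apply (χ : G →* ℂˣ) (a : G) : charFun χ a = χ a := rfl

/-- Dedekind's independence of characters. Faithful flatness rests on it. -/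
theorem linearIndependent_charFun : LinearIndependent ℂ (fun χ : G →* ℂˣ => charFun χ) := by
  refine (linearIndependent_monoidHom G ℂ).comp (fun χ => (Units.coeHom ℂ).comp χ) ?_
  intro χ ψ h
  ext a
  exact DFunLike.congr_fun h a

variable (X : Subgroup (G →* ℂˣ))

/-- The algebra of functions generated by a group of characters. -/
def charAlg : Subalgebra ℂ (G → ℂ) := Algebra.adjoin ℂ (charFun '' X)

/-- The characters in `X` are already closed under products, so generating an algebra adds only
linear combinations. -/
theorem charAlg_toSubmodule :
    Subalgebra.toSubmodule (charAlg X) = Submodule.span ℂ (charFun '' (X : Set (G →* ℂˣ))) := by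
  rw [charAlg, Algebra.adjoin_eq_span]
  have : charFun '' (X : Set (G →* ℂˣ)) = (X.toSubmonoid.map charFun : Set (G → ℂ)) := rfl
  rw [this, Submonoid.closure_eq]

variable {X}

theorem charFun_mem {χ : G →* ℂˣ} (hχ : χ ∈ X) : charFun χ ∈ charAlg X :=
  Algebra.subset_adjoin ⟨χ, hχ, rfl⟩

theorem charAlg_induction {p : (G → ℂ) → Prop} (hc : ∀ χ ∈ X, p (charFun χ)) (h0 : p 0)
    (hadd : ∀ f g, p f → p g → p (f + g)) (hsmul : ∀ (c : ℂ) f, p f → p (c • f))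
    {f : G → ℂ} (hf : f ∈ charAlg X) : p f := by
  rw [← Subalgebra.mem_toSubmodule, charAlg_toSubmodule] at hf
  refine Submodule.span_induction ?_ h0 (fun f g _ _ => hadd f g) (fun c f _ => hsmul c f) hf
  rintro _ ⟨χ, hχ, rfl⟩
  exact hc χ hχ

variable (X)

theorem isHopfSubalgebra_of_exists {V : Subalgebra ℂ (G → ℂ)}
    (h : ∀ f ∈ V, ∃ t : V ⊗[ℂ] V, ∀ a b, pairAt V a b t = f (a * b))
    (h' : ∀ f ∈ V, (fun a => f a⁻¹) ∈ V) : IsHopfSubalgebra V :=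
  ⟨fun f => h f f.2, fun f => h' f f.2⟩

/-- Characters are group-like: the coproduct of χ is χ ⊗ χ and its antipode is χ⁻¹. Both extend
linearly. -/
instance charAlg_isHopfSubalgebra : IsHopfSubalgebra (charAlg X) := by
  refine isHopfSubalgebra_of_exists (fun f hf => ?_) fun f hf => ?_
  · refine charAlg_induction (X := X) (p := fun f => ∃ t : charAlg X ⊗[ℂ] charAlg X,
      ∀ a b, pairAt (charAlg X) a b t = f (a * b)) (fun χ hχ => ?_) ?_ (fun f g hf hg => ?_)
      (fun c f hf => ?_) hf
    · exact ⟨⟨_, charFun_mem hχ⟩ ⊗ₜ ⟨_, charFun_mem hχ⟩, fun a b => by simp⟩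
    · exact ⟨0, fun a b => by simp⟩
    · obtain ⟨s, hs⟩ := hf
      obtain ⟨t, ht⟩ := hg
      exact ⟨s + t, fun a b => by simp [hs, ht]⟩
    · obtain ⟨s, hs⟩ := hf
      exact ⟨c • s, fun a b => by simp [hs]⟩
  · refine charAlg_induction (X := X) (p := fun f => (fun a => f a⁻¹) ∈ charAlg X)
      (fun χ hχ => ?_) ?_ (fun f g hf hg => ?_) (fun c f hf => ?_) hf
    · have : (fun a => charFun χ a⁻¹) = charFun χ⁻¹ := by ext a; simp
      rw [this]
      exact charFun_mem (X.inv_mem hχ)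
    · exact (charAlg X).zero_mem
    · exact (charAlg X).add_mem hf hg
    · exact (charAlg X).smul_mem hf c

/-! ### Left translations and flagged spaces of functions. -/

/-- Left translation of functions. -/
def leftTranslate (a : G) : (G → ℂ) →ₐ[ℂ] (G → ℂ) where
  toFun f b := f (a * b)
  map_one' := rfl
  map_mul' _ _ := rfl
  map_zero' := rfl
  map_add' _ _ := rfl
  commutes' _ := rfl

@[simp] theorem leftTranslate_apply (a b : G) (f : G → ℂ) :
    leftTranslate a f b = f (a * b) := rfl

theorem leftTranslate_charFun (a : G) (χ : G →* ℂˣ) :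
    leftTranslate a (charFun χ) = charFun χ a • charFun χ := by ext; simp

/-- Finite-dimensional spaces of functions with a flag that is stable under left translations and
on whose successive quotients `G` acts by characters in `X`; the flag starts with the constants. -/
inductive IsFlagged : Submodule ℂ (G → ℂ) → Prop
  | one : IsFlagged (Submodule.span ℂ {1})
  | step {N : Submodule ℂ (G → ℂ)} (f : G → ℂ) (χ : G →* ℂˣ) : IsFlagged N → χ ∈ X →
      (∀ a, leftTranslate a f - charFun χ a • f ∈ N) → IsFlagged (N ⊔ Submodule.span ℂ {f})

variable {X}

namespace IsFlagged

variable {N N' : Submodule ℂ (G → ℂ)}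

theorem one_mem (hN : IsFlagged X N) : (1 : G → ℂ) ∈ N := by
  induction hN with
  | one => exact Submodule.mem_span_singleton_self _
  | step f χ _ _ _ ih => exact Submodule.mem_sup_left ih

/-- The condition on a step only asks for membership in the space below, so it survives enlarging
that space by `N`. The first step is absorbed because both flags start at the constants. -/
theorem sup (hN : IsFlagged X N) (hN' : IsFlagged X N') : IsFlagged X (N ⊔ N') := by
  induction hN' with
  | one =>
    rwa [sup_eq_left.mpr]
    rw [Submodule.span_singleton_le_iff_mem]
    exact hN.one_mem
  | step f χ _ hχ hf ih =>
    rw [← sup_assoc]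
    exact .step f χ ih hχ fun a => Submodule.mem_sup_right (hf a)

theorem translate_mem (hN : IsFlagged X N) {f : G → ℂ} (hf : f ∈ N) (a : G) :
    leftTranslate a f ∈ N := by
  induction hN generalizing f with
  | one =>
    obtain ⟨c, rfl⟩ := Submodule.mem_span_singleton.mp hf
    rw [map_smul, map_one]
    exact Submodule.smul_mem _ _ (Submodule.mem_span_singleton_self _)
  | step g χ _ hχ hg ih =>
    obtain ⟨n, hn, m, hm, rfl⟩ := Submodule.mem_sup.mp hf
    obtain ⟨c, rfl⟩ := Submodule.mem_span_singleton.mp hm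
    rw [map_add, map_smul]
    refine add_mem (Submodule.mem_sup_left (ih hn)) (Submodule.smul_mem _ _ ?_)
    rw [← sub_add_cancel (leftTranslate a g) (charFun χ a • g)]
    exact add_mem (Submodule.mem_sup_left (hg a)) (Submodule.smul_mem _ _
      (Submodule.mem_sup_right (Submodule.mem_span_singleton_self _)))

/-- A stable subspace of a flagged space is flagged. -/
theorem inf_of_stable (hN : IsFlagged X N) (h1 : (1 : G → ℂ) ∈ N')
    (hs : ∀ f ∈ N', ∀ a, leftTranslate a f ∈ N') : IsFlagged X (N' ⊓ N) := by
  induction hN with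
  | one =>
    rw [inf_eq_right.mpr]
    · exact .one
    · rwa [Submodule.span_singleton_le_iff_mem]
  | @step N g χ hN hχ hg ih =>
    -- Either the intersection does not grow, or it contains a vector with nonzero coefficient at
    -- `g`. Scaling that coefficient to 1 gives an `f` that replaces `g` and has the same character
    -- modulo `N`.
    by_cases h : N' ⊓ (N ⊔ Submodule.span ℂ {g}) ≤ N' ⊓ N
    · rw [le_antisymm h (inf_le_inf_left _ le_sup_left)]
      exact ih
    obtain ⟨f', ⟨hf1, hf2⟩, hf3⟩ := Set.not_subset.mp h
    obtain ⟨n, hn, m, hm, rfl⟩ := Submodule.mem_sup.mp hf2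
    obtain ⟨c, rfl⟩ := Submodule.mem_span_singleton.mp hm
    have hc : c ≠ 0 := by
      rintro rfl
      exact hf3 ⟨hf1, by simpa using hn⟩
    have hf1' : n + c • g ∈ N' := hf1
    set f := c⁻¹ • n + g with hfdef
    have hf : f ∈ N' := by
      have := N'.smul_mem c⁻¹ hf1'
      rwa [smul_add, smul_smul, inv_mul_cancel₀ hc, one_smul] at this
    have heq : N' ⊓ (N ⊔ Submodule.span ℂ {g}) = (N' ⊓ N) ⊔ Submodule.span ℂ {f} := by
      apply le_antisymm
      · rintro x ⟨hx1, hx2⟩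
        obtain ⟨p, hp, q, hq, rfl⟩ := Submodule.mem_sup.mp hx2
        obtain ⟨d, rfl⟩ := Submodule.mem_span_singleton.mp hq
        have e : p + d • g = (p - d • c⁻¹ • n) + d • f := by
          rw [hfdef, smul_add]; abel
        have hx1' : p + d • g ∈ N' := hx1
        rw [e] at hx1' ⊢
        refine Submodule.add_mem_sup ⟨?_, ?_⟩
          (Submodule.smul_mem _ _ (Submodule.mem_span_singleton_self _))
        · exact (Submodule.add_mem_iff_left _ (N'.smul_mem _ hf)).mp hx1'
        · exact sub_mem hp (N.smul_mem _ (N.smul_mem _ hn))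
      · refine sup_le (inf_le_inf_left _ le_sup_left) ?_
        rw [Submodule.span_singleton_le_iff_mem]
        exact ⟨hf, Submodule.add_mem_sup (N.smul_mem _ hn) (Submodule.mem_span_singleton_self _)⟩
    rw [heq]
    refine .step f χ ih hχ fun a => ⟨sub_mem (hs f hf a) (N'.smul_mem _ hf), ?_⟩
    have e : leftTranslate a f - charFun χ a • f =
        (leftTranslate a (c⁻¹ • n) - charFun χ a • c⁻¹ • n) +
          (leftTranslate a g - charFun χ a • g) := by
      rw [hfdef, map_add, smul_add]; abel
    rw [e]
    have h2 := N.smul_mem c⁻¹ hn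
    exact add_mem (sub_mem (hN.translate_mem h2 a) (N.smul_mem _ h2)) (hg a)

end IsFlagged

/-- Every element of `V` lies in a flagged subspace of `V`. -/
def IsLocallyFlagged (X : Subgroup (G →* ℂˣ)) (V : Subalgebra ℂ (G → ℂ)) : Prop :=
  ∀ f ∈ V, ∃ N, IsFlagged X N ∧ f ∈ N ∧ N ≤ Subalgebra.toSubmodule V

theorem IsLocallyFlagged.exists_of_finset {V : Subalgebra ℂ (G → ℂ)} (hV : IsLocallyFlagged X V)
    (s : Finset (G → ℂ)) (hs : ∀ f ∈ s, f ∈ V) :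
    ∃ N, IsFlagged X N ∧ (∀ f ∈ s, f ∈ N) ∧ N ≤ Subalgebra.toSubmodule V := by
  classical
  induction s using Finset.induction_on with
  | empty =>
    obtain ⟨N, h1, -, h3⟩ := hV 1 V.one_mem
    exact ⟨N, h1, by simp, h3⟩
  | insert f s _ ih =>
    obtain ⟨N, h1, h2, h3⟩ := ih fun g hg => hs g (Finset.mem_insert_of_mem hg)
    obtain ⟨N', h1', h2', h3'⟩ := hV f (hs f (Finset.mem_insert_self _ _))
    refine ⟨N ⊔ N', h1.sup h1', fun g hg => ?_, sup_le h3 h3'⟩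
    rcases Finset.mem_insert.mp hg with rfl | hg
    · exact Submodule.mem_sup_right h2'
    · exact Submodule.mem_sup_left (h2 g hg)

/-! ### Faithful flatness -/

section Flatness

/-- Multiplying an eigenvector modulo `M` by a nonzero element of `charAlg X` does not bring it
into `M`. -/
theorem mem_of_smul_mem {M : Submodule (charAlg X) (G → ℂ)}
    (hM : ∀ f ∈ M, ∀ a, leftTranslate a f ∈ M) {f : G → ℂ} {χ : G →* ℂˣ}
    (hf : ∀ a, leftTranslate a f - charFun χ a • f ∈ M) {e : charAlg X} (he : e ≠ 0)
    (hef : e • f ∈ M) : f ∈ M := by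
  classical
  have he' : (e : G → ℂ) ∈ Submodule.span ℂ (charFun '' (X : Set (G →* ℂˣ))) := by
    rw [← charAlg_toSubmodule]; exact e.2
  rw [Set.image_eq_range, Finsupp.mem_span_range_iff_exists_finsupp] at he'
  obtain ⟨c, hc⟩ := he'
  let E (ψ : (X : Set (G →* ℂˣ))) : charAlg X := ⟨charFun ψ.1, charFun_mem ψ.2⟩
  have hec : e = ∑ ψ ∈ c.support, c ψ • E ψ := by
    apply Subtype.ext
    rw [← hc]
    simp [Finsupp.sum, E]
  -- Translating `e • f` by `a` multiplies each term of `e` by ψ(a), and modulo `M` it multiplies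
  -- `f` by χ(a). So `M` contains the combination of the vectors c ψ · ψ · f with coefficients
  -- (ψχ)(a).
  have key : ∀ a, ∑ ψ ∈ c.support, (charFun (ψ.1 * χ) a * c ψ) • (E ψ • f) ∈ M := by
    intro a
    have h1 := hM _ hef a
    have h2 : ∑ ψ ∈ c.support, (charFun (ψ.1 * χ) a * c ψ) • (E ψ • f) =
        leftTranslate a (e • f) -
          (∑ ψ ∈ c.support, (charFun ψ.1 a * c ψ) • E ψ) • (leftTranslate a f - charFun χ a • f) := by
      rw [hec]
      ext b
      simp only [Subalgebra.smul_def, smul_eq_mul, map_mul, Pi.sub_apply, Pi.mul_apply,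
        Finset.sum_apply, Pi.smul_apply, leftTranslate_apply, AddSubmonoidClass.coe_finsetSum,
        SetLike.val_smul, E, charFun_apply, MonoidHom.mul_apply, Units.val_mul, Finset.sum_mul]
      rw [← Finset.sum_sub_distrib]
      refine Finset.sum_congr rfl fun ψ _ => ?_
      ring
    rw [h2]
    exact sub_mem h1 (M.smul_mem _ (hf a))
  obtain ⟨ψ, hψ⟩ : ∃ ψ, c ψ ≠ 0 := by
    by_contra! h
    apply he
    rw [hec]
    simp [h]
  let MC := M.restrictScalars ℂ
  -- Every linear functional on the quotient by `M` turns `key` into a linear relation between the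
  -- distinct characters ψχ, so each coefficient vanishes separately.
  have hzero : MC.mkQ (c ψ • (E ψ • f)) = 0 := by
    rw [← Module.forall_dual_apply_eq_zero_iff ℂ]
    intro l
    have hli : LinearIndependent ℂ (fun ψ : (X : Set (G →* ℂˣ)) => charFun (ψ.1 * χ)) :=
      linearIndependent_charFun.comp (fun ψ : (X : Set (G →* ℂˣ)) => ψ.1 * χ)
        fun _ _ h => Subtype.ext (mul_right_cancel h)
    refine linearIndependent_iff'.mp hli c.support
      (fun ψ => l (MC.mkQ (c ψ • (E ψ • f)))) ?_ ψ (Finsupp.mem_support_iff.mpr hψ)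
    ext a
    have h0 : MC.mkQ (∑ ψ ∈ c.support, (charFun (ψ.1 * χ) a * c ψ) • (E ψ • f)) = 0 :=
      (Submodule.Quotient.mk_eq_zero _).mpr (key a)
    have h3 := congrArg l h0
    simp only [map_sum, map_zero, mul_smul] at h3
    simp only [map_smul, smul_eq_mul] at h3
    simp only [Finset.sum_apply, Pi.smul_apply, smul_eq_mul, Pi.zero_apply, map_smul]
    rw [← h3]
    exact Finset.sum_congr rfl fun ψ _ => by ring
  have h4 : c ψ • (E ψ • f) ∈ MC := (Submodule.Quotient.mk_eq_zero _).mp hzero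
  have h5 : E ψ • f ∈ M := (MC.smul_mem_iff hψ).mp h4
  -- Multiplication by ψ⁻¹ in `charAlg X` frees `f` from the unit ψ.
  have h6 := M.smul_mem (⟨charFun ψ.1⁻¹, charFun_mem (X.inv_mem ψ.2)⟩ : charAlg X) h5
  convert h6 using 1
  ext a
  simp [Subalgebra.smul_def, E]

/-- The `charAlg X`-module generated by a flagged space. -/
theorem IsFlagged.free_span {N : Submodule ℂ (G → ℂ)} (hN : IsFlagged X N) :
    ∀ M : Submodule (charAlg X) (G → ℂ), M = Submodule.span (charAlg X) (N : Set (G → ℂ)) →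
      (∀ f ∈ M, ∀ a, leftTranslate a f ∈ M) ∧ Module.Free (charAlg X) M ∧
        ∃ r : M →ₗ[charAlg X] charAlg X, ∀ h1 : (1 : G → ℂ) ∈ M, r ⟨1, h1⟩ = 1 := by
  have hstable {N : Submodule ℂ (G → ℂ)} (hN : IsFlagged X N) : ∀ f ∈
      Submodule.span (charAlg X) (N : Set (G → ℂ)), ∀ a,
        leftTranslate a f ∈ Submodule.span (charAlg X) (N : Set (G → ℂ)) := by
    intro f hf a
    induction hf using Submodule.span_induction with
    | mem x hx => exact Submodule.subset_span (hN.translate_mem hx a)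
    | zero => rw [map_zero]; exact zero_mem _
    | add x y _ _ hx hy => rw [map_add]; exact add_mem hx hy
    | smul e x _ hx =>
      have he : leftTranslate a (e : G → ℂ) ∈ charAlg X := by
        refine charAlg_induction (X := X) (p := fun f => leftTranslate a f ∈ charAlg X)
          (fun χ hχ => ?_) ?_ (fun f g hf hg => ?_) (fun c f hf => ?_) e.2
        · rw [leftTranslate_charFun]
          exact (charAlg X).smul_mem (charFun_mem hχ) _
        · rw [map_zero]; exact zero_mem _
        · rw [map_add]; exact add_mem hf hg
        · rw [map_smul]; exact (charAlg X).smul_mem hf _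
      rw [Subalgebra.smul_def, smul_eq_mul, map_mul]
      exact Submodule.smul_mem _ (⟨_, he⟩ : charAlg X) hx
  induction hN with
  | one =>
    rintro M rfl
    refine ⟨hstable .one, ?_⟩
    -- The constants generate `charAlg X` itself, and the functional is the identity.
    have e : Submodule.span (charAlg X) ((Submodule.span ℂ {(1 : G → ℂ)} : Submodule ℂ (G → ℂ)) :
        Set (G → ℂ)) = LinearMap.range (Algebra.linearMap (charAlg X) (G → ℂ)) := by
      rw [Submodule.span_span_of_tower, LinearMap.range_eq_map, ← Ideal.span_singleton_one]
      change _ = Submodule.map _ (Submodule.span _ _)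
      rw [Submodule.map_span, Set.image_singleton]
      simp
    rw [e]
    let eq := LinearEquiv.ofInjective (Algebra.linearMap (charAlg X) (G → ℂ))
      Subtype.val_injective
    refine ⟨Module.Free.of_equiv eq, eq.symm.toLinearMap, fun h1 => ?_⟩
    apply eq.injective
    apply Subtype.ext
    rw [LinearEquiv.coe_coe, eq.apply_symm_apply]
    rfl
  | @step N f χ hN hχ hf ih =>
    rintro M rfl
    refine ⟨hstable (.step f χ hN hχ hf), ?_⟩
    set M := Submodule.span (charAlg X) (N : Set (G → ℂ))
    obtain ⟨h1, h2, r, hr⟩ := ih M rfl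
    have e : Submodule.span (charAlg X)
        ((N ⊔ Submodule.span ℂ {f} : Submodule ℂ (G → ℂ)) : Set (G → ℂ)) =
        M ⊔ Submodule.span (charAlg X) {f} := by
      apply le_antisymm
      · rw [Submodule.span_le]
        intro x hx
        obtain ⟨n, hn, m, hm, rfl⟩ := Submodule.mem_sup.mp hx
        obtain ⟨c, rfl⟩ := Submodule.mem_span_singleton.mp hm
        refine Submodule.add_mem_sup (Submodule.subset_span hn) ?_
        exact (Submodule.restrictScalars ℂ (Submodule.span (charAlg X) {f})).smul_mem c
          (Submodule.mem_span_singleton_self _)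
      · refine sup_le (Submodule.span_mono (fun x hx => Submodule.mem_sup_left hx)) ?_
        rw [Submodule.span_singleton_le_iff_mem]
        exact Submodule.subset_span (Submodule.mem_sup_right (Submodule.mem_span_singleton_self _))
    have h1M : (1 : G → ℂ) ∈ M := Submodule.subset_span hN.one_mem
    rw [e]
    by_cases hfM : f ∈ M
    · rw [sup_eq_left.mpr ((Submodule.span_singleton_le_iff_mem _ _).mpr hfM)]
      exact ⟨h2, r, hr⟩
    -- As `f` is not in `M`, no nonzero multiple of it is, by `mem_of_smul_mem`. So the sum is
    -- direct and the new summand is free; the functional is extended by zero on it.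
    let l : (M × charAlg X) →ₗ[charAlg X] (G → ℂ) :=
      M.subtype.coprod (LinearMap.toSpanSingleton (charAlg X) (G → ℂ) f)
    have hl : Function.Injective l := by
      rw [injective_iff_map_eq_zero]
      rintro ⟨m, e⟩ h
      have h' : (m : G → ℂ) + e • f = 0 := h
      have he : e = 0 := by
        by_contra he
        refine hfM (mem_of_smul_mem h1 (fun a => Submodule.subset_span (hf a)) he ?_)
        rw [eq_neg_of_add_eq_zero_right h']
        exact neg_mem m.2
      subst he
      refine Prod.ext (Subtype.ext ?_) rfl
      simpa using h'
    have hrange : LinearMap.range l = M ⊔ Submodule.span (charAlg X) {f} := by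
      rw [LinearMap.range_coprod, Submodule.range_subtype, LinearMap.range_toSpanSingleton]
    rw [← hrange]
    let eq := LinearEquiv.ofInjective l hl
    refine ⟨Module.Free.of_equiv eq,
      r.comp ((LinearMap.fst _ _ _).comp eq.symm.toLinearMap), fun h => ?_⟩
    have : eq.symm ⟨1, h⟩ = (⟨1, h1M⟩, 0) := by
      rw [LinearEquiv.symm_apply_eq]
      apply Subtype.ext
      simp [eq, l]
    simp [this, hr]

/-- Flatness: a linear relation between finitely many vectors lies in some free `S`, where it is
trivial. Faithfulness: if I·W = W, then `w` lies in I·S for some `S`, and the functional `r` gives 1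
∈ I. -/
theorem faithfullyFlat_of_cover {R W : Type*} [CommRing R] [AddCommGroup W] [Module R W] (w : W)
    (P : Set (Submodule R W)) (hcover : ∀ s : Finset W, ∃ S ∈ P, ∀ v ∈ s, v ∈ S)
    (hP : ∀ S ∈ P, Module.Free R S ∧ ∃ r : S →ₗ[R] R, ∀ h : w ∈ S, r ⟨w, h⟩ = 1) :
    Module.FaithfullyFlat R W := by
  classical
  rw [Module.FaithfullyFlat.iff_flat_and_proper_ideal]
  constructor
  · refine Module.Flat.of_forall_isTrivialRelation fun {l e x} hx => ?_
    obtain ⟨S, hS, hxS⟩ := hcover (Finset.univ.image x)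
    have hmem : ∀ i, x i ∈ S := fun i => hxS _ (Finset.mem_image_of_mem _ (Finset.mem_univ i))
    obtain ⟨hfree, -⟩ := hP S hS
    have hx' : ∑ i, e i • (⟨x i, hmem i⟩ : S) = 0 := by
      apply Subtype.ext
      simpa using hx
    obtain ⟨κ, a, y, h1, h2⟩ := Module.Flat.isTrivialRelation_of_sum_smul_eq_zero hx'
    refine ⟨κ, a, fun j => y j, fun i => ?_, h2⟩
    have := congrArg Subtype.val (h1 i)
    simpa using this
  · intro I hI htop
    -- The set `s` collects the vectors in an expression of `v` as an element of I·W. Once `S`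
    -- contains them, every functional on `S` takes `v` into `I`.
    have key : ∀ v ∈ (I • ⊤ : Submodule R W), ∃ s : Finset W, ∀ S : Submodule R W,
        (∀ v ∈ s, v ∈ S) → ∃ hv : v ∈ S, ∀ r : S →ₗ[R] R, r ⟨v, hv⟩ ∈ I := by
      intro v hv
      refine Submodule.smul_induction_on hv (fun e he v _ => ?_) ?_
      · refine ⟨{v}, fun S hS => ?_⟩
        have hv : v ∈ S := hS v (Finset.mem_singleton_self v)
        refine ⟨S.smul_mem e hv, fun r => ?_⟩
        have : (⟨e • v, S.smul_mem e hv⟩ : S) = e • ⟨v, hv⟩ := rfl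
        rw [this, map_smul]
        exact I.mul_mem_right _ he
      · rintro v v' ⟨s, hs⟩ ⟨s', hs'⟩
        refine ⟨s ∪ s', fun S hS => ?_⟩
        obtain ⟨hv, hr⟩ := hs S fun u hu => hS u (Finset.mem_union_left _ hu)
        obtain ⟨hv', hr'⟩ := hs' S fun u hu => hS u (Finset.mem_union_right _ hu)
        refine ⟨add_mem hv hv', fun r => ?_⟩
        have : (⟨v + v', add_mem hv hv'⟩ : S) = ⟨v, hv⟩ + ⟨v', hv'⟩ := rfl
        rw [this, map_add]
        exact add_mem (hr r) (hr' r)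
    obtain ⟨s, hs⟩ := key w (by rw [htop]; trivial)
    obtain ⟨S, hS, hsS⟩ := hcover s
    obtain ⟨-, r, hr1⟩ := hP S hS
    obtain ⟨hw, hr⟩ := hs S hsS
    exact hI ((Ideal.eq_top_iff_one I).mpr (hr1 hw ▸ hr r))

/-- `V` is covered by the modules that its flagged subspaces generate, each free with a functional
taking 1 to 1. -/
theorem IsLocallyFlagged.faithfullyFlat {V : Subalgebra ℂ (G → ℂ)} [IsHopfSubalgebra V]
    (hV : IsLocallyFlagged X V) (h : charAlg X ≤ V) : SpecEpi (inclusionHom h) := by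
  classical
  let algV : Algebra (charAlg X) V :=
    ((inclusionHom h : charAlg X →ₐ[ℂ] V) : charAlg X →+* V).toAlgebra
  change Module.FaithfullyFlat (charAlg X) V
  let val : V →ₗ[charAlg X] (G → ℂ) :=
    { toFun := Subtype.val, map_add' := fun _ _ => rfl, map_smul' := fun _ _ => rfl }
  have hval : Function.Injective val := Subtype.val_injective
  let S (N : Submodule ℂ (G → ℂ)) : Submodule (charAlg X) V :=
    (Submodule.span (charAlg X) (N : Set (G → ℂ))).comap val
  have hS {N : Submodule ℂ (G → ℂ)} (hN : IsFlagged X N) (hNV : N ≤ Subalgebra.toSubmodule V) :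
      Module.Free (charAlg X) (S N) ∧
        ∃ r : S N →ₗ[charAlg X] charAlg X, ∀ h1 : (1 : V) ∈ S N, r ⟨1, h1⟩ = 1 := by
    obtain ⟨-, h1, r, hr⟩ := hN.free_span _ rfl
    have hle : Submodule.span (charAlg X) (N : Set (G → ℂ)) ≤ LinearMap.range val := by
      rw [Submodule.span_le]
      exact fun f hf => ⟨⟨f, hNV hf⟩, rfl⟩
    have hmap : (S N).map val = Submodule.span (charAlg X) (N : Set (G → ℂ)) :=
      (Submodule.map_comap_eq _ _).trans (inf_eq_right.mpr hle)
    let eq : S N ≃ₗ[charAlg X] Submodule.span (charAlg X) (N : Set (G → ℂ)) :=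
      (Submodule.equivMapOfInjective val hval (S N)).trans (LinearEquiv.ofEq _ _ hmap)
    exact ⟨Module.Free.of_equiv eq.symm, r.comp eq.toLinearMap, fun h1 => hr _⟩
  refine faithfullyFlat_of_cover (1 : V)
    {T | ∃ N, IsFlagged X N ∧ N ≤ Subalgebra.toSubmodule V ∧ T = S N} (fun s => ?_) ?_
  · obtain ⟨N, hN, hsN, hNV⟩ := hV.exists_of_finset (s.image Subtype.val)
      (by simp only [Finset.mem_image]; rintro _ ⟨v, -, rfl⟩; exact v.2)
    exact ⟨S N, ⟨N, hN, hNV, rfl⟩, fun v hv =>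
      Submodule.subset_span (hsN _ (Finset.mem_image_of_mem _ hv))⟩
  · rintro _ ⟨N, hN, hNV, rfl⟩
    exact hS hN hNV

end Flatness

end Characters

end ExpIterInt

end

noncomputable section
namespace ExpIterInt
universe u

/-! ### Prodiagonalizable groups -/

section Diagonalizable

variable {G : Type u} [Group G] {X : Subgroup (G →* ℂˣ)}

theorem charAlg_mono {X Y : Subgroup (G →* ℂˣ)} (h : X ≤ Y) : charAlg X ≤ charAlg Y :=
  Algebra.adjoin_mono (Set.image_mono h)

/-- A homomorphism from ℤ^m to the characters extends to the group algebra. It preserves coproducts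
because characters are group-like, and it is onto because the characters in its range span. -/
theorem isDiagonalizable_charAlg_range {m : ℕ} (p : Multiplicative (Fin m → ℤ) →* (G →* ℂˣ)) :
    IsDiagonalizable (charAlg p.range) := by
  let P : Multiplicative (Fin m → ℤ) →* charAlg p.range :=
    { toFun := fun c => ⟨charFun (p c), charFun_mem ⟨c, rfl⟩⟩
      map_one' := by apply Subtype.ext; simp
      map_mul' := fun c d => by apply Subtype.ext; simp }
  let F : AddMonoidAlgebra ℂ (Fin m → ℤ) →ₐ[ℂ] charAlg p.range :=
    AddMonoidAlgebra.lift ℂ (charAlg p.range) (Fin m → ℤ) P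
  refine ⟨m, BialgHom.ofAlgHom F ?_ ?_, ?_⟩
  · ext c
    change ((F (AddMonoidAlgebra.single c 1) : charAlg p.range) : G → ℂ) 1 = _
    simp [F, P]
  · ext c
    simp only [AlgHom.comp_apply, Bialgebra.comulAlgHom_apply]
    refine pairAt_separating _ fun a b => ?_
    rw [pairAt_comul]
    simp [F, P]
  · rintro ⟨f, hf⟩
    suffices ∃ y, ((F y : charAlg p.range) : G → ℂ) = f by
      obtain ⟨y, hy⟩ := this
      exact ⟨y, Subtype.ext hy⟩
    refine charAlg_induction (X := p.range) (p := fun f => ∃ y, ((F y : charAlg p.range) : G → ℂ) = f)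
      ?_ ⟨0, by simp⟩ ?_ ?_ hf
    · rintro _ ⟨c, rfl⟩
      exact ⟨AddMonoidAlgebra.single (Multiplicative.toAdd c) 1, by simp [F, P]⟩
    · rintro f g ⟨y, hy⟩ ⟨z, hz⟩
      exact ⟨y + z, by rw [map_add, ← hy, ← hz]; rfl⟩
    · rintro c f ⟨y, hy⟩
      exact ⟨algebraMap ℂ _ c * y, by rw [map_mul, AlgHom.commutes, ← hy]; ext a; rfl⟩

theorem exists_finset_mem_charAlg_closure {f : G → ℂ} (hf : f ∈ charAlg X) :
    ∃ T : Finset (G →* ℂˣ), (T : Set (G →* ℂˣ)) ⊆ X ∧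
      f ∈ charAlg (Subgroup.closure (T : Set (G →* ℂˣ))) := by
  classical
  refine charAlg_induction (X := X) (p := fun f => ∃ T : Finset (G →* ℂˣ),
    (T : Set (G →* ℂˣ)) ⊆ X ∧ f ∈ charAlg (Subgroup.closure (T : Set (G →* ℂˣ)))) ?_ ?_ ?_ ?_ hf
  · intro χ hχ
    exact ⟨{χ}, by simpa using hχ, charFun_mem (Subgroup.subset_closure (by simp))⟩
  · exact ⟨∅, by simp, zero_mem _⟩
  · rintro f g ⟨T, hT, hf⟩ ⟨T', hT', hg⟩
    refine ⟨T ∪ T', by simp [hT, hT'], add_mem (charAlg_mono ?_ hf) (charAlg_mono ?_ hg)⟩ <;>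
    · apply Subgroup.closure_mono
      simp
  · rintro c f ⟨T, hT, hf⟩
    exact ⟨T, hT, Subalgebra.smul_mem _ hf c⟩

variable (X) in
theorem isProdiagonalizable_charAlg : IsProdiagonalizable (charAlg X) := by
  classical
  intro s
  have hT : ∃ T : Finset (G →* ℂˣ), (T : Set (G →* ℂˣ)) ⊆ X ∧
      ∀ f ∈ s, (f : G → ℂ) ∈ charAlg (Subgroup.closure (T : Set (G →* ℂˣ))) := by
    induction s using Finset.induction_on with
    | empty => exact ⟨∅, by simp, by simp⟩
    | insert f s _ ih =>
      obtain ⟨T, h1, h2⟩ := ih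
      obtain ⟨T', h1', h2'⟩ := exists_finset_mem_charAlg_closure f.2
      refine ⟨T ∪ T', by simp [h1, h1'], fun g hg => ?_⟩
      rcases Finset.mem_insert.mp hg with rfl | hg
      · exact charAlg_mono (Subgroup.closure_mono (by simp)) h2'
      · exact charAlg_mono (Subgroup.closure_mono (by simp)) (h2 g hg)
  obtain ⟨T, hTX, hs⟩ := hT
  -- An exponent vector goes to the corresponding monomial in the characters of `T`, so the range is
  -- the group that they generate.
  let p : Multiplicative (Fin T.card → ℤ) →* (G →* ℂˣ) :=
    ∏ i, (zpowersHom (G →* ℂˣ) (T.equivFin.symm i)).comp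
      (AddMonoidHom.toMultiplicative (Pi.evalAddMonoidHom (fun _ => ℤ) i))
  have hp : ∀ c, p c = ∏ i, (T.equivFin.symm i : G →* ℂˣ) ^ (Multiplicative.toAdd c i : ℤ) := by
    intro c
    simp only [p, MonoidHom.finsetProd_apply]
    rfl
  have hle : p.range ≤ X := by
    rintro _ ⟨c, rfl⟩
    rw [hp]
    exact X.prod_mem fun i _ => X.zpow_mem (hTX (T.equivFin.symm i).2) _
  have hge : Subgroup.closure (T : Set (G →* ℂˣ)) ≤ p.range := by
    rw [Subgroup.closure_le]
    intro χ hχ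
    refine ⟨Multiplicative.ofAdd (Pi.single (T.equivFin ⟨χ, hχ⟩) 1), ?_⟩
    rw [hp, Finset.prod_eq_single (T.equivFin ⟨χ, hχ⟩)]
    · rw [toAdd_ofAdd, Pi.single_eq_same, Equiv.symm_apply_apply]
      exact zpow_one χ
    · intro j _ hj
      rw [toAdd_ofAdd, Pi.single_eq_of_ne hj]
      exact zpow_zero (T.equivFin.symm j : G →* ℂˣ)
    · intro h
      exact absurd (Finset.mem_univ _) h
  refine ⟨charAlg p.range, inferInstance, inferInstance, inclusionHom (charAlg_mono hle),
    fun f g h => ?_, fun f hf => ?_, isDiagonalizable_charAlg_range p⟩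
  · apply Subtype.ext
    exact congrArg (fun f : charAlg X => (f : G → ℂ)) h
  · exact ⟨⟨f, charAlg_mono hge (hs f hf)⟩, rfl⟩

end Diagonalizable

/-! ### Hopf subalgebras generated by unitriangular matrices -/

section Unitriangular

variable {K : Type u} [CommRing K] [HopfAlgebra ℂ K] {m : ℕ} {a : Matrix (Fin m) (Fin m) K}

/-- The subalgebra generated by the entries of a matrix. -/
abbrev entryAlg (a : Matrix (Fin m) (Fin m) K) : Subalgebra ℂ K :=
  Algebra.adjoin ℂ {b | ∃ i j, b = a i j}

/-- A matrix, as a matrix over the subalgebra generated by its entries. -/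
def entryMatrix (a : Matrix (Fin m) (Fin m) K) : Matrix (Fin m) (Fin m) (entryAlg a) :=
  fun i j => ⟨a i j, Algebra.subset_adjoin ⟨i, j, rfl⟩⟩

/-- Only the antipode needs an argument. The matrix has determinant 1, so its inverse already has
entries in the algebra they generate; by the antipode axiom, applying the antipode entrywise also
gives an inverse, and inverses are unique. -/
theorem isSubHopf_entryAlg (hdiag : ∀ i, a i i = 1) (htri : ∀ i j, j < i → a i j = 0)
    (hcomul : ∀ i j, Coalgebra.comul (R := ℂ) (a i j) = ∑ k, a i k ⊗ₜ[ℂ] a k j)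
    (hcounit : ∀ i j, Coalgebra.counit (R := ℂ) (a i j) = if i = j then 1 else 0) :
    IsSubHopf (entryAlg a) := by
  have h1 : entryAlg a ≤ Subalgebra.comap (Bialgebra.comulAlgHom ℂ K)
      (Algebra.TensorProduct.map (entryAlg a).val (entryAlg a).val).range := by
    refine Algebra.adjoin_le ?_
    rintro _ ⟨i, j, rfl⟩
    refine ⟨∑ k, entryMatrix a i k ⊗ₜ entryMatrix a k j, ?_⟩
    simp [hcomul, entryMatrix]
  have hdet : (entryMatrix a).det = 1 := by
    rw [Matrix.det_of_isUpperTriangular]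
    · refine Finset.prod_eq_one fun i _ => Subtype.ext (hdiag i)
    · intro i j hij
      exact Subtype.ext (htri i j hij)
  have hinv : entryMatrix a * (entryMatrix a)⁻¹ = 1 :=
    Matrix.mul_nonsing_inv _ (by rw [hdet]; exact isUnit_one)
  have hanti : (a.map (HopfAlgebra.antipode ℂ)) * a = 1 := by
    ext i j
    have h := HopfAlgebra.mul_antipode_rTensor_comul_apply (R := ℂ) (a i j)
    rw [hcomul, hcounit] at h
    simp only [map_sum, LinearMap.rTensor_tmul, LinearMap.mul'_apply] at h
    rw [Matrix.mul_apply, Matrix.one_apply]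
    simp only [Matrix.map_apply]
    rw [h]
    split_ifs <;> simp
  have hinv' : a * ((entryMatrix a)⁻¹).map (entryAlg a).val = 1 := by
    have h := congrArg (fun N => Matrix.map N (entryAlg a).val) hinv
    rw [Matrix.map_mul] at h
    refine h.trans ?_
    exact Matrix.map_one _ rfl rfl
  have heq := left_inv_eq_right_inv hanti hinv'
  have h2 : entryAlg a ≤ Subalgebra.comap (HopfAlgebra.antipodeAlgHom ℂ K) (entryAlg a) := by
    refine Algebra.adjoin_le ?_
    rintro _ ⟨i, j, rfl⟩
    have := congrFun (congrFun heq i) j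
    rw [Matrix.map_apply, Matrix.map_apply] at this
    change HopfAlgebra.antipode ℂ (a i j) ∈ entryAlg a
    rw [this]
    exact ((entryMatrix a)⁻¹ i j).2
  exact ⟨fun b => h1 b.2, fun b => h2 b.2⟩

theorem isUnipotent_entryAlg [IsSubHopf (entryAlg a)] (hdiag : ∀ i, a i i = 1)
    (htri : ∀ i j, j < i → a i j = 0)
    (hcomul : ∀ i j, Coalgebra.comul (R := ℂ) (a i j) = ∑ k, a i k ⊗ₜ[ℂ] a k j) :
    IsUnipotent (entryAlg a) := by
  refine ⟨m, entryMatrix a, fun i => Subtype.ext (hdiag i),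
    fun i j h => Subtype.ext (htri i j h), fun i j => ?_, ?_⟩
  · apply map_val_injective
    rw [map_val_comul]
    simp [entryMatrix, hcomul]
  · rw [← Algebra.adjoin_adjoin_coe_preimage]
    congr 1
    ext b
    constructor
    · rintro ⟨i, j, rfl⟩
      exact ⟨i, j, rfl⟩
    · rintro ⟨i, j, h⟩
      exact ⟨i, j, Subtype.ext h⟩

end Unitriangular

/-! ### The kernel is prounipotent -/

section Kernel

variable {G : Type u} [Group G] {X : Subgroup (G →* ℂˣ)}

/-- A basis adapted to the flag makes left translations triangular, with the characters of the steps
on the diagonal. -/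
theorem IsFlagged.exists_matrix {N : Submodule ℂ (G → ℂ)} (hN : IsFlagged X N) :
    ∃ (m : ℕ) (b : Fin m → G → ℂ) (a : Fin m → Fin m → G → ℂ), LinearIndependent ℂ b ∧
      Submodule.span ℂ (Set.range b) = N ∧ (∀ i, ∃ χ ∈ X, a i i = charFun χ) ∧
      (∀ i j, j < i → a i j = 0) ∧ ∀ g i, leftTranslate g (b i) = ∑ j, a i j g • b j := by
  induction hN with
  | one =>
    refine ⟨1, fun _ => 1, fun _ _ => 1, ?_, ?_, fun _ => ⟨1, X.one_mem, rfl⟩, ?_, ?_⟩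
    · rw [linearIndependent_unique_iff]
      exact one_ne_zero
    · simp
    · intro i j h
      omega
    · intro g i
      simp
  | @step N f χ hN hχ hf ih =>
    obtain ⟨m, b, a, hli, hspan, hdiag, htri, htrans⟩ := ih
    by_cases hfN : f ∈ N
    · rw [sup_eq_left.mpr ((Submodule.span_singleton_le_iff_mem _ _).mpr hfN)]
      exact ⟨m, b, a, hli, hspan, hdiag, htri, htrans⟩
    have hc : ∀ g, ∃ c : Fin m → ℂ, ∑ j, c j • b j = leftTranslate g f - charFun χ g • f := by
      intro g
      rw [← Submodule.mem_span_range_iff_exists_fun, hspan]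
      exact hf g
    choose c hc using hc
    -- The newest vector is put first: its translates involve itself and the older vectors, which
    -- makes the matrix upper triangular.
    refine ⟨m + 1, Fin.cons f b, Fin.cons (Fin.cons (charFun χ) fun j g => c g j)
      fun i => Fin.cons 0 (a i), ?_, ?_, ?_, ?_, ?_⟩
    · exact hli.finCons (by rwa [hspan])
    · rw [Fin.range_cons, Submodule.span_insert, hspan, sup_comm]
    · intro i
      refine Fin.cases ⟨χ, hχ, rfl⟩ (fun i => ?_) i
      simpa using hdiag i
    · intro i j
      refine Fin.cases (fun h => absurd h (Fin.not_lt_zero _)) (fun i => ?_) i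
      refine Fin.cases (fun _ => rfl) (fun j h => ?_) j
      simpa using htri i j (Fin.succ_lt_succ_iff.mp h)
    · intro g i
      refine Fin.cases ?_ (fun i => ?_) i
      · simp [Fin.sum_univ_succ, hc]
      · simp [Fin.sum_univ_succ, htrans]

theorem exists_dual_of_linearIndependent {k W ι : Type*} [Field k] [AddCommGroup W] [Module k W]
    [DecidableEq ι] {b : ι → W} (hb : LinearIndependent k b) (j : ι) :
    ∃ l : W →ₗ[k] k, ∀ i, l (b i) = if i = j then 1 else 0 := by
  obtain ⟨l, hl⟩ := LinearMap.exists_extend ((Finsupp.lapply j).comp hb.repr)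
  refine ⟨l, fun i => ?_⟩
  have h := LinearMap.congr_fun hl ⟨b i, Submodule.subset_span ⟨i, rfl⟩⟩
  rw [LinearMap.comp_apply, Submodule.subtype_apply] at h
  rw [h, LinearMap.comp_apply, hb.repr_eq_single i _ rfl]
  simp [Finsupp.single_apply]

theorem exists_sum_of_isHopfSubalgebra {V : Subalgebra ℂ (G → ℂ)} [hV : IsHopfSubalgebra V]
    {f : G → ℂ} (hf : f ∈ V) : ∃ S : Finset (V × V), ∀ x y,
      f (x * y) = ∑ p ∈ S, (p.1 : G → ℂ) x * (p.2 : G → ℂ) y := by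
  obtain ⟨t, ht⟩ := hV.comul ⟨f, hf⟩
  obtain ⟨S, rfl⟩ := TensorProduct.exists_finset t
  exact ⟨S, fun x y => (ht x y).symm.trans (by simp)⟩

/-- Translation coefficients are elements of the Hopf algebra: they arise by applying dual
functionals to the second factor of a coproduct. Uniqueness of coordinates turns `leftTranslate` of
a product, and of 1, into the comatrix identities. -/
theorem IsFlagged.exists_comatrix {V : Subalgebra ℂ (G → ℂ)} [hV : IsHopfSubalgebra V]
    {N : Submodule ℂ (G → ℂ)} (hN : IsFlagged X N) (hNV : N ≤ Subalgebra.toSubmodule V) :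
    ∃ (m : ℕ) (a : Matrix (Fin m) (Fin m) V),
      (∀ i, ∃ χ ∈ X, (a i i : G → ℂ) = charFun χ) ∧ (∀ i j, j < i → a i j = 0) ∧
      (∀ i j, Coalgebra.comul (R := ℂ) (a i j) = ∑ k, a i k ⊗ₜ[ℂ] a k j) ∧
      (∀ i j, Coalgebra.counit (R := ℂ) (a i j) = if i = j then 1 else 0) ∧
      ∀ f ∈ N, ∃ c : Fin m → Fin m → ℂ, f = ∑ i, ∑ j, c i j • (a i j : G → ℂ) := by
  obtain ⟨m, b, a, hli, hspan, hdiag, htri, htrans⟩ := hN.exists_matrix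
  have hbN : ∀ i, b i ∈ N := fun i => hspan ▸ Submodule.subset_span ⟨i, rfl⟩
  have hval : ∀ g i h, b i (g * h) = ∑ j, a i j g * b j h := by
    intro g i h
    have := congrFun (htrans g i) h
    simpa using this
  have huniq : ∀ c d : Fin m → ℂ, (∑ j, c j • b j = ∑ j, d j • b j) → c = d := by
    intro c d h
    ext j
    rw [← sub_eq_zero]
    refine Fintype.linearIndependent_iff.mp hli (fun j => c j - d j) ?_ j
    simp [sub_smul, h]
  have hmem : ∀ i j, a i j ∈ V := by
    intro i j
    obtain ⟨l, hl⟩ := exists_dual_of_linearIndependent hli j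
    obtain ⟨S, hS⟩ := exists_sum_of_isHopfSubalgebra (hNV (hbN i))
    have : a i j = ∑ p ∈ S, l p.2 • (p.1 : G → ℂ) := by
      ext g
      have h1 : leftTranslate g (b i) = ∑ p ∈ S, (p.1 : G → ℂ) g • (p.2 : G → ℂ) := by
        ext h
        simp [hS]
      rw [htrans] at h1
      have h2 := congrArg l h1
      simp only [map_sum, map_smul, hl, smul_eq_mul, mul_ite, mul_one, mul_zero,
        Finset.sum_ite_eq', Finset.mem_univ, if_true] at h2
      simp [h2, mul_comm]
    rw [this]
    exact sum_mem fun p _ => V.smul_mem p.1.2 _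
  have hmul : ∀ g h i l, a i l (g * h) = ∑ j, a i j g * a j l h := by
    intro g h i l
    refine congrFun (huniq (fun l => a i l (g * h)) (fun l => ∑ j, a i j g * a j l h) ?_) l
    ext x
    simp only [Finset.sum_apply, Pi.smul_apply, smul_eq_mul]
    rw [← hval, mul_assoc, hval]
    simp_rw [hval, Finset.mul_sum, Finset.sum_mul]
    rw [Finset.sum_comm]
    exact Finset.sum_congr rfl fun _ _ => Finset.sum_congr rfl fun _ _ => by ring
  have hone : ∀ i j, a i j 1 = if i = j then 1 else 0 := by
    intro i j
    refine congrFun (huniq (fun j => a i j 1) (fun j => if i = j then 1 else 0) ?_) j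
    ext x
    simp only [Finset.sum_apply, Pi.smul_apply, smul_eq_mul]
    rw [← hval]
    simp
  refine ⟨m, fun i j => ⟨a i j, hmem i j⟩, hdiag, fun i j h => Subtype.ext (htri i j h),
    fun i j => ?_, hone, fun f hf => ?_⟩
  · refine pairAt_separating V fun g h => ?_
    rw [pairAt_comul]
    simp [hmul]
  · rw [← hspan, Submodule.mem_span_range_iff_exists_fun] at hf
    obtain ⟨c, rfl⟩ := hf
    -- Evaluating a translate of `b i` at 1 gives b i (g) = Σ a i j (g) · b j (1), so the
    -- coefficients recover the space.
    refine ⟨fun i j => c i * b j 1, ?_⟩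
    ext g
    simp only [Finset.sum_apply, Pi.smul_apply, smul_eq_mul]
    refine Finset.sum_congr rfl fun i _ => ?_
    have := hval g i 1
    rw [mul_one] at this
    rw [this, Finset.mul_sum]
    exact Finset.sum_congr rfl fun _ _ => by ring

variable {V E : Subalgebra ℂ (G → ℂ)} [hV : IsHopfSubalgebra V] [hE : IsHopfSubalgebra E]

/-- The ideal of the kernel of the homomorphism dual to an inclusion. -/
def kernelIdeal (h : E ≤ V) : Ideal V :=
  Ideal.map (inclusionHom h) (RingHom.ker (Bialgebra.counitAlgHom ℂ E))

/-- Functions from `E` become constant on the kernel, since `e - e 1` lies in the augmentation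
ideal. -/
theorem inclusion_sub_counit_mem (h : E ≤ V) (e : E) :
    Ideal.Quotient.mkₐ ℂ (kernelIdeal h) (Subalgebra.inclusion h e) =
      algebraMap ℂ _ ((e : G → ℂ) 1) := by
  have h1 : e - algebraMap ℂ E ((e : G → ℂ) 1) ∈ RingHom.ker (Bialgebra.counitAlgHom ℂ E) := by
    rw [RingHom.mem_ker]
    change (e : G → ℂ) 1 - (e : G → ℂ) 1 = 0
    rw [sub_self]
  have h2 := Ideal.mem_map_of_mem (inclusionHom h) h1
  rw [map_sub] at h2
  have h3 := (Ideal.Quotient.mk_eq_mk_iff_sub_mem (I := kernelIdeal h)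
    (inclusionHom h e) (inclusionHom h (algebraMap ℂ E ((e : G → ℂ) 1)))).mpr h2
  refine h3.trans ?_
  rfl

/-- It suffices to test generators `e` with `e 1 = 0`. Modulo the ideal in both factors, the
coproduct of `e` collapses to its value at `(1, 1)`, which is `e 1`. -/
instance kernelIdeal_isHopfIdeal (h : E ≤ V) : (kernelIdeal h).IsHopfIdeal ℂ := by
  have hcoun : kernelIdeal h ≤ RingHom.ker (Bialgebra.counitAlgHom ℂ V) := by
    refine Ideal.map_le_iff_le_comap.mpr ?_
    intro e he
    exact he
  let q := Ideal.Quotient.mkₐ ℂ (kernelIdeal h)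
  have hcomul : kernelIdeal h ≤ RingHom.ker
      ((Algebra.TensorProduct.map q q).comp (Bialgebra.comulAlgHom ℂ V)) := by
    refine Ideal.map_le_iff_le_comap.mpr ?_
    intro e he
    rw [Ideal.mem_comap, RingHom.mem_ker]
    have key : ∀ t : E ⊗[ℂ] E, Algebra.TensorProduct.map q q
        (Algebra.TensorProduct.map (Subalgebra.inclusion h) (Subalgebra.inclusion h) t) =
          algebraMap ℂ _ (pairAt E 1 1 t) := by
      intro t
      induction t with
      | zero => simp
      | tmul x y =>
        rw [Algebra.TensorProduct.map_tmul, Algebra.TensorProduct.map_tmul,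
          inclusion_sub_counit_mem, inclusion_sub_counit_mem, pairAt_tmul,
          Algebra.TensorProduct.algebraMap_apply, Algebra.algebraMap_eq_smul_one,
          Algebra.algebraMap_eq_smul_one, Algebra.algebraMap_eq_smul_one,
          TensorProduct.smul_tmul_smul, TensorProduct.smul_tmul']
      | add x y hx hy => simp only [map_add, hx, hy]
    have h2 : Coalgebra.comul (R := ℂ) (inclusionHom h e) =
        Algebra.TensorProduct.map (Subalgebra.inclusion h) (Subalgebra.inclusion h)
          (Coalgebra.comul (R := ℂ) e) :=
      (DFunLike.congr_fun (BialgHomClass.map_comp_comulAlgHom (inclusionHom h)) e).symm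
    have he' : (e : G → ℂ) 1 = 0 := he
    change Algebra.TensorProduct.map q q (Coalgebra.comul (R := ℂ) (inclusionHom h e)) = 0
    rw [h2, key, pairAt_comul, mul_one, he', map_zero]
  have hanti : Ideal.map (inclusionHom h) (RingHom.ker (Bialgebra.counitAlgHom ℂ E)) ≤
      Ideal.comap (HopfAlgebra.antipodeAlgHom ℂ V) (kernelIdeal h) := by
    refine Ideal.map_le_iff_le_comap.mpr ?_
    intro e he
    have h1 : HopfAlgebra.antipode ℂ e ∈ RingHom.ker (Bialgebra.counitAlgHom ℂ E) :=
      (HopfAlgebra.counit_antipode (R := ℂ) e).trans he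
    exact Ideal.mem_map_of_mem (inclusionHom h) h1
  have : ((kernelIdeal h).restrictScalars ℂ).IsCoideal :=
    ⟨fun x hx => hcoun hx, fun x hx => hcomul hx⟩
  exact ⟨fun x hx => hanti hx⟩

/-- The comatrix of a flagged space is triangular with diagonal in `X`. As `q` sends `X` to 1, its
image is unitriangular, and the entries generate the required Hopf subalgebra. -/
theorem IsLocallyFlagged.isProunipotent {K : Type u} [CommRing K] [HopfAlgebra ℂ K]
    (hflag : IsLocallyFlagged X V) (q : V →ₐc[ℂ] K) (hq : Function.Surjective q)
    (hX : ∀ f : V, ∀ χ ∈ X, (f : G → ℂ) = charFun χ → q f = 1) : IsProunipotent K := by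
  classical
  intro s
  choose lift hlift using hq
  -- Lifts of all the given elements are placed in a single flagged space, so that one matrix serves
  -- them all.
  obtain ⟨N, hN, hsN, hNV⟩ := hflag.exists_of_finset (s.image fun x => (lift x : G → ℂ))
    (by simp only [Finset.mem_image]; rintro _ ⟨v, -, rfl⟩; exact (lift v).2)
  obtain ⟨m, a, hdiag, htri, hcomul, hcounit, hspan⟩ := hN.exists_comatrix hNV
  let a' : Matrix (Fin m) (Fin m) K := fun i j => q (a i j)
  have hdiag' : ∀ i, a' i i = 1 := by
    intro i
    obtain ⟨χ, hχ, he⟩ := hdiag i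
    exact hX _ χ hχ he
  have htri' : ∀ i j, j < i → a' i j = 0 := by
    intro i j hij
    change q (a i j) = 0
    rw [htri i j hij, map_zero]
  have hcomul' : ∀ i j, Coalgebra.comul (R := ℂ) (a' i j) = ∑ k, a' i k ⊗ₜ[ℂ] a' k j := by
    intro i j
    have h1 : Coalgebra.comul (R := ℂ) (q (a i j)) =
        TensorProduct.map (q : V →ₗ[ℂ] K) (q : V →ₗ[ℂ] K) (Coalgebra.comul (R := ℂ) (a i j)) :=
      (CoalgHomClass.map_comp_comul_apply q (a i j)).symm
    refine h1.trans ?_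
    rw [hcomul, map_sum]
    rfl
  have hcounit' : ∀ i j, Coalgebra.counit (R := ℂ) (a' i j) = if i = j then 1 else 0 :=
    fun i j => (CoalgHomClass.counit_comp_apply q (a i j)).trans (hcounit i j)
  have := isSubHopf_entryAlg hdiag' htri' hcomul' hcounit'
  refine ⟨entryAlg a', inferInstance, inferInstance, subHopfVal _, Subtype.val_injective, ?_,
    isUnipotent_entryAlg hdiag' htri' hcomul'⟩
  intro x hx
  obtain ⟨c, hc⟩ := hspan (lift x) (hsN _ (Finset.mem_image_of_mem _ hx))
  have h1 : lift x = ∑ i, ∑ j, c i j • a i j := by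
    apply Subtype.ext
    rw [hc]
    simp
  have h2 : x = ∑ i, ∑ j, c i j • a' i j := by
    rw [← hlift x, h1]
    simp only [map_sum, map_smul]
    rfl
  have h3 : x ∈ entryAlg a' := by
    rw [h2]
    exact sum_mem fun i _ => sum_mem fun j _ =>
      Subalgebra.smul_mem _ (entryMatrix a' i j).2 _
  exact ⟨⟨x, h3⟩, rfl⟩

theorem IsLocallyFlagged.hasProunipotentKernel (hflag : IsLocallyFlagged X V)
    (h : charAlg X ≤ V) : HasProunipotentKernel (inclusionHom h) := by
  refine ⟨V ⧸ kernelIdeal h, inferInstance, inferInstance,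
    Bialgebra.Quotient.mkBialgHom (kernelIdeal h), ?_, ?_⟩
  · exact ⟨Ideal.Quotient.mk_surjective (I := kernelIdeal h), Ideal.mk_ker (I := kernelIdeal h)⟩
  · refine hflag.isProunipotent (Bialgebra.Quotient.mkBialgHom (kernelIdeal h))
      (Ideal.Quotient.mk_surjective (I := kernelIdeal h)) fun f χ hχ he => ?_
    have h1 : f = Subalgebra.inclusion h ⟨charFun χ, charFun_mem hχ⟩ := Subtype.ext he
    rw [h1]
    refine (inclusion_sub_counit_mem h ⟨charFun χ, charFun_mem hχ⟩).trans ?_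
    change algebraMap ℂ _ (charFun χ 1) = 1
    rw [charFun_apply, map_one, Units.val_one, map_one]

end Kernel

end ExpIterInt

end

noncomputable section
namespace ExpIterInt
universe u

open MeasureTheory intervalIntegral Set

/-! ### Iterated integrals of functions on the unit interval -/

section UnitInterval

/-- Interval integrable functions on `[0, 1]` that are continuous at all but countably many points
of the interior. -/
structure IsPiecewiseCont {E : Type*} [NormedAddCommGroup E] (F : ℝ → E) : Prop where
  integrable : IntervalIntegrable F volume 0 1
  countable : {t | t ∈ Ioo (0 : ℝ) 1 ∧ ¬ ContinuousAt F t}.Countable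

namespace IsPiecewiseCont

variable {E : Type*} [NormedAddCommGroup E]

theorem mono {F : ℝ → E} (hF : IsPiecewiseCont F) {a b : ℝ} (ha : a ∈ Icc (0 : ℝ) 1)
    (hb : b ∈ Icc (0 : ℝ) 1) : IntervalIntegrable F volume a b :=
  hF.integrable.mono_set (uIcc_subset_uIcc (by rwa [uIcc_of_le zero_le_one])
    (by rwa [uIcc_of_le zero_le_one]))

theorem zero : IsPiecewiseCont (fun _ => (0 : E)) :=
  ⟨by simp, by simp [continuousAt_const]⟩

theorem add {F H : ℝ → E} (hF : IsPiecewiseCont F) (hH : IsPiecewiseCont H) :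
    IsPiecewiseCont (fun t => F t + H t) := by
  refine ⟨hF.integrable.add hH.integrable, (hF.countable.union hH.countable).mono ?_⟩
  rintro t ⟨ht, h⟩
  by_contra hcon
  simp only [mem_union, mem_ofPred_eq, not_or, not_and, not_not] at hcon
  exact h ((hcon.1 ht).add (hcon.2 ht))

theorem norm {F : ℝ → E} (hF : IsPiecewiseCont F) : IsPiecewiseCont (fun t => ‖F t‖) := by
  refine ⟨hF.integrable.norm, hF.countable.mono ?_⟩
  rintro t ⟨ht, h⟩
  exact ⟨ht, fun hcon => h hcon.norm⟩

theorem mul {A : Type*} [NormedRing A] {F g : ℝ → A} (hF : IsPiecewiseCont F)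
    (hg : ContinuousOn g (Icc 0 1)) : IsPiecewiseCont (fun t => F t * g t) := by
  refine ⟨hF.integrable.mul_continuousOn (by rwa [uIcc_of_le zero_le_one]),
    hF.countable.mono ?_⟩
  rintro t ⟨ht, h⟩
  exact ⟨ht, fun hcon => h (hcon.mul (hg.continuousAt (Icc_mem_nhds ht.1 ht.2)))⟩

theorem mul' {A : Type*} [NormedRing A] {F g : ℝ → A} (hF : IsPiecewiseCont F)
    (hg : ContinuousOn g (Icc 0 1)) : IsPiecewiseCont (fun t => g t * F t) := by
  refine ⟨hF.integrable.continuousOn_mul (by rwa [uIcc_of_le zero_le_one]),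
    hF.countable.mono ?_⟩
  rintro t ⟨ht, h⟩
  exact ⟨ht, fun hcon => h ((hg.continuousAt (Icc_mem_nhds ht.1 ht.2)).mul hcon)⟩

end IsPiecewiseCont

/-- The primitive `s ↦ ∫ₛ¹ F`. -/
def prim {E : Type*} [NormedAddCommGroup E] [NormedSpace ℝ E] (F : ℝ → E) (s : ℝ) : E :=
  ∫ t in s..1, F t

/-! ### Primitives and the fundamental theorem of calculus. -/

section Prim

variable {E : Type*} [NormedAddCommGroup E] [NormedSpace ℝ E]

@[simp] theorem prim_one (F : ℝ → E) : prim F 1 = 0 := integral_same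

theorem IsPiecewiseCont.continuousOn_prim {F : ℝ → E} (hF : IsPiecewiseCont F) :
    ContinuousOn (prim F) (Icc 0 1) := by
  have h := continuousOn_primitive_interval_left (a := 0) (b := 1) (μ := volume) (f := F)
    (by rw [uIcc_of_le zero_le_one, integrableOn_Icc_iff_integrableOn_Ioc]
        exact (intervalIntegrable_iff_integrableOn_Ioc_of_le zero_le_one).mp hF.integrable)
  rwa [uIcc_of_le zero_le_one] at h

theorem IsPiecewiseCont.hasDerivAt_prim [CompleteSpace E] {F : ℝ → E} (hF : IsPiecewiseCont F)
    {t : ℝ} (ht : t ∈ Ioo (0 : ℝ) 1) (hc : ContinuousAt F t) : HasDerivAt (prim F) (-F t) t := by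
  refine integral_hasDerivAt_left (hF.mono ⟨ht.1.le, ht.2.le⟩ ⟨zero_le_one, le_rfl⟩) ?_ hc
  exact AEStronglyMeasurable.stronglyMeasurableAtFilter_of_mem hF.integrable.1.1
    (Ioc_mem_nhds ht.1 ht.2)

/-- The fundamental theorem of calculus, with countably many exceptional points. -/
theorem eq_add_prim_of_hasDerivAt [CompleteSpace E] {y H : ℝ → E} (hy : ContinuousOn y (Icc 0 1))
    (hH : IsPiecewiseCont H) {S : Set ℝ} (hS : S.Countable)
    (hd : ∀ t ∈ Ioo (0 : ℝ) 1, t ∉ S → HasDerivAt y (-H t) t) {s : ℝ} (hs : s ∈ Icc (0 : ℝ) 1) :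
    y s = y 1 + prim H s := by
  have h := integral_eq_of_hasDerivAt_off_countable y (fun t => -H t) (a := s) (b := 1) hS
    (hy.mono (by rw [uIcc_of_le hs.2]; exact Icc_subset_Icc_left hs.1))
    (fun t ht => hd t ⟨hs.1.trans_lt (by simpa [hs.2] using ht.1.1), by simpa [hs.2] using ht.1.2⟩
      ht.2)
    (hH.mono hs ⟨zero_le_one, le_rfl⟩).neg
  rw [intervalIntegral.integral_neg] at h
  rw [prim, ← neg_neg (∫ t in s..1, H t), h]
  abel

theorem prim_congr {F H : ℝ → E} {s : ℝ} (hs : s ≤ 1) (h : ∀ t ∈ Icc s 1, F t = H t) :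
    prim F s = prim H s :=
  integral_congr fun t ht => h t (by rwa [uIcc_of_le hs] at ht)

theorem prim_add {F H : ℝ → E} (hF : IsPiecewiseCont F) (hH : IsPiecewiseCont H) {s : ℝ}
    (hs : s ∈ Icc (0 : ℝ) 1) : prim (fun t => F t + H t) s = prim F s + prim H s :=
  integral_add (hF.mono hs ⟨zero_le_one, le_rfl⟩) (hH.mono hs ⟨zero_le_one, le_rfl⟩)

end Prim

/-- Integration by parts. It is the smallest shuffle relation: the square splits according to which
of the two variables comes first. -/
theorem prim_mul_prim {F H : ℝ → ℂ} (hF : IsPiecewiseCont F) (hH : IsPiecewiseCont H) {s : ℝ}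
    (hs : s ∈ Icc (0 : ℝ) 1) :
    prim F s * prim H s = prim (fun t => F t * prim H t) s + prim (fun t => H t * prim F t) s := by
  have h1 := hF.mul hH.continuousOn_prim
  have h2 := hH.mul hF.continuousOn_prim
  refine (eq_add_prim_of_hasDerivAt (y := fun s => prim F s * prim H s)
    (hF.continuousOn_prim.mul hH.continuousOn_prim) (h1.add h2)
    (hF.countable.union hH.countable) (fun t ht hS => ?_) hs).trans ?_
  · simp only [mem_union, mem_ofPred_eq, not_or, not_and, not_not] at hS
    refine ((hF.hasDerivAt_prim ht (hS.1 ht)).mul (hH.hasDerivAt_prim ht (hS.2 ht))).congr_deriv ?_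
    ring
  · rw [prim_add h1 h2 hs, prim_one, prim_one]
    simp

/-- This is the source of the factorials: the m-fold iterated integral of one function is P^m / m!,
where P is its primitive. -/
theorem prim_pow_succ {F : ℝ → ℝ} (hF : IsPiecewiseCont F) (m : ℕ) {s : ℝ}
    (hs : s ∈ Icc (0 : ℝ) 1) : prim (fun t => F t * (prim F t ^ m / m.factorial)) s =
      prim F s ^ (m + 1) / (m + 1).factorial := by
  have h1 := hF.mul ((hF.continuousOn_prim.pow m).div_const (m.factorial : ℝ))
  symm
  refine (eq_add_prim_of_hasDerivAt (y := fun s => prim F s ^ (m + 1) / (m + 1).factorial)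
    ((hF.continuousOn_prim.pow (m + 1)).div_const _) h1 hF.countable (fun t ht hS => ?_) hs).trans ?_
  · simp only [mem_ofPred_eq, not_and, not_not] at hS
    refine (((hF.hasDerivAt_prim ht (hS ht)).pow (m + 1)).div_const
      ((m + 1).factorial : ℝ)).congr_deriv ?_
    have : (m.factorial : ℝ) ≠ 0 := by positivity
    rw [Nat.factorial_succ]
    push_cast
    have : (m : ℝ) + 1 ≠ 0 := by positivity
    field_simp
    simp [mul_comm]
  · rw [prim_one]
    simp

theorem norm_prim_le {F g : ℝ → ℂ} (hF : IsPiecewiseCont F) {B : ℝ → ℝ}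
    (hB : ContinuousOn B (Icc 0 1)) (h : ∀ t ∈ Icc (0 : ℝ) 1, ‖g t‖ ≤ B t) {s : ℝ}
    (hs : s ∈ Icc (0 : ℝ) 1) : ‖prim (fun t => F t * g t) s‖ ≤ prim (fun t => ‖F t‖ * B t) s := by
  refine norm_integral_le_of_norm_le hs.2 (ae_of_all _ fun t ht => ?_)
    ((hF.norm.mul hB).mono hs ⟨zero_le_one, le_rfl⟩)
  rw [norm_mul]
  exact mul_le_mul_of_nonneg_left (h t ⟨hs.1.trans ht.1.le, ht.2⟩) (norm_nonneg _)

theorem prim_norm_nonneg {F : ℝ → ℂ} {s : ℝ} (hs : s ≤ 1) : 0 ≤ prim (fun t => ‖F t‖) s :=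
  integral_nonneg hs fun _ _ => norm_nonneg _

theorem prim_norm_le {F : ℝ → ℂ} (hF : IsPiecewiseCont F) {s : ℝ} (hs : s ∈ Icc (0 : ℝ) 1) :
    prim (fun t => ‖F t‖) s ≤ prim (fun t => ‖F t‖) 0 := by
  have h := integral_add_adjacent_intervals
    (hF.norm.mono (a := 0) ⟨le_rfl, zero_le_one⟩ hs) (hF.norm.mono hs ⟨zero_le_one, le_rfl⟩)
  have h0 : 0 ≤ ∫ t in (0 : ℝ)..s, ‖F t‖ := integral_nonneg hs.1 fun _ _ => norm_nonneg _
  unfold prim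
  linarith

theorem exp_sub_eq_mul (a b : ℂ) :
    Complex.exp (a - b) = Complex.exp a * Complex.exp (-b) := by
  rw [← Complex.exp_add, sub_eq_add_neg]

/-- Dominated convergence, with ‖K‖ · B m as majorants. -/
theorem hasSum_prim {ι : Type*} [Countable ι] {K G : ℝ → ℂ} {g : ι → ℝ → ℂ} {B : ι → ℝ}
    (hK : IsPiecewiseCont K) (hg : ∀ m, ContinuousOn (g m) (Icc 0 1)) (hB : Summable B)
    (hb : ∀ m, ∀ t ∈ Icc (0 : ℝ) 1, ‖g m t‖ ≤ B m)
    (hG : ∀ t ∈ Icc (0 : ℝ) 1, HasSum (fun m => g m t) (G t)) {s : ℝ} (hs : s ∈ Icc (0 : ℝ) 1) :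
    HasSum (fun m => prim (fun t => K t * g m t) s) (prim (fun t => K t * G t) s) := by
  have hsub : ∀ t ∈ uIoc s 1, t ∈ Icc (0 : ℝ) 1 := by
    intro t ht
    rw [uIoc_of_le hs.2] at ht
    exact ⟨hs.1.trans ht.1.le, ht.2⟩
  refine hasSum_integral_of_dominated_convergence
    (fun m t => ‖K t‖ * B m) (fun m => ?_) (fun m => ?_) ?_ ?_ ?_
  · exact ((hK.mul (hg m)).mono hs ⟨zero_le_one, le_rfl⟩).def'.1
  · refine ae_of_all _ fun t ht => ?_
    rw [norm_mul]
    exact mul_le_mul_of_nonneg_left (hb m t (hsub t ht)) (norm_nonneg _)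
  · exact ae_of_all _ fun t _ => hB.mul_left _
  · simp_rw [tsum_mul_left]
    exact (hK.norm.mul continuousOn_const).mono hs ⟨zero_le_one, le_rfl⟩
  · exact ae_of_all _ fun t ht => (hG t (hsub t ht)).mul_left _

/-- The solution of the integral equation `S = c + ∫ₛ¹ H + ∫ₛ¹ F S`. -/
theorem eq_of_integral_equation {F H S : ℝ → ℂ} (hF : IsPiecewiseCont F) (hH : IsPiecewiseCont H)
    (hS : ContinuousOn S (Icc 0 1)) {c : ℂ}
    (h : ∀ s ∈ Icc (0 : ℝ) 1, S s = c + prim H s + prim (fun t => F t * S t) s) {s : ℝ}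
    (hs : s ∈ Icc (0 : ℝ) 1) :
    S s = c * Complex.exp (prim F s) +
      prim (fun t => Complex.exp (prim F s - prim F t) * H t) s := by
  have hE : ContinuousOn (fun t => Complex.exp (-prim F t)) (Icc 0 1) :=
    Complex.continuous_exp.comp_continuousOn hF.continuousOn_prim.neg
  have hFS := hF.mul hS
  -- Variation of constants: after multiplication by the integrating factor exp(-∫ₛ¹ F), the
  -- derivative no longer involves `S`.
  have key := eq_add_prim_of_hasDerivAt (y := fun t => Complex.exp (-prim F t) * S t)
    (hE.mul hS) (hH.mul' hE) (hF.countable.union hH.countable) (fun t ht hcon => ?_) hs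
  · have h1 := h 1 ⟨zero_le_one, le_rfl⟩
    simp only [prim_one, add_zero, neg_zero, Complex.exp_zero, one_mul] at key h1
    rw [h1] at key
    have h2 : S s = Complex.exp (prim F s) * (Complex.exp (-prim F s) * S s) := by
      rw [← mul_assoc, ← Complex.exp_add, add_neg_cancel, Complex.exp_zero, one_mul]
    rw [h2, key, mul_add, mul_comm, add_right_inj]
    unfold prim
    rw [← intervalIntegral.integral_const_mul]
    refine integral_congr fun t _ => ?_
    rw [exp_sub_eq_mul, mul_assoc]
  · simp only [mem_union, mem_ofPred_eq, not_or, not_and, not_not] at hcon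
    have hc1 := hcon.1 ht
    have hc2 := hcon.2 ht
    -- The integral equation itself makes `S` differentiable wherever `F` and `H` are continuous.
    have hSt : HasDerivAt S (-(H t + F t * S t)) t := by
      have hcS := hS.continuousAt (Icc_mem_nhds ht.1 ht.2)
      have hd := ((hH.hasDerivAt_prim ht hc2).const_add c).add
        (hFS.hasDerivAt_prim ht (hc1.mul hcS))
      rw [neg_add]
      refine hd.congr_of_eventuallyEq ?_
      filter_upwards [Icc_mem_nhds ht.1 ht.2] with u hu using h u hu
    refine (((hF.hasDerivAt_prim ht hc1).neg.cexp).mul hSt).congr_deriv ?_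
    simp only [Pi.neg_apply]
    ring

/-! ### Series in which one form is repeated. -/

theorem exponential_bound {F : ℝ → ℂ} (hF : IsPiecewiseCont F) {a : ℕ → ℝ → ℂ}
    (h0 : ContinuousOn (a 0) (Icc 0 1)) {B : ℝ} (hB : ∀ s ∈ Icc (0 : ℝ) 1, ‖a 0 s‖ ≤ B)
    (hrec : ∀ m s, a (m + 1) s = prim (fun t => F t * a m t) s) (m : ℕ) :
    ContinuousOn (a m) (Icc 0 1) ∧
      ∀ s ∈ Icc (0 : ℝ) 1, ‖a m s‖ ≤ B * (prim (fun t => ‖F t‖) 0 ^ m / m.factorial) := by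
  have hB0 : 0 ≤ B := (norm_nonneg _).trans (hB 0 ⟨le_rfl, zero_le_one⟩)
  -- With the integral of ‖F‖ over [s, 1] in place of the one over [0, 1], the bound reproduces
  -- itself under the recursion, by `prim_pow_succ`.
  suffices h : ContinuousOn (a m) (Icc 0 1) ∧
      ∀ s ∈ Icc (0 : ℝ) 1, ‖a m s‖ ≤ B * (prim (fun t => ‖F t‖) s ^ m / m.factorial) by
    refine ⟨h.1, fun s hs => (h.2 s hs).trans ?_⟩
    have h1 := prim_norm_nonneg (F := F) hs.2
    have h2 := prim_norm_le hF hs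
    gcongr
  induction m with
  | zero => exact ⟨h0, fun s hs => by simpa using hB s hs⟩
  | succ m ih =>
    constructor
    · have : a (m + 1) = prim (fun t => F t * a m t) := funext (hrec m)
      rw [this]
      exact (hF.mul ih.1).continuousOn_prim
    · intro s hs
      rw [hrec, ← prim_pow_succ hF.norm m hs]
      refine (norm_prim_le hF ?_ ih.2 hs).trans_eq ?_
      · exact continuousOn_const.mul ((hF.norm.continuousOn_prim.pow m).div_const _)
      · unfold prim
        rw [← intervalIntegral.integral_const_mul]
        exact integral_congr fun t _ => by ring

/-- Summing the recursion over `m` gives S = a 0 + ∫ₛ¹ F S, which `eq_of_integral_equation` solves.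
The bounds of `exponential_bound` make the sum uniform, so integral and sum may be exchanged. -/
theorem hasSum_exponential {F H : ℝ → ℂ} (hF : IsPiecewiseCont F) (hH : IsPiecewiseCont H)
    {a : ℕ → ℝ → ℂ} {c : ℂ} (h0 : ∀ s ∈ Icc (0 : ℝ) 1, a 0 s = c + prim H s)
    (hrec : ∀ m s, a (m + 1) s = prim (fun t => F t * a m t) s) {s : ℝ}
    (hs : s ∈ Icc (0 : ℝ) 1) :
    HasSum (fun m => a m s) (c * Complex.exp (prim F s) +
      prim (fun t => Complex.exp (prim F s - prim F t) * H t) s) := by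
  have h0c : ContinuousOn (a 0) (Icc 0 1) :=
    (continuousOn_const.add hH.continuousOn_prim).congr h0
  obtain ⟨B, hB⟩ := isCompact_Icc.exists_bound_of_continuousOn h0c
  have hb := exponential_bound hF h0c hB hrec
  set Q := prim (fun t => ‖F t‖) 0
  have hsum : Summable fun m : ℕ => B * (Q ^ m / m.factorial) :=
    (Real.summable_pow_div_factorial Q).mul_left B
  have hsa : ∀ s ∈ Icc (0 : ℝ) 1, Summable fun m => a m s := fun s hs =>
    Summable.of_norm_bounded hsum fun m => (hb m).2 s hs
  let S : ℝ → ℂ := fun s => ∑' m, a m s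
  have hS : ContinuousOn S (Icc 0 1) :=
    continuousOn_tsum (fun m => (hb m).1) hsum fun m s hs => (hb m).2 s hs
  have heq : ∀ s ∈ Icc (0 : ℝ) 1, S s = c + prim H s + prim (fun t => F t * S t) s := by
    intro s hs
    have h1 : HasSum (fun m => prim (fun t => F t * a m t) s) (prim (fun t => F t * S t) s) :=
      hasSum_prim hF (fun m => (hb m).1) hsum (fun m => (hb m).2) (fun t ht => (hsa t ht).hasSum) hs
    have h2 : S s = a 0 s + ∑' m, a (m + 1) s := (hsa s hs).tsum_eq_zero_add
    rw [h2, h0 s hs]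
    simp_rw [hrec]
    rw [h1.tsum_eq]
  rw [← eq_of_integral_equation hF hH hS heq hs]
  exact (hsa s hs).hasSum

/-! ### Transport -/

/-- The entries of the parallel transport of the upper triangular connection with diagonal
entries `d i` and entries `e i` above the diagonal: `transport d e k i s` is the entry at
`(i, i + k)` of the transport from `s` to `1`. -/
def transport (d e : ℕ → ℝ → ℂ) : ℕ → ℕ → ℝ → ℂ
  | 0, i, s => Complex.exp (prim (d i) s)
  | k + 1, i, s =>
    prim (fun t => Complex.exp (prim (d i) s - prim (d i) t) * (e i t * transport d e k (i + 1) t)) s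

variable {d e : ℕ → ℝ → ℂ}

theorem transport_succ (d e : ℕ → ℝ → ℂ) (k i : ℕ) (s : ℝ) : transport d e (k + 1) i s =
    Complex.exp (prim (d i) s) *
      prim (fun t => Complex.exp (-prim (d i) t) * (e i t * transport d e k (i + 1) t)) s := by
  rw [transport]
  unfold prim
  rw [← intervalIntegral.integral_const_mul]
  refine integral_congr fun t _ => ?_
  rw [exp_sub_eq_mul, mul_assoc]

theorem continuousOn_exp_prim {F : ℝ → ℂ} (hF : IsPiecewiseCont F) :
    ContinuousOn (fun t => Complex.exp (prim F t)) (Icc 0 1) :=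
  Complex.continuous_exp.comp_continuousOn hF.continuousOn_prim

theorem continuousOn_exp_neg_prim {F : ℝ → ℂ} (hF : IsPiecewiseCont F) :
    ContinuousOn (fun t => Complex.exp (-prim F t)) (Icc 0 1) :=
  Complex.continuous_exp.comp_continuousOn hF.continuousOn_prim.neg

theorem continuousOn_transport (hd : ∀ i, IsPiecewiseCont (d i))
    (he : ∀ i, IsPiecewiseCont (e i)) (k i : ℕ) : ContinuousOn (transport d e k i) (Icc 0 1) := by
  induction k generalizing i with
  | zero => exact continuousOn_exp_prim (hd i)
  | succ k ih =>
    rw [show transport d e (k + 1) i = _ from funext (transport_succ d e k i)]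
    exact (continuousOn_exp_prim (hd i)).mul
      (((he i).mul (ih (i + 1))).mul' (continuousOn_exp_neg_prim (hd i))).continuousOn_prim

theorem transport_shift (d e : ℕ → ℝ → ℂ) (j k i : ℕ) :
    transport (fun i => d (i + j)) (fun i => e (i + j)) k i = transport d e k (i + j) := by
  induction k generalizing i with
  | zero => rfl
  | succ k ih =>
    ext s
    rw [transport, transport, ih, Nat.add_right_comm]

theorem transport_one (d e : ℕ → ℝ → ℂ) (k i : ℕ) :
    transport d e k i 1 = if k = 0 then 1 else 0 := by
  cases k <;> simp [transport]

/-- Iterated integrals of a list of functions. -/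
def iterPrim : List (ℝ → ℂ) → ℝ → ℂ
  | [], _ => 1
  | F :: w, s => prim (fun t => F t * iterPrim w t) s

/-- The word `d₀ ⋯ d₀ e₀ d₁ ⋯ d₁ e₁ ⋯ e_{k-1} d_k ⋯ d_k` in which `dᵢ` is repeated `mᵢ` times. -/
def transportWord (d e : ℕ → ℝ → ℂ) (k : ℕ) (m : Fin (k + 1) → ℕ) : List (ℝ → ℂ) :=
  List.replicate (m 0) (d 0) ++
    (List.ofFn fun i : Fin k => e i :: List.replicate (m i.succ) (d (i + 1))).flatten

theorem transportWord_cons (d e : ℕ → ℝ → ℂ) (k : ℕ) (m₀ : ℕ) (m : Fin (k + 1) → ℕ) :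
    transportWord d e (k + 1) (Fin.cons m₀ m) = List.replicate m₀ (d 0) ++
      (e 0 :: transportWord (fun i => d (i + 1)) (fun i => e (i + 1)) k m) := by
  simp [transportWord, List.ofFn_succ, Fin.cons_succ]

theorem iterPrim_replicate_succ (F : ℝ → ℂ) (m : ℕ) (w : List (ℝ → ℂ)) (s : ℝ) :
    iterPrim (List.replicate (m + 1) F ++ w) s =
      prim (fun t => F t * iterPrim (List.replicate m F ++ w) t) s := rfl

/-- Induction on the number of blocks. The powers of `d 0` are summed by `hasSum_exponential`, the
remaining exponents by dominated convergence under the integral. The summable majorant `B` is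
carried along to justify this and the reordering. -/
theorem hasSum_transportWord (hd : ∀ i, IsPiecewiseCont (d i)) (he : ∀ i, IsPiecewiseCont (e i))
    (k : ℕ) : ∃ B : (Fin (k + 1) → ℕ) → ℝ, Summable B ∧
      (∀ m, ContinuousOn (iterPrim (transportWord d e k m)) (Icc 0 1)) ∧
      (∀ m, ∀ s ∈ Icc (0 : ℝ) 1, ‖iterPrim (transportWord d e k m) s‖ ≤ B m) ∧
      ∀ s ∈ Icc (0 : ℝ) 1,
        HasSum (fun m => iterPrim (transportWord d e k m) s) (transport d e k 0 s) := by
  induction k generalizing d e with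
  | zero =>
    let a : ℕ → ℝ → ℂ := fun m => iterPrim (List.replicate m (d 0) ++ [])
    have hb := exponential_bound (a := a) (B := 1) (hd 0) continuousOn_const (by simp [a, iterPrim])
      (fun m s => iterPrim_replicate_succ _ _ _ _)
    have ha : ∀ m : Fin 1 → ℕ, iterPrim (transportWord d e 0 m) = a (m 0) := by
      intro m
      simp [transportWord, a]
    let eqv : (Fin 1 → ℕ) ≃ ℕ := Equiv.funUnique (Fin 1) ℕ
    refine ⟨fun m => 1 * (prim (fun t => ‖d 0 t‖) 0 ^ (m 0) / (m 0).factorial), ?_, ?_, ?_, ?_⟩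
    · exact eqv.summable_iff.mpr ((Real.summable_pow_div_factorial _).mul_left 1)
    · intro m
      rw [ha]
      exact (hb (m 0)).1
    · intro m
      rw [ha]
      exact (hb (m 0)).2
    · intro s hs
      simp_rw [ha]
      have h := hasSum_exponential (a := a) (c := 1) (hd 0) IsPiecewiseCont.zero
        (by intro s _; simp [a, iterPrim, prim]) (fun m s => iterPrim_replicate_succ _ _ _ _) hs
      refine (eqv.hasSum_iff (f := fun m => a m s)).mpr ?_
      simpa [transport, prim] using h
  | succ k ih =>
    obtain ⟨B, hB, hcont, hbound, hsum⟩ := ih (d := fun i => d (i + 1)) (e := fun i => e (i + 1))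
      (fun i => hd (i + 1)) (fun i => he (i + 1))
    set v : (Fin (k + 1) → ℕ) → ℝ → ℂ := fun m =>
      iterPrim (transportWord (fun i => d (i + 1)) (fun i => e (i + 1)) k m) with hv
    let a : (Fin (k + 1) → ℕ) → ℕ → ℝ → ℂ := fun m m₀ => iterPrim (List.replicate m₀ (d 0) ++
      (e 0 :: transportWord (fun i => d (i + 1)) (fun i => e (i + 1)) k m))
    have ha0 : ∀ m, a m 0 = prim (fun t => e 0 t * v m t) := fun m => rfl
    have harec : ∀ m m₀ s, a m (m₀ + 1) s = prim (fun t => d 0 t * a m m₀ t) s :=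
      fun m m₀ s => iterPrim_replicate_succ _ _ _ _
    set C := prim (fun t => ‖e 0 t‖) 0
    set Q := prim (fun t => ‖d 0 t‖) 0
    have hB0 : ∀ m, 0 ≤ B m := fun m =>
      (norm_nonneg _).trans (hbound m 0 ⟨le_rfl, zero_le_one⟩)
    have ha0b : ∀ m, ∀ s ∈ Icc (0 : ℝ) 1, ‖a m 0 s‖ ≤ C * B m := by
      intro m s hs
      rw [ha0]
      refine (norm_prim_le (he 0) continuousOn_const (hbound m) hs).trans ?_
      unfold prim
      rw [intervalIntegral.integral_mul_const]
      exact mul_le_mul_of_nonneg_right (prim_norm_le (he 0) hs) (hB0 m)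
    have hb := fun m => exponential_bound (a := a m) (hd 0)
      (by rw [ha0]; exact ((he 0).mul (hcont m)).continuousOn_prim) (ha0b m) (harec m)
    let eqv : ℕ × (Fin (k + 1) → ℕ) ≃ (Fin (k + 2) → ℕ) := Fin.consEquiv (fun _ => ℕ)
    have hw : ∀ p, iterPrim (transportWord d e (k + 1) (eqv p)) = a p.2 p.1 := fun p => by
      change iterPrim (transportWord d e (k + 1) (Fin.cons p.1 p.2)) = _
      rw [transportWord_cons]
    -- Prepending `e 0` costs a factor `C`, and repeating `d 0` costs Q^m₀ / m₀!. The product is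
    -- summable over pairs.
    let b : ℕ × (Fin (k + 1) → ℕ) → ℝ := fun p => (C * B p.2) * (Q ^ p.1 / p.1.factorial)
    have hC : 0 ≤ C := prim_norm_nonneg zero_le_one
    have hQ : 0 ≤ Q := prim_norm_nonneg zero_le_one
    have hbsum : Summable b := by
      have := (Real.summable_pow_div_factorial Q).mul_of_nonneg (hB.mul_left C)
        (fun m => by positivity) (fun m => mul_nonneg hC (hB0 m))
      refine this.congr fun p => ?_
      simp only [b]
      ring
    refine ⟨fun m => b (eqv.symm m), eqv.symm.summable_iff.mpr hbsum, ?_, ?_, ?_⟩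
    · intro m
      obtain ⟨p, rfl⟩ := eqv.surjective m
      rw [hw]
      exact (hb p.2 p.1).1
    · intro m
      obtain ⟨p, rfl⟩ := eqv.surjective m
      rw [hw]
      change ∀ s ∈ Icc (0 : ℝ) 1, _ ≤ b (eqv.symm (eqv p))
      rw [Equiv.symm_apply_apply]
      exact (hb p.2 p.1).2
    · intro s hs
      have hinner : ∀ m, HasSum (fun m₀ => a m m₀ s)
          (prim (fun t => Complex.exp (prim (d 0) s - prim (d 0) t) * (e 0 t * v m t)) s) := by
        intro m
        have := hasSum_exponential (a := a m) (c := 0) (hd 0) ((he 0).mul (hcont m))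
          (by intro s _; rw [ha0, zero_add]) (harec m) hs
        simpa only [zero_mul, zero_add] using this
      have houter : HasSum (fun m => prim (fun t => Complex.exp (prim (d 0) s - prim (d 0) t) *
          (e 0 t * v m t)) s) (transport d e (k + 1) 0 s) := by
        rw [transport]
        have hE : ContinuousOn (fun t => Complex.exp (prim (d 0) s - prim (d 0) t)) (Icc 0 1) :=
          Complex.continuous_exp.comp_continuousOn
            (continuousOn_const.sub (hd 0).continuousOn_prim)
        have := hasSum_prim ((he 0).mul' hE) hcont hB hbound hsum hs
        rw [transport_shift d e 1 k 0] at this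
        simpa only [mul_assoc] using this
      -- Absolute convergence over pairs allows the first exponent to be summed before the others.
      have h1 : Summable fun p : ℕ × (Fin (k + 1) → ℕ) => a p.2 p.1 s :=
        Summable.of_norm_bounded hbsum fun p => (hb p.2 p.1).2 s hs
      have htot : Summable fun p : (Fin (k + 1) → ℕ) × ℕ => a p.1 p.2 s := h1.prod_symm
      have h2 : ∑' p : (Fin (k + 1) → ℕ) × ℕ, a p.1 p.2 s = transport d e (k + 1) 0 s :=
        (htot.hasSum.prod_fiberwise hinner).unique houter
      have h3 : ∑' p : ℕ × (Fin (k + 1) → ℕ), a p.2 p.1 s = transport d e (k + 1) 0 s := by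
        rw [← h2]
        exact (Equiv.prodComm ℕ (Fin (k + 1) → ℕ)).tsum_eq
          (fun p : (Fin (k + 1) → ℕ) × ℕ => a p.1 p.2 s)
      have h5 : (fun m => iterPrim (transportWord d e (k + 1) m) s) ∘ eqv =
          fun p => a p.2 p.1 s := funext fun p => congrFun (hw p) s
      rw [← eqv.hasSum_iff, h5, ← h3]
      exact h1.hasSum

end UnitInterval

end ExpIterInt

end

noncomputable section
namespace ExpIterInt
universe u

open MeasureTheory intervalIntegral Set

section Transport

variable {d e d' e' : ℕ → ℝ → ℂ}

/-! ### Products -/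

theorem transport_zero_mul_zero (hd : ∀ i, IsPiecewiseCont (d i))
    (hd' : ∀ i, IsPiecewiseCont (d' i)) {s : ℝ} (hs : s ∈ Icc (0 : ℝ) 1) :
    transport d e 0 0 s * transport d' e' 0 0 s =
      Complex.exp (prim (fun t => d 0 t + d' 0 t) s) := by
  rw [transport, transport, prim_add (hd 0) (hd' 0) hs, Complex.exp_add]

theorem prim_exp_factor {D : ℝ → ℂ} (H : ℝ → ℂ) (c : ℂ) (s : ℝ) :
    prim (fun t => Complex.exp (c - prim D t) * H t) s =
      Complex.exp c * prim (fun t => Complex.exp (-prim D t) * H t) s := by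
  unfold prim
  rw [← intervalIntegral.integral_const_mul]
  refine integral_congr fun t _ => ?_
  rw [exp_sub_eq_mul, mul_assoc]

/-- A factor of length zero has no form to insert. It only changes the first exponent to d 0 + d' 0
and moves under the integral. -/
theorem transport_succ_mul_zero (hd : ∀ i, IsPiecewiseCont (d i))
    (hd' : ∀ i, IsPiecewiseCont (d' i)) (k : ℕ) {s : ℝ} (hs : s ∈ Icc (0 : ℝ) 1) :
    transport d e (k + 1) 0 s * transport d' e' 0 0 s =
      prim (fun t => Complex.exp (prim (fun t => d 0 t + d' 0 t) s -
        prim (fun t => d 0 t + d' 0 t) t) *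
          (e 0 t * (transport d e k 1 t * transport d' e' 0 0 t))) s := by
  rw [prim_exp_factor, transport_succ, transport, prim_add (hd 0) (hd' 0) hs, Complex.exp_add,
    mul_right_comm]
  congr 1
  refine prim_congr hs.2 fun t ht => ?_
  rw [prim_add (hd 0) (hd' 0) ⟨hs.1.trans ht.1, ht.2⟩, transport, neg_add, Complex.exp_add]
  have : Complex.exp (-prim (d' 0) t) * Complex.exp (prim (d' 0) t) = 1 := by
    rw [← Complex.exp_add, neg_add_cancel, Complex.exp_zero]
  linear_combination -(Complex.exp (-prim (d 0) t) * (e 0 t * transport d e k (0 + 1) t)) * this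

/-- The recursion of the shuffle product: the first inserted form is either `e 0` or `e' 0`, and
before it both exponents act together. After the exponentials are factored out, this is
`prim_mul_prim`. -/
theorem transport_succ_mul_succ (hd : ∀ i, IsPiecewiseCont (d i))
    (he : ∀ i, IsPiecewiseCont (e i)) (hd' : ∀ i, IsPiecewiseCont (d' i))
    (he' : ∀ i, IsPiecewiseCont (e' i)) (k k' : ℕ) {s : ℝ} (hs : s ∈ Icc (0 : ℝ) 1) :
    transport d e (k + 1) 0 s * transport d' e' (k' + 1) 0 s =
      prim (fun t => Complex.exp (prim (fun t => d 0 t + d' 0 t) s -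
        prim (fun t => d 0 t + d' 0 t) t) *
          (e 0 t * (transport d e k 1 t * transport d' e' (k' + 1) 0 t))) s +
      prim (fun t => Complex.exp (prim (fun t => d 0 t + d' 0 t) s -
        prim (fun t => d 0 t + d' 0 t) t) *
          (e' 0 t * (transport d e (k + 1) 0 t * transport d' e' k' 1 t))) s := by
  have h1 := ((he 0).mul (continuousOn_transport hd he k 1)).mul' (continuousOn_exp_neg_prim (hd 0))
  have h2 := ((he' 0).mul (continuousOn_transport hd' he' k' 1)).mul'
    (continuousOn_exp_neg_prim (hd' 0))
  rw [prim_exp_factor, prim_exp_factor, transport_succ, transport_succ,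
    mul_mul_mul_comm, prim_mul_prim h1 h2 hs, prim_add (hd 0) (hd' 0) hs, Complex.exp_add,
    mul_add]
  congr 2 <;>
  · refine prim_congr hs.2 fun t ht => ?_
    rw [prim_add (hd 0) (hd' 0) ⟨hs.1.trans ht.1, ht.2⟩, transport_succ, neg_add, Complex.exp_add]
    have h3 : Complex.exp (-prim (d' 0) t) * Complex.exp (prim (d' 0) t) = 1 := by
      rw [← Complex.exp_add, neg_add_cancel, Complex.exp_zero]
    have h4 : Complex.exp (-prim (d 0) t) * Complex.exp (prim (d 0) t) = 1 := by
      rw [← Complex.exp_add, neg_add_cancel, Complex.exp_zero]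
    first
    | linear_combination -(Complex.exp (-prim (d 0) t) * (e 0 t * transport d e k (0 + 1) t)) *
        prim (fun t => Complex.exp (-prim (d' 0) t) * (e' 0 t * transport d' e' k' (0 + 1) t)) t * h3
    | linear_combination -(Complex.exp (-prim (d' 0) t) * (e' 0 t * transport d' e' k' (0 + 1) t)) *
        prim (fun t => Complex.exp (-prim (d 0) t) * (e 0 t * transport d e k (0 + 1) t)) t * h4

/-! ### Concatenation -/

section Concat

variable {dα eα dβ eβ : ℕ → ℝ → ℂ}

/-- `F` is the concatenation of `A` and `B`. -/
structure IsConcat (F A B : ℝ → ℂ) : Prop where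
  left : ∀ t ∈ Ioo (0 : ℝ) (1 / 2), F t = 2 * A (2 * t)
  right : ∀ t ∈ Ioo (1 / 2 : ℝ) 1, F t = 2 * B (2 * t - 1)

/-- End points are ignored because velocities need not match at the break points of a concatenation.
-/
theorem integral_congr_Ioo {F H : ℝ → ℂ} {a b : ℝ} (hab : a ≤ b) (h : ∀ t ∈ Ioo a b, F t = H t) :
    ∫ t in a..b, F t = ∫ t in a..b, H t := by
  rw [integral_of_le hab, integral_of_le hab, ← integral_Icc_eq_integral_Ioc,
    ← integral_Icc_eq_integral_Ioc, integral_Icc_eq_integral_Ioo, integral_Icc_eq_integral_Ioo]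
  exact setIntegral_congr_fun measurableSet_Ioo h

theorem integral_right_half {F B : ℝ → ℂ} (h : ∀ t ∈ Ioo (1 / 2 : ℝ) 1, F t = 2 * B (2 * t - 1))
    {s : ℝ} (hs : s ∈ Icc (1 / 2 : ℝ) 1) : prim F s = prim B (2 * s - 1) := by
  unfold prim
  rw [integral_congr_Ioo (H := fun t => 2 * B (2 * t - 1)) hs.2
    (fun t ht => h t ⟨hs.1.trans_lt ht.1, ht.2⟩), intervalIntegral.integral_const_mul,
    intervalIntegral.integral_comp_mul_sub B two_ne_zero, Complex.real_smul, ← mul_assoc]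
  norm_num

theorem integral_left_half {F A : ℝ → ℂ} (h : ∀ t ∈ Ioo (0 : ℝ) (1 / 2), F t = 2 * A (2 * t))
    {s : ℝ} (hs : s ∈ Icc (0 : ℝ) (1 / 2)) : ∫ t in s..(1 / 2), F t = prim A (2 * s) := by
  unfold prim
  rw [integral_congr_Ioo (H := fun t => 2 * A (2 * t)) hs.2
    (fun t ht => h t ⟨hs.1.trans_lt ht.1, ht.2⟩), intervalIntegral.integral_const_mul,
    intervalIntegral.integral_comp_mul_left A two_ne_zero, Complex.real_smul, ← mul_assoc]
  norm_num

theorem prim_half {F : ℝ → ℂ} (hF : IsPiecewiseCont F) {s : ℝ} (hs : s ∈ Icc (0 : ℝ) (1 / 2)) :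
    prim F s = (∫ t in s..(1 / 2), F t) + prim F (1 / 2) :=
  (integral_add_adjacent_intervals (hF.mono ⟨hs.1, hs.2.trans (by norm_num)⟩ ⟨by norm_num, by norm_num⟩)
    (hF.mono ⟨by norm_num, by norm_num⟩ ⟨zero_le_one, le_rfl⟩)).symm

theorem transport_right_half (hd : ∀ i, IsConcat (d i) (dα i) (dβ i))
    (he : ∀ i, IsConcat (e i) (eα i) (eβ i)) (k i : ℕ) {s : ℝ} (hs : s ∈ Icc (1 / 2 : ℝ) 1) :
    transport d e k i s = transport dβ eβ k i (2 * s - 1) := by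
  induction k generalizing i s with
  | zero => rw [transport, transport, integral_right_half (hd i).right hs]
  | succ k ih =>
    rw [transport, transport]
    let B : ℝ → ℂ := fun u => Complex.exp (prim (dβ i) (2 * s - 1) - prim (dβ i) u) *
        (eβ i u * transport dβ eβ k (i + 1) u)
    unfold prim
    rw [integral_congr_Ioo (H := fun t => 2 * B (2 * t - 1)) hs.2]
    · rw [intervalIntegral.integral_const_mul,
        intervalIntegral.integral_comp_mul_sub B two_ne_zero, Complex.real_smul, ← mul_assoc]
      norm_num [B, prim]
    · intro t ht
      have ht' : t ∈ Ioo (1 / 2 : ℝ) 1 := ⟨hs.1.trans_lt ht.1, ht.2⟩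
      have h1 := integral_right_half (hd i).right hs
      have h2 := integral_right_half (hd i).right ⟨ht'.1.le, ht'.2.le⟩
      change Complex.exp (prim (d i) s - prim (d i) t) * _ = _
      rw [h1, h2, ih _ ⟨ht'.1.le, ht'.2.le⟩, (he i).right t ht']
      simp only [B]
      ring

/-- Multiplicativity of transport. The outer integral is split at 1/2: if the first form is inserted
later, nothing is inserted along the first path; if earlier, the inductive hypothesis applies under
the integral. That is why all s ≤ 1/2 are treated at once. -/
theorem transport_concat (hd : ∀ i, IsPiecewiseCont (d i)) (he : ∀ i, IsPiecewiseCont (e i))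
    (hdα : ∀ i, IsPiecewiseCont (dα i)) (heα : ∀ i, IsPiecewiseCont (eα i))
    (hdc : ∀ i, IsConcat (d i) (dα i) (dβ i)) (hec : ∀ i, IsConcat (e i) (eα i) (eβ i))
    (k i : ℕ) {s : ℝ} (hs : s ∈ Icc (0 : ℝ) (1 / 2)) :
    transport d e k i s = ∑ p ∈ Finset.HasAntidiagonal.antidiagonal k,
      transport dα eα p.1 i (2 * s) * transport dβ eβ p.2 (i + p.1) 0 := by
  have hprim : ∀ i, ∀ s ∈ Icc (0 : ℝ) (1 / 2),
      prim (d i) s = prim (dα i) (2 * s) + prim (d i) (1 / 2) := fun i s hs => by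
    rw [prim_half (hd i) hs, integral_left_half (hdc i).left hs]
  induction k generalizing i s with
  | zero =>
    have h := integral_right_half (hdc i).right (s := 1 / 2) ⟨le_rfl, by norm_num⟩
    rw [show (2 : ℝ) * (1 / 2) - 1 = 0 by norm_num] at h
    simp only [Finset.Nat.antidiagonal_zero, Finset.sum_singleton, transport, add_zero]
    rw [← Complex.exp_add, hprim i s hs]
    rw [h]
  | succ k ih =>
    have hs1 : s ∈ Icc (0 : ℝ) 1 := ⟨hs.1, hs.2.trans (by norm_num)⟩
    have h2s : 2 * s ∈ Icc (0 : ℝ) 1 := ⟨by linarith [hs.1], by linarith [hs.2]⟩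
    have hE : ContinuousOn (fun t => Complex.exp (prim (d i) s - prim (d i) t)) (Icc 0 1) :=
      Complex.continuous_exp.comp_continuousOn (continuousOn_const.sub (hd i).continuousOn_prim)
    rw [transport, prim_half (((he i).mul (continuousOn_transport hd he k (i + 1))).mul' hE) hs]
    have h1 : prim (fun t => Complex.exp (prim (d i) s - prim (d i) t) *
        (e i t * transport d e k (i + 1) t)) (1 / 2) =
        transport dα eα 0 i (2 * s) * transport dβ eβ (k + 1) (i + 0) 0 := by
      have h := transport_right_half hdc hec (k + 1) i (s := 1 / 2) ⟨le_rfl, by norm_num⟩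
      rw [show (2 : ℝ) * (1 / 2) - 1 = 0 by norm_num] at h
      rw [add_zero, ← h, transport, transport, prim_exp_factor, prim_exp_factor, ← mul_assoc,
        ← Complex.exp_add, hprim i s hs]
    have h2 : ∫ t in s..(1 / 2), Complex.exp (prim (d i) s - prim (d i) t) *
        (e i t * transport d e k (i + 1) t) = ∑ p ∈ Finset.HasAntidiagonal.antidiagonal k,
          transport dα eα (p.1 + 1) i (2 * s) * transport dβ eβ p.2 (i + (p.1 + 1)) 0 := by
      let A : ℕ → ℝ → ℂ := fun p u => Complex.exp (prim (dα i) (2 * s) - prim (dα i) u) *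
        (eα i u * transport dα eα p (i + 1) u)
      have hA : ∀ p, IsPiecewiseCont (A p) := fun p =>
        ((heα i).mul (continuousOn_transport hdα heα p (i + 1))).mul'
          (Complex.continuous_exp.comp_continuousOn
            (continuousOn_const.sub (hdα i).continuousOn_prim))
      have h3 : ∀ t ∈ Ioo (0 : ℝ) (1 / 2), Complex.exp (prim (d i) s - prim (d i) t) *
          (e i t * transport d e k (i + 1) t) = 2 * (fun u => ∑ p ∈ Finset.HasAntidiagonal.antidiagonal k,
            A p.1 u * transport dβ eβ p.2 (i + (p.1 + 1)) 0) (2 * t) := by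
        intro t ht
        have ht' : t ∈ Icc (0 : ℝ) (1 / 2) := ⟨ht.1.le, ht.2.le⟩
        rw [hprim i s hs, hprim i t ht', ih (i + 1) ht',
          (hec i).left t ht, add_sub_add_right_eq_sub,
          Finset.mul_sum, Finset.mul_sum, Finset.mul_sum]
        refine Finset.sum_congr rfl fun p _ => ?_
        rw [show i + 1 + p.1 = i + (p.1 + 1) by ring]
        simp only [A]
        ring
      rw [integral_left_half (A := fun u => ∑ p ∈ Finset.HasAntidiagonal.antidiagonal k,
        A p.1 u * transport dβ eβ p.2 (i + (p.1 + 1)) 0) h3 hs]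
      unfold prim
      rw [intervalIntegral.integral_finsetSum]
      · refine Finset.sum_congr rfl fun p _ => ?_
        rw [intervalIntegral.integral_mul_const]
        rfl
      · intro p _
        exact ((hA p.1).mul continuousOn_const).mono h2s ⟨zero_le_one, le_rfl⟩
    rw [h1, h2, Finset.Nat.antidiagonal_succ, Finset.sum_cons, Finset.sum_map, add_comm]
    rfl

end Concat

/-! ### Reversal -/

/-- The reversed path from time 1 - s on runs back from time s to 0; following it by the whole path
cancels down to the path from s to 1. In the proof ∫ₛ¹ is written as ∫₀¹ - ∫₀ˢ: the first integral
gives the term with nothing inserted on the way back, the second the others, by reflection and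
induction. -/
theorem transport_reverse {dι eι : ℕ → ℝ → ℂ} (hd : ∀ i, IsPiecewiseCont (d i))
    (he : ∀ i, IsPiecewiseCont (e i)) (hdι : ∀ i, IsPiecewiseCont (dι i))
    (heι : ∀ i, IsPiecewiseCont (eι i))
    (hdr : ∀ i, ∀ t ∈ Ioo (0 : ℝ) 1, dι i t = -d i (1 - t))
    (her : ∀ i, ∀ t ∈ Ioo (0 : ℝ) 1, eι i t = -e i (1 - t))
    (k i : ℕ) {s : ℝ} (hs : s ∈ Icc (0 : ℝ) 1) :
    ∑ p ∈ Finset.HasAntidiagonal.antidiagonal k,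
      transport dι eι p.1 i (1 - s) * transport d e p.2 (i + p.1) 0 = transport d e k i s := by
  have hsplit : ∀ {H : ℝ → ℂ}, IsPiecewiseCont H → ∀ s ∈ Icc (0 : ℝ) 1,
      prim H s = prim H 0 - ∫ t in (0 : ℝ)..s, H t := by
    intro H hH s hs
    have := integral_add_adjacent_intervals (hH.mono (a := 0) ⟨le_rfl, zero_le_one⟩ hs)
      (hH.mono hs ⟨zero_le_one, le_rfl⟩)
    unfold prim
    rw [← this]
    ring
  have hrev : ∀ {H Hι : ℝ → ℂ}, (∀ t ∈ Ioo (0 : ℝ) 1, Hι t = -H (1 - t)) → ∀ s ∈ Icc (0 : ℝ) 1,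
      prim Hι (1 - s) = -∫ t in (0 : ℝ)..s, H t := by
    intro H Hι h s hs
    unfold prim
    rw [integral_congr_Ioo (H := fun t => -H (1 - t)) (by linarith [hs.1])
      (fun t ht => h t ⟨by linarith [ht.1, hs.2], ht.2⟩), intervalIntegral.integral_neg,
      intervalIntegral.integral_comp_sub_left (fun t => H t)]
    simp
  have hprim : ∀ i, ∀ s ∈ Icc (0 : ℝ) 1,
      prim (d i) s = prim (dι i) (1 - s) + prim (d i) 0 := fun i s hs => by
    rw [hsplit (hd i) s hs, hrev (hdr i) s hs]
    ring
  induction k generalizing i s with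
  | zero =>
    simp only [Finset.Nat.antidiagonal_zero, Finset.sum_singleton, transport, add_zero]
    rw [← Complex.exp_add, hprim i s hs]
  | succ k ih =>
    have h1s : 1 - s ∈ Icc (0 : ℝ) 1 := ⟨by linarith [hs.2], by linarith [hs.1]⟩
    have hE : ContinuousOn (fun t => Complex.exp (prim (d i) s - prim (d i) t)) (Icc 0 1) :=
      Complex.continuous_exp.comp_continuousOn (continuousOn_const.sub (hd i).continuousOn_prim)
    let A : ℕ → ℝ → ℂ := fun p u => Complex.exp (prim (dι i) (1 - s) - prim (dι i) u) *
        (eι i u * transport dι eι p (i + 1) u)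
    have hA : ∀ p, IsPiecewiseCont (A p) := fun p =>
      ((heι i).mul (continuousOn_transport hdι heι p (i + 1))).mul'
        (Complex.continuous_exp.comp_continuousOn
          (continuousOn_const.sub (hdι i).continuousOn_prim))
    have h1 : prim (fun t => Complex.exp (prim (d i) s - prim (d i) t) *
        (e i t * transport d e k (i + 1) t)) 0 =
        transport dι eι 0 i (1 - s) * transport d e (k + 1) (i + 0) 0 := by
      rw [add_zero, transport, transport, prim_exp_factor, prim_exp_factor, ← mul_assoc,
        ← Complex.exp_add, hprim i s hs]
    have h3 : ∀ t ∈ Ioo (0 : ℝ) 1, (∑ p ∈ Finset.HasAntidiagonal.antidiagonal k,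
        A p.1 t * transport d e p.2 (i + (p.1 + 1)) 0) =
        -((fun t => Complex.exp (prim (d i) s - prim (d i) t) *
          (e i t * transport d e k (i + 1) t)) (1 - t)) := by
      intro t ht
      have ht' : 1 - t ∈ Icc (0 : ℝ) 1 := ⟨by linarith [ht.2], by linarith [ht.1]⟩
      simp only
      rw [hprim i s hs, hprim i (1 - t) ht', ← ih (i + 1) ht', add_sub_add_right_eq_sub,
        Finset.mul_sum, Finset.mul_sum, ← Finset.sum_neg_distrib, sub_sub_cancel]
      refine Finset.sum_congr rfl fun p _ => ?_
      rw [show i + 1 + p.1 = i + (p.1 + 1) by ring]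
      simp only [A]
      rw [her i t ht]
      ring
    have h2 : -∫ t in (0 : ℝ)..s, Complex.exp (prim (d i) s - prim (d i) t) *
        (e i t * transport d e k (i + 1) t) = ∑ p ∈ Finset.HasAntidiagonal.antidiagonal k,
          transport dι eι (p.1 + 1) i (1 - s) * transport d e p.2 (i + (p.1 + 1)) 0 := by
      rw [← hrev h3 s hs]
      unfold prim
      rw [intervalIntegral.integral_finsetSum]
      · refine Finset.sum_congr rfl fun p _ => ?_
        rw [intervalIntegral.integral_mul_const]
        rfl
      · intro p _
        exact ((hA p.1).mul continuousOn_const).mono h1s ⟨zero_le_one, le_rfl⟩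
    rw [transport, hsplit (((he i).mul (continuousOn_transport hd he k (i + 1))).mul' hE) s hs,
      sub_eq_add_neg (prim _ _), h1, h2, Finset.Nat.antidiagonal_succ, Finset.sum_cons, Finset.sum_map]
    rfl

end Transport

end ExpIterInt

end

noncomputable section
namespace ExpIterInt
universe u
open MeasureTheory intervalIntegral Set Filter Topology

variable {n : ℕ} {M : Type u} [TopologicalSpace M]
  [ChartedSpace (EuclideanSpace ℝ (Fin n)) M] [IsManifold (𝓡 n) ∞ M]

/-! ### Pullbacks of forms along piecewise differentiable loops -/

/-- The one-sided velocity is continuous up to the ends of a C¹ piece, because the tangent map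
within the interval is. -/
theorem continuousOn_apply_mfderivWithin {f : ℝ → M} {a b : ℝ} (hab : a < b)
    (hf : ContMDiffOn 𝓘(ℝ, ℝ) (𝓡 n) 1 f (Icc a b)) (η : OneForm n M) :
    ContinuousOn (fun t => (η (f t) (mfderivWithin 𝓘(ℝ, ℝ) (𝓡 n) f (Icc a b) t (1 : ℝ)) : ℂ))
      (Icc a b) := by
  have : IsManifold (𝓡 n) 1 M := IsManifold.of_le (n := ∞) (by norm_cast)
  have h1 := hf.continuousOn_tangentMapWithin le_rfl (uniqueDiffOn_Icc hab).uniqueMDiffOn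
  have h2 : Continuous fun t : ℝ => (⟨t, (1 : ℝ)⟩ : TangentBundle 𝓘(ℝ, ℝ) ℝ) :=
    (tangentBundleModelSpaceHomeomorph 𝓘(ℝ, ℝ)).symm.continuous.comp
      (f := fun t : ℝ => ((t, (1 : ℝ)) : ModelProd ℝ ℝ))
      (continuous_id.prodMk continuous_const : Continuous fun t : ℝ => (t, (1 : ℝ)))
  have h3 := h1.comp h2.continuousOn (s := Icc a b) (fun t ht => ht)
  have h4 := η.contMDiff.continuous.comp_continuousOn hf.continuousOn
  have h5 := ContinuousOn.clm_bundle_apply (F₁ := EuclideanSpace ℝ (Fin n)) (F₂ := ℂ)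
    (E₁ := fun p : M => TangentSpace (𝓡 n) p) (E₂ := Bundle.Trivial M ℂ) (b := f)
    (ϕ := fun t => η (f t)) (v := fun t => mfderivWithin 𝓘(ℝ, ℝ) (𝓡 n) f (Icc a b) t (1 : ℝ))
    h4 h3
  exact ((Bundle.Trivial.homeomorphProd M ℂ).continuous.comp_continuousOn h5).snd

theorem exists_smooth_left (S : Finset ℝ) {t : ℝ} (ht : 0 < t) :
    ∃ a, 0 ≤ a ∧ a < t ∧ ∀ s ∈ S, s ∉ Ioo a t := by
  have h : (⋂ s ∈ S, {u : ℝ | s < t → s < u}) ∩ Ioo 0 t ∈ 𝓝[<] t := by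
    refine inter_mem ((biInter_finset_mem S).mpr fun s _ => ?_) (Ioo_mem_nhdsLT ht)
    by_cases hs : s < t
    · exact mem_of_superset (Ioo_mem_nhdsLT hs) fun u hu _ => hu.1
    · exact mem_of_superset univ_mem fun u _ h => absurd h hs
  obtain ⟨a, ha⟩ := Filter.nonempty_of_mem h
  refine ⟨a, ha.2.1.le, ha.2.2, fun s hs hsI => ?_⟩
  have := mem_iInter₂.mp ha.1 s hs hsI.2
  exact lt_asymm this hsI.1

theorem exists_smooth_right (S : Finset ℝ) {t : ℝ} (ht : t < 1) :
    ∃ b, b ≤ 1 ∧ t < b ∧ ∀ s ∈ S, s ∉ Ioo t b := by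
  obtain ⟨a, h0, h1, h2⟩ := exists_smooth_left (S.image (fun s => 1 - s)) (t := 1 - t) (by linarith)
  refine ⟨1 - a, by linarith, by linarith, fun s hs hsI => ?_⟩
  exact h2 _ (Finset.mem_image_of_mem _ hs) ⟨by linarith [hsI.2], by linarith [hsI.1]⟩

variable {x : M}

theorem exists_continuousOn_eq_pullback {γ : Loop n x} {a b : ℝ} (hab : a < b)
    (h : ContMDiffOn 𝓘(ℝ, ℝ) (𝓡 n) 1 γ.path.extend (Icc a b)) (η : OneForm n M) :
    ∃ F : ℝ → ℂ, ContinuousOn F (Icc a b) ∧ ∀ t ∈ Ioo a b, pullback γ η t = F t := by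
  refine ⟨_, continuousOn_apply_mfderivWithin hab h η, fun t ht => ?_⟩
  rw [pullback, mfderivWithin_of_mem_nhds (Icc_mem_nhds ht.1 ht.2)]

theorem integrableOn_pullback {γ : Loop n x} {a b : ℝ} (hab : a < b)
    (h : ContMDiffOn 𝓘(ℝ, ℝ) (𝓡 n) 1 γ.path.extend (Icc a b)) (η : OneForm n M) :
    IntegrableOn (pullback γ η) (Icc a b) := by
  obtain ⟨F, hF, hF'⟩ := exists_continuousOn_eq_pullback hab h η
  rw [integrableOn_Icc_iff_integrableOn_Ioo]
  exact ((hF.integrableOn_Icc).mono_set Ioo_subset_Icc_self).congr_fun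
    (fun t ht => (hF' t ht).symm) measurableSet_Ioo

/-- On each side of any point there is a C¹ piece, in whose interior the pullback agrees with a
function continuous on the closed piece. Compactness gives integrability, and only break points can
be discontinuities. -/
theorem isPiecewiseCont_pullback (γ : Loop n x) (η : OneForm n M) :
    IsPiecewiseCont (pullback γ η) := by
  obtain ⟨S, hS⟩ := γ.piecewiseC1
  constructor
  · rw [intervalIntegrable_iff_integrableOn_Icc_of_le zero_le_one]
    refine LocallyIntegrableOn.integrableOn_isCompact (fun t ht => ?_) isCompact_Icc
    have hl : IntegrableAtFilter (pullback γ η) (𝓝[Icc 0 1 ∩ Iic t] t) volume := by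
      rcases ht.1.eq_or_lt with rfl | h0
      · refine ⟨{0}, mem_of_superset self_mem_nhdsWithin fun u hu => ?_, by simp⟩
        exact le_antisymm hu.2 hu.1.1
      · obtain ⟨a, ha0, hat, ha⟩ := exists_smooth_left S h0
        refine ⟨Icc a t, ?_, integrableOn_pullback hat (hS a t ha0 hat ht.2 ha) η⟩
        exact nhdsWithin_mono t inter_subset_right (Icc_mem_nhdsLE hat)
    have hr : IntegrableAtFilter (pullback γ η) (𝓝[Icc 0 1 ∩ Ici t] t) volume := by
      rcases ht.2.eq_or_lt with rfl | h1
      · refine ⟨{1}, mem_of_superset self_mem_nhdsWithin fun u hu => ?_, by simp⟩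
        exact le_antisymm hu.1.2 hu.2
      · obtain ⟨b, hb1, htb, hb⟩ := exists_smooth_right S h1
        refine ⟨Icc t b, ?_, integrableOn_pullback htb (hS t b ht.1 htb hb1 hb) η⟩
        exact nhdsWithin_mono t inter_subset_right (Icc_mem_nhdsGE htb)
    have := IntegrableAtFilter.sup_iff.mpr ⟨hl, hr⟩
    rwa [← nhdsWithin_union, ← inter_union_distrib_left, Iic_union_Ici, inter_univ] at this
  · refine S.countable_toSet.mono fun t ht => ?_
    by_contra htS
    obtain ⟨a, ha0, hat, ha⟩ := exists_smooth_left S ht.1.1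
    obtain ⟨b, hb1, htb, hb⟩ := exists_smooth_right S ht.1.2
    have hc := hS a b ha0 (hat.trans htb) hb1 fun s hs hsI => by
      rcases lt_trichotomy s t with h | rfl | h
      · exact ha s hs ⟨hsI.1, h⟩
      · exact htS hs
      · exact hb s hs ⟨h, hsI.2⟩
    obtain ⟨F, hF, hF'⟩ := exists_continuousOn_eq_pullback (hat.trans htb) hc η
    refine ht.2 ((hF.continuousAt (Icc_mem_nhds hat htb)).congr ?_)
    filter_upwards [Ioo_mem_nhds hat htb] with u hu using (hF' u hu).symm

theorem pullback_add (γ : Loop n x) (η η' : OneForm n M) :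
    pullback γ (η + η') = fun t => pullback γ η t + pullback γ η' t := rfl

theorem pullback_neg (γ : Loop n x) (η : OneForm n M) :
    pullback γ (-η) = fun t => -pullback γ η t := rfl

theorem pullback_zero (γ : Loop n x) : pullback γ (0 : OneForm n M) = fun _ => 0 := rfl

theorem pullback_const (η : OneForm n M) : pullback (Loop.const n x) η = fun _ => 0 := by
  ext t
  have h : ⇑(Loop.const n x).path.extend = fun _ => x := by
    ext t
    simp [Loop.const]
  rw [pullback, h, mfderiv_const]
  exact (η x).map_zero

theorem mfderiv_comp_affine {n : ℕ} {M : Type u} [TopologicalSpace M]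
    [ChartedSpace (EuclideanSpace ℝ (Fin n)) M] {f : ℝ → M} {c : ℝ} (hc : c ≠ 0) (b t : ℝ) :
    (mfderiv 𝓘(ℝ, ℝ) (𝓡 n) (fun u => f (c * u + b)) t (1 : ℝ) : EuclideanSpace ℝ (Fin n)) =
      c • (mfderiv 𝓘(ℝ, ℝ) (𝓡 n) f (c * t + b) (1 : ℝ) : EuclideanSpace ℝ (Fin n)) := by
  have hA : ∀ c b u : ℝ, HasMFDerivAt 𝓘(ℝ, ℝ) 𝓘(ℝ, ℝ) (fun u : ℝ => c * u + b) u
      (ContinuousLinearMap.toSpanSingleton ℝ c) := fun c b u =>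
    (((hasDerivAt_id u).const_mul c).add_const b).hasFDerivAt.hasMFDerivAt.congr_mfderiv (by
      simp
      rfl)
  by_cases h : MDifferentiableAt 𝓘(ℝ, ℝ) (𝓡 n) f (c * t + b)
  · have := (h.hasMFDerivAt.comp t (hA c b t)).mfderiv
    change (mfderiv 𝓘(ℝ, ℝ) (𝓡 n) (f ∘ fun u => c * u + b) t (1 : ℝ) :
      EuclideanSpace ℝ (Fin n)) = _
    rw [this]
    change mfderiv 𝓘(ℝ, ℝ) (𝓡 n) f (c * t + b) (ContinuousLinearMap.toSpanSingleton ℝ c (1 : ℝ)) = _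
    rw [ContinuousLinearMap.toSpanSingleton_apply, one_smul]
    have h2 := (mfderiv 𝓘(ℝ, ℝ) (𝓡 n) f (c * t + b)).map_smul c (1 : ℝ)
    exact (congrArg _ (mul_one c).symm).trans h2
  -- The affine map is invertible, so differentiability fails on both sides together and both
  -- derivatives are zero by convention. Hence no regularity of `f` is needed.
  · have h' : ¬MDifferentiableAt 𝓘(ℝ, ℝ) (𝓡 n) (fun u => f (c * u + b)) t := by
      intro h1
      refine h ?_
      have hinv : f = (fun u => f (c * u + b)) ∘ fun u => c⁻¹ * u + (-(c⁻¹ * b)) := by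
        ext u
        simp only [Function.comp_apply]
        congr 1
        field_simp
        ring
      have ht : c⁻¹ * (c * t + b) + (-(c⁻¹ * b)) = t := by
        field_simp
        ring
      rw [hinv]
      refine MDifferentiableAt.comp (c * t + b) ?_ (hA c⁻¹ (-(c⁻¹ * b)) _).mdifferentiableAt
      rwa [ht]
    rw [mfderiv_zero_of_not_mdifferentiableAt h, mfderiv_zero_of_not_mdifferentiableAt h']
    exact (smul_zero c).symm

theorem pullback_eq_of_eventuallyEq {α β : Loop n x} (η : OneForm n M) {c : ℝ} (hc : c ≠ 0)
    {b t : ℝ} (h : ∀ᶠ u in 𝓝 t, α.path.extend u = β.path.extend (c * u + b)) :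
    pullback α η t = c * pullback β η (c * t + b) := by
  have h1 : ∀ (p q : M), p = q → ∀ v : EuclideanSpace ℝ (Fin n), (η p v : ℂ) = η q v := by
    rintro p _ rfl v
    rfl
  have h2 : (mfderiv 𝓘(ℝ, ℝ) (𝓡 n) α.path.extend t (1 : ℝ) : EuclideanSpace ℝ (Fin n)) =
      c • (mfderiv 𝓘(ℝ, ℝ) (𝓡 n) β.path.extend (c * t + b) (1 : ℝ) : EuclideanSpace ℝ (Fin n)) := by
    rw [← mfderiv_comp_affine hc, Filter.EventuallyEq.mfderiv_eq h]
    rfl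
  exact (h1 _ _ h.self_of_nhds _).trans ((congrArg _ h2).trans
    (((η (β.path.extend (c * t + b))).map_smul c _).trans (Complex.real_smul ..)))

theorem isConcat_pullback (α β : Loop n x) (η : OneForm n M) :
    IsConcat (pullback (α.concat β) η) (pullback α η) (pullback β η) where
  left t ht := by
    rw [pullback_eq_of_eventuallyEq (β := α) η two_ne_zero (b := 0)]
    · simp
    · filter_upwards [Ioo_mem_nhds ht.1 ht.2] with u hu
      rw [add_zero]
      exact Path.extend_trans_of_le_half _ _ hu.2.le
  right t ht := by
    rw [pullback_eq_of_eventuallyEq (β := β) η two_ne_zero (b := -1)]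
    · simp [sub_eq_add_neg]
    · filter_upwards [Ioo_mem_nhds ht.1 ht.2] with u hu
      exact Path.extend_trans_of_half_le _ _ hu.1.le

theorem pullback_inverse (α : Loop n x) (η : OneForm n M) (t : ℝ) :
    pullback α.inverse η t = -pullback α η (1 - t) := by
  rw [pullback_eq_of_eventuallyEq (β := α) η (c := -1) (by norm_num) (b := 1)]
  · rw [show -1 * t + 1 = 1 - t by ring]
    simp
  · refine Eventually.of_forall fun u => ?_
    rw [show -1 * u + 1 = 1 - u by ring]
    simp [Loop.inverse, Path.extend_symm_apply]

/-! ### Local primitives of closed forms -/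

/-- The form in the chart is `η` applied to the tangent map of the inverse chart. That tangent map
costs one derivative, so the inverse chart is taken C² and the result is C¹. -/
theorem differentiableOn_inChart (η : OneForm n M) (p : M) :
    DifferentiableOn ℝ (inChart η p) (extChartAt (𝓡 n) p).target := by
  have h2 : IsManifold (𝓡 n) 2 M := IsManifold.of_le (n := ∞) (by norm_cast)
  have h1 : IsManifold (𝓡 n) 1 M := IsManifold.of_le (n := ∞) (by norm_cast)
  set φ := extChartAt (𝓡 n) p
  have ho : IsOpen φ.target := isOpen_extChartAt_target p
  have hφ : ContMDiffOn 𝓘(ℝ, EuclideanSpace ℝ (Fin n)) (𝓡 n) 2 φ.symm φ.target :=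
    contMDiffOn_extChartAt_symm p
  suffices h : ContDiffOn ℝ 1 (inChart η p) φ.target from h.differentiableOn one_ne_zero
  rw [contDiffOn_clm_apply]
  intro v
  have ht := hφ.contMDiffOn_tangentMapWithin (m := 1) (by norm_num) ho.uniqueMDiffOn
  have hv : ContMDiff 𝓘(ℝ, EuclideanSpace ℝ (Fin n)) 𝓘(ℝ, EuclideanSpace ℝ (Fin n)).tangent 1
      fun y : EuclideanSpace ℝ (Fin n) =>
        (⟨y, v⟩ : TangentBundle 𝓘(ℝ, EuclideanSpace ℝ (Fin n)) (EuclideanSpace ℝ (Fin n))) :=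
    contMDiff_vectorSpace_iff_contDiff.mpr contDiff_const
  have h3 := ht.comp hv.contMDiffOn (s := φ.target) (fun y hy => hy)
  have h4 := (η.contMDiff.of_le (m := 1) (by norm_cast)).comp_contMDiffOn (hφ.of_le one_le_two)
  have h5 := ContMDiffOn.clm_bundle_apply (F₁ := EuclideanSpace ℝ (Fin n)) (F₂ := ℂ)
    (E₁ := fun p : M => TangentSpace (𝓡 n) p) (E₂ := Bundle.Trivial M ℂ) (b := φ.symm)
    (ϕ := fun y => η (φ.symm y)) (v := fun y => mfderivWithin 𝓘(ℝ, EuclideanSpace ℝ (Fin n)) (𝓡 n) φ.symm φ.target y v)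
    h4 h3
  intro y hy
  have h6 := (Bundle.contMDiffWithinAt_totalSpace.mp (h5 y hy)).2
  rw [contMDiffWithinAt_iff_contDiffWithinAt] at h6
  refine h6.congr (fun z hz => ?_) ?_
  all_goals
    simp only [inChart]
    rw [← mfderivWithin_of_mem_nhds (ho.mem_nhds ‹_›)]
    rfl

/-- The Poincaré lemma on a ball in a chart. The primitive is carried back by the chart, whose
derivative is inverse to that of the inverse chart. -/
theorem IsClosedForm.exists_primitive {δ : OneForm n M} (hδ : IsClosedForm δ) (p : M) :
    ∃ (U : Set M) (g : M → ℂ), IsOpen U ∧ p ∈ U ∧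
      ∀ q ∈ U, HasMFDerivAt (𝓡 n) 𝓘(ℝ, ℂ) g q (δ q) := by
  have h1 : IsManifold (𝓡 n) 1 M := IsManifold.of_le (n := ∞) (by norm_cast)
  set φ := extChartAt (𝓡 n) p
  have ho : IsOpen φ.target := isOpen_extChartAt_target p
  obtain ⟨r, hr, hball⟩ := Metric.isOpen_iff.mp ho (φ p) (mem_extChartAt_target p)
  obtain ⟨f, hf⟩ := (convex_ball (φ p) r).exists_forall_hasFDerivAt_of_fderiv_symmetric
    Metric.isOpen_ball ((differentiableOn_inChart δ p).mono hball)
    fun y hy v w => sub_eq_zero.mp (hδ p y (hball hy) v w)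
  refine ⟨φ.source ∩ φ ⁻¹' Metric.ball (φ p) r, f ∘ φ,
    (continuousOn_extChartAt p).isOpen_inter_preimage (isOpen_extChartAt_source p)
      Metric.isOpen_ball, ⟨mem_extChartAt_source p, Metric.mem_ball_self hr⟩, fun q hq => ?_⟩
  have h2 := (hf (φ q) hq.2).hasMFDerivAt
  have h3 : MDifferentiableAt (𝓡 n) 𝓘(ℝ, EuclideanSpace ℝ (Fin n)) φ q :=
    mdifferentiableAt_extChartAt (by simpa [φ] using hq.1)
  have h4 := h2.comp q h3.hasMFDerivAt
  refine h4.congr_mfderiv (ContinuousLinearMap.ext fun v => ?_)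
  have h5 : ∀ q' : M, q' = q → ∀ w w' : EuclideanSpace ℝ (Fin n), w = w' →
      (δ q' w : ℂ) = δ q w' := by
    rintro _ rfl w _ rfl
    rfl
  refine h5 _ (φ.left_inv hq.1) _ _ ?_
  have h6 := mfderivWithin_extChartAt_symm_comp_mfderiv_extChartAt' (I := 𝓡 n) hq.1
  rw [ModelWithCorners.range_eq_univ, mfderivWithin_univ] at h6
  exact DFunLike.congr_fun h6 v

end ExpIterInt

end

noncomputable section
namespace ExpIterInt
universe u
open MeasureTheory intervalIntegral Set

variable {n : ℕ} {M : Type u} [TopologicalSpace M]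
  [ChartedSpace (EuclideanSpace ℝ (Fin n)) M] [IsManifold (𝓡 n) ∞ M] {x : M}

/-! ### Exponential iterated integrals as transports -/

/-- The transport along `γ` from the time `s` to the end, see `transport`, for sequences of
forms. -/
def transportAlong (δ η : ℕ → OneForm n M) (k i : ℕ) (γ : Loop n x) (s : ℝ) : ℂ :=
  transport (fun j => pullback γ (δ j)) (fun j => pullback γ (η j)) k i s

theorem iterIntFrom_eq_iterPrim (γ : Loop n x) (ws : List (OneForm n M)) :
    iterIntFrom γ ws = iterPrim (ws.map (pullback γ)) := by
  induction ws with
  | nil => rfl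
  | cons η ws ih =>
    ext s
    rw [iterIntFrom, ih]
    rfl

/-- Infinite sequences of forms make shifting the index harmless. A transport of length `k` starting
at index 0 reads only `δ 0, …, δ k` and `η 0, …, η (k - 1)`. -/
theorem expIterInt_eq_transportAlong (k : ℕ) (δ η : ℕ → OneForm n M) :
    expIterInt (fun i : Fin (k + 1) => δ i) (fun i : Fin k => η i) =
      fun γ : Loop n x => transportAlong δ η k 0 γ 0 := by
  ext γ
  obtain ⟨_, -, -, -, h⟩ := hasSum_transportWord (fun i => isPiecewiseCont_pullback γ (δ i))
    (fun i => isPiecewiseCont_pullback γ (η i)) k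
  rw [transportAlong, ← (h 0 ⟨le_rfl, zero_le_one⟩).tsum_eq, expIterInt]
  congr 1
  ext m
  rw [iterInt, iterIntFrom_eq_iterPrim]
  congr 1
  simp [expWord, transportWord, List.map_ofFn, Function.comp_def]

theorem expInt_apply (δ : OneForm n M) (γ : Loop n x) :
    expInt δ γ = Complex.exp (prim (pullback γ δ) 0) := by
  have h := congrFun (expIterInt_eq_transportAlong (x := x) 0 (fun _ => δ) (fun _ => 0)) γ
  rw [expInt]
  convert! h

theorem EB_eq_span (x : M) (L : Submodule ℤ (OneForm n M)) :
    EB x L = Submodule.span ℂ {f | ∃ (k : ℕ) (δ η : ℕ → OneForm n M), (∀ i, δ i ∈ L) ∧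
      f = fun γ : Loop n x => transportAlong δ η k 0 γ 0} := by
  rw [EB]
  congr 1
  ext f
  constructor
  · rintro ⟨k, δ, η, hδ, rfl⟩
    -- Padding by 0 keeps the exponents in `L`, and the padded terms are never read.
    refine ⟨k, fun i => if h : i < k + 1 then δ ⟨i, h⟩ else 0,
      fun i => if h : i < k then η ⟨i, h⟩ else 0, fun i => ?_, ?_⟩
    · dsimp only
      split_ifs
      exacts [hδ _, L.zero_mem]
    · rw [← expIterInt_eq_transportAlong]
      congr 1 <;>
      · ext1 i
        simp only [Fin.is_lt, dite_true, Fin.eta]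
  · rintro ⟨k, δ, η, hδ, rfl⟩
    exact ⟨k, _, _, fun i => hδ i, (expIterInt_eq_transportAlong k δ η).symm⟩

theorem transportAlong_shift (δ η : ℕ → OneForm n M) (j k i : ℕ) (γ : Loop n x) (s : ℝ) :
    transportAlong (fun i => δ (i + j)) (fun i => η (i + j)) k i γ s =
      transportAlong δ η k (i + j) γ s := by
  simp only [transportAlong]
  rw [← transport_shift]

theorem transportAlong_mem (k i : ℕ) {L : Submodule ℤ (OneForm n M)} {δ : ℕ → OneForm n M}
    (hδ : ∀ i, δ i ∈ L) (η : ℕ → OneForm n M) :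
    (fun γ : Loop n x => transportAlong δ η k i γ 0) ∈ EB x L := by
  rw [EB_eq_span]
  refine Submodule.subset_span ⟨k, fun j => δ (j + i), fun j => η (j + i), fun j => hδ _, ?_⟩
  ext γ
  rw [transportAlong_shift, zero_add]

theorem continuousOn_transportAlong (δ η : ℕ → OneForm n M) (k i : ℕ) (γ : Loop n x) :
    ContinuousOn (transportAlong δ η k i γ) (Icc 0 1) :=
  continuousOn_transport (fun _ => isPiecewiseCont_pullback γ _)
    (fun _ => isPiecewiseCont_pullback γ _) k i

theorem transportAlong_concat (δ η : ℕ → OneForm n M) (k i : ℕ) (α β : Loop n x) :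
    transportAlong δ η k i (α.concat β) 0 = ∑ p ∈ Finset.HasAntidiagonal.antidiagonal k,
      transportAlong δ η p.1 i α 0 * transportAlong δ η p.2 (i + p.1) β 0 := by
  have h := transport_concat (fun j => isPiecewiseCont_pullback (α.concat β) (δ j))
    (fun j => isPiecewiseCont_pullback (α.concat β) (η j))
    (fun j => isPiecewiseCont_pullback α (δ j)) (fun j => isPiecewiseCont_pullback α (η j))
    (fun j => isConcat_pullback α β (δ j)) (fun j => isConcat_pullback α β (η j)) k i
    (s := 0) ⟨le_rfl, by norm_num⟩
  rwa [mul_zero] at h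

/-- This is `transport_reverse` at s = 1, where the remaining path is trivial and its transport is
the identity. -/
theorem transportAlong_inverse (δ η : ℕ → OneForm n M) (k i : ℕ) (α : Loop n x) :
    (∑ p ∈ Finset.HasAntidiagonal.antidiagonal k,
      transportAlong δ η p.1 i α.inverse 0 * transportAlong δ η p.2 (i + p.1) α 0) =
      if k = 0 then 1 else 0 := by
  have h := transport_reverse (fun j => isPiecewiseCont_pullback α (δ j))
    (fun j => isPiecewiseCont_pullback α (η j))
    (fun j => isPiecewiseCont_pullback α.inverse (δ j))
    (fun j => isPiecewiseCont_pullback α.inverse (η j))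
    (fun j t _ => pullback_inverse α (δ j) t) (fun j t _ => pullback_inverse α (η j) t) k i
    (s := 1) ⟨zero_le_one, le_rfl⟩
  rwa [sub_self, transport_one] at h

theorem transportAlong_const (δ η : ℕ → OneForm n M) (k i : ℕ) :
    transportAlong δ η k i (Loop.const n x) 0 = if k = 0 then 1 else 0 := by
  cases k <;> simp [transportAlong, transport, pullback_const, prim]

/-! ### Products -/

/-- Prepend a term to a sequence. -/
def consSeq {X : Type*} (a : X) (f : ℕ → X) : ℕ → X
  | 0 => a
  | i + 1 => f i

/-- `f` is a finite sum of transports of length `k` with exponents in `L`. -/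
def IsTransportSum (L : Submodule ℤ (OneForm n M)) (k : ℕ) (f : Loop n x → ℝ → ℂ) : Prop :=
  ∃ l : List ((ℕ → OneForm n M) × (ℕ → OneForm n M)), (∀ v ∈ l, ∀ i, v.1 i ∈ L) ∧
    ∀ γ : Loop n x, ∀ s ∈ Icc (0 : ℝ) 1, f γ s = (l.map fun v => transportAlong v.1 v.2 k 0 γ s).sum

variable {L : Submodule ℤ (OneForm n M)}

theorem IsTransportSum.add {k : ℕ} {f g : Loop n x → ℝ → ℂ} (hf : IsTransportSum L k f)
    (hg : IsTransportSum L k g) : IsTransportSum L k fun γ s => f γ s + g γ s := by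
  obtain ⟨l, hl, h⟩ := hf
  obtain ⟨l', hl', h'⟩ := hg
  refine ⟨l ++ l', fun v hv => ?_, fun γ s hs => ?_⟩
  · rcases List.mem_append.mp hv with hv | hv
    exacts [hl v hv, hl' v hv]
  · dsimp only
    rw [h γ s hs, h' γ s hs, List.map_append, List.sum_append]

theorem continuousOn_list_sum {ι : Type*} {f : ι → ℝ → ℂ} (l : List ι)
    (hf : ∀ v ∈ l, ContinuousOn (f v) (Icc 0 1)) :
    ContinuousOn (fun t => (l.map fun v => f v t).sum) (Icc 0 1) := by
  induction l with
  | nil => simpa using continuousOn_const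
  | cons v l ih =>
    simp only [List.map_cons, List.sum_cons]
    exact (hf v List.mem_cons_self).add (ih fun w hw => hf w (List.mem_cons_of_mem _ hw))

theorem prim_mul_list_sum {ι : Type*} {F : ℝ → ℂ} (hF : IsPiecewiseCont F) {f : ι → ℝ → ℂ}
    (l : List ι) (hf : ∀ v ∈ l, ContinuousOn (f v) (Icc 0 1)) {s : ℝ} (hs : s ∈ Icc (0 : ℝ) 1) :
    prim (fun t => F t * (l.map fun v => f v t).sum) s =
      (l.map fun v => prim (fun t => F t * f v t) s).sum := by
  induction l with
  | nil => simp [prim]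
  | cons v l ih =>
    have h := fun w hw => hf w (List.mem_cons_of_mem _ hw)
    simp only [List.map_cons, List.sum_cons, mul_add]
    rw [prim_add (hF.mul (hf v List.mem_cons_self)) (hF.mul (continuousOn_list_sum l h)) hs, ih h]

/-- One step of the recursion that defines `transport`, applied termwise to a finite sum. -/
theorem IsTransportSum.prepend {k : ℕ} {f : Loop n x → ℝ → ℂ} (hf : IsTransportSum L k f)
    {δ : OneForm n M} (hδ : δ ∈ L) (ξ : OneForm n M) :
    IsTransportSum L (k + 1) fun γ s => prim (fun t =>
      Complex.exp (prim (pullback γ δ) s - prim (pullback γ δ) t) * (pullback γ ξ t * f γ t)) s := by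
  obtain ⟨l, hl, h⟩ := hf
  refine ⟨l.map fun v => (consSeq δ v.1, consSeq ξ v.2), fun v hv i => ?_, fun γ s hs => ?_⟩
  · obtain ⟨w, hw, rfl⟩ := List.mem_map.mp hv
    cases i with
    | zero => exact hδ
    | succ i => exact hl w hw i
  · have hE : ContinuousOn (fun t => Complex.exp (prim (pullback γ δ) s - prim (pullback γ δ) t))
        (Icc 0 1) := Complex.continuous_exp.comp_continuousOn
      (continuousOn_const.sub (isPiecewiseCont_pullback γ δ).continuousOn_prim)
    have h1 := prim_mul_list_sum ((isPiecewiseCont_pullback γ ξ).mul' hE)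
      (f := fun v t => transportAlong v.1 v.2 k 0 γ t) l
      (fun v _ => continuousOn_transportAlong v.1 v.2 k 0 γ) hs
    rw [List.map_map]
    refine Eq.trans ?_ (h1.trans ?_)
    · refine prim_congr hs.2 fun t ht => ?_
      rw [h γ t ⟨hs.1.trans ht.1, ht.2⟩, mul_assoc]
    · congr 1
      refine List.map_congr_left fun v _ => ?_
      simp only [Function.comp_apply, transportAlong]
      rw [transport, ← transport_shift _ _ 1 k 0]
      simp only [consSeq, mul_assoc]

/-- The shuffle product, by induction on the total length. The new exponents have the form δ i + δ'
j, which is why `L` must be closed under addition. All starting times are needed because the product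
recurs under the integral sign. -/
theorem isTransportSum_mul (δ η δ' η' : ℕ → OneForm n M) (hδ : ∀ i, δ i ∈ L) (hδ' : ∀ i, δ' i ∈ L)
    (k k' : ℕ) : IsTransportSum L (k + k') fun (γ : Loop n x) s =>
      transportAlong δ η k 0 γ s * transportAlong δ' η' k' 0 γ s := by
  have hp := fun (γ : Loop n x) (ξ : ℕ → OneForm n M) i => isPiecewiseCont_pullback γ (ξ i)
  have shift : ∀ (δ η : ℕ → OneForm n M) k (γ : Loop n x) t,
      transportAlong (fun i => δ (i + 1)) (fun i => η (i + 1)) k 0 γ t =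
      transportAlong δ η k 1 γ t := fun δ η k γ t => transportAlong_shift δ η 1 k 0 γ t
  induction hN : k + k' generalizing δ η δ' η' k k' with
  | zero =>
    obtain ⟨rfl, rfl⟩ : k = 0 ∧ k' = 0 := by omega
    refine ⟨[(fun _ => δ 0 + δ' 0, fun _ => 0)], ?_, fun γ s hs => ?_⟩
    · simpa using L.add_mem (hδ 0) (hδ' 0)
    · simp only [transportAlong]
      rw [transport_zero_mul_zero (hp γ δ) (hp γ δ') hs]
      simp [transport, pullback_add]
  | succ N ih =>
    have hL := L.add_mem (hδ 0) (hδ' 0)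
    have left : ∀ k, k + k' = N → IsTransportSum L (N + 1) fun (γ : Loop n x) s => prim (fun t =>
        Complex.exp (prim (pullback γ (δ 0 + δ' 0)) s - prim (pullback γ (δ 0 + δ' 0)) t) *
          (pullback γ (η 0) t *
            (transportAlong δ η k 1 γ t * transportAlong δ' η' k' 0 γ t))) s := by
      intro k hk
      have := (ih (fun i => δ (i + 1)) (fun i => η (i + 1)) δ' η' (fun i => hδ _) hδ' k k'
        hk).prepend hL (η 0)
      simpa only [shift] using this
    have right : ∀ k', k + k' = N → IsTransportSum L (N + 1) fun (γ : Loop n x) s => prim (fun t =>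
        Complex.exp (prim (pullback γ (δ 0 + δ' 0)) s - prim (pullback γ (δ 0 + δ' 0)) t) *
          (pullback γ (η' 0) t *
            (transportAlong δ η k 0 γ t * transportAlong δ' η' k' 1 γ t))) s := by
      intro k' hk
      have := (ih δ η (fun i => δ' (i + 1)) (fun i => η' (i + 1)) hδ (fun i => hδ' _) k k'
        hk).prepend hL (η' 0)
      simpa only [shift] using this
    have congr : ∀ {f g : Loop n x → ℝ → ℂ}, IsTransportSum L (N + 1) f →
        (∀ γ, ∀ s ∈ Icc (0 : ℝ) 1, g γ s = f γ s) → IsTransportSum L (N + 1) g := by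
      rintro f g ⟨l, hl, h⟩ hfg
      exact ⟨l, hl, fun γ s hs => (hfg γ s hs).trans (h γ s hs)⟩
    match k, k' with
    | 0, 0 => omega
    | k + 1, 0 =>
      refine congr (left k (by omega)) fun γ s hs => ?_
      exact transport_succ_mul_zero (hp γ δ) (hp γ δ') k hs
    -- This is the mirror image of the previous case, with the two factors exchanged.
    | 0, k' + 1 =>
      refine congr (right k' (by omega)) fun γ s hs => ?_
      have h := transport_succ_mul_zero (e := fun i => pullback γ (η' i))
        (e' := fun i => pullback γ (η i)) (hp γ δ') (hp γ δ) k' hs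
      simp only [transportAlong]
      rw [mul_comm, h, add_comm (δ 0)]
      simp only [pullback_add, mul_comm (transport _ _ 0 0 _)]
    | k + 1, k' + 1 =>
      refine congr ((left k (by omega)).add (right k' (by omega))) fun γ s hs => ?_
      exact transport_succ_mul_succ (hp γ δ) (hp γ η) (hp γ δ') (hp γ η') k k' hs

theorem one_mem_EB (x : M) (L : Submodule ℤ (OneForm n M)) : (1 : Loop n x → ℂ) ∈ EB x L := by
  have h := transportAlong_mem (x := x) 0 0 (L := L) (δ := fun _ => 0) (fun _ => L.zero_mem)
    (fun _ => 0)
  convert! h using 1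
  ext γ
  simp [transportAlong, transport, pullback_zero, prim]

theorem mul_mem_EB {f g : Loop n x → ℂ} (hf : f ∈ EB x L) (hg : g ∈ EB x L) : f * g ∈ EB x L := by
  rw [EB_eq_span] at hf hg
  induction hf, hg using Submodule.span_induction₂ with
  | mem_mem f g hf hg =>
    obtain ⟨k, δ, η, hδ, rfl⟩ := hf
    obtain ⟨k', δ', η', hδ', rfl⟩ := hg
    obtain ⟨l, hl, h⟩ := isTransportSum_mul (x := x) δ η δ' η' hδ hδ' k k'
    have h1 : ((fun γ : Loop n x => transportAlong δ η k 0 γ 0) * fun γ =>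
        transportAlong δ' η' k' 0 γ 0) =
        (l.map fun v => fun γ : Loop n x => transportAlong v.1 v.2 (k + k') 0 γ 0).sum := by
      ext γ
      refine (h γ 0 ⟨le_rfl, zero_le_one⟩).trans ?_
      clear h hl
      induction l with
      | nil => rfl
      | cons v l ih => simp [ih]
    rw [h1]
    refine list_sum_mem fun f hf => ?_
    obtain ⟨v, hv, rfl⟩ := List.mem_map.mp hf
    exact transportAlong_mem _ _ (hl v hv) _
  | zero_left => rw [zero_mul]; exact Submodule.zero_mem _
  | zero_right => rw [mul_zero]; exact Submodule.zero_mem _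
  | add_left _ _ _ _ _ _ h1 h2 => rw [add_mul]; exact Submodule.add_mem _ h1 h2
  | add_right _ _ _ _ _ _ h1 h2 => rw [mul_add]; exact Submodule.add_mem _ h1 h2
  | smul_left _ _ _ _ _ h => rw [smul_mul_assoc]; exact Submodule.smul_mem _ _ h
  | smul_right _ _ _ _ _ h => rw [mul_smul_comm]; exact Submodule.smul_mem _ _ h

end ExpIterInt

end

noncomputable section
namespace ExpIterInt
universe u
open MeasureTheory intervalIntegral Set Filter Topology unitInterval

variable {n : ℕ} {M : Type u} [TopologicalSpace M]
  [ChartedSpace (EuclideanSpace ℝ (Fin n)) M] [IsManifold (𝓡 n) ∞ M] {x : M}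

/-! ### Homotopy invariance of integrals of closed forms -/

/-- `g` is a primitive of `δ` on the open set `U`. -/
def IsPrimitiveOn (δ : OneForm n M) (U : Set M) (g : M → ℂ) : Prop :=
  IsOpen U ∧ ∀ q ∈ U, HasMFDerivAt (𝓡 n) 𝓘(ℝ, ℂ) g q (δ q)

theorem exists_finset_mdifferentiableAt {n : ℕ} {M : Type u} [TopologicalSpace M]
    [ChartedSpace (EuclideanSpace ℝ (Fin n)) M] {x : M} (γ : Loop n x) : ∃ S : Finset ℝ, ∀ t ∈ Ioo (0 : ℝ) 1,
    t ∉ S → MDifferentiableAt 𝓘(ℝ, ℝ) (𝓡 n) γ.path.extend t := by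
  obtain ⟨S, hS⟩ := γ.piecewiseC1
  refine ⟨S, fun t ht htS => ?_⟩
  obtain ⟨a, ha0, hat, ha⟩ := exists_smooth_left S ht.1
  obtain ⟨b, hb1, htb, hb⟩ := exists_smooth_right S ht.2
  have hc := hS a b ha0 (hat.trans htb) hb1 fun s hs hsI => by
    rcases lt_trichotomy s t with h | rfl | h
    · exact ha s hs ⟨hsI.1, h⟩
    · exact htS hs
    · exact hb s hs ⟨h, hsI.2⟩
  exact ((hc t ⟨hat.le, htb.le⟩).contMDiffAt (Icc_mem_nhds hat htb)).mdifferentiableAt one_ne_zero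

theorem IsPrimitiveOn.integral_pullback {δ : OneForm n M} {U : Set M} {g : M → ℂ}
    (h : IsPrimitiveOn δ U g) (γ : Loop n x) {a b : ℝ} (ha : 0 ≤ a) (hab : a ≤ b) (hb : b ≤ 1)
    (hU : ∀ t ∈ Icc a b, γ.path.extend t ∈ U) :
    ∫ t in a..b, pullback γ δ t = g (γ.path.extend b) - g (γ.path.extend a) := by
  obtain ⟨S, hS⟩ := exists_finset_mdifferentiableAt γ
  refine integral_eq_of_hasDerivAt_off_countable (fun t => g (γ.path.extend t)) _
    S.countable_toSet ?_ ?_ ?_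
  · rw [uIcc_of_le hab]
    exact fun t ht => ((h.2 _ (hU t ht)).continuousAt.comp
      γ.path.continuous_extend.continuousAt).continuousWithinAt
  · rintro t ⟨ht, htS⟩
    rw [min_eq_left hab, max_eq_right hab] at ht
    have h1 := (hS t ⟨ha.trans_lt ht.1, ht.2.trans_le hb⟩ htS).hasMFDerivAt
    have h2 : HasFDerivAt (fun t => g (γ.path.extend t)) ((δ (γ.path.extend t)).comp
        (mfderiv 𝓘(ℝ, ℝ) (𝓡 n) γ.path.extend t) : ℝ →L[ℝ] ℂ) t :=
      ((h.2 _ (hU t ⟨ht.1.le, ht.2.le⟩)).comp t h1).hasFDerivAt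
    exact h2.hasDerivAt
  · exact (isPiecewiseCont_pullback γ δ).mono ⟨ha, hab.trans hb⟩ ⟨ha.trans hab, hb⟩

theorem eventually_eq_of_hasMFDerivAt_zero {U : Set M} (hU : IsOpen U) {g : M → ℂ}
    (h : ∀ q ∈ U, HasMFDerivAt (𝓡 n) 𝓘(ℝ, ℂ) g q 0) {q : M} (hq : q ∈ U) :
    ∀ᶠ q' in 𝓝 q, g q' = g q := by
  have h1 : IsManifold (𝓡 n) 1 M := IsManifold.of_le (n := ∞) (by norm_cast)
  set φ := extChartAt (𝓡 n) q
  have hO : IsOpen (φ.target ∩ φ.symm ⁻¹' U) :=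
    (continuousOn_extChartAt_symm q).isOpen_inter_preimage (isOpen_extChartAt_target q) hU
  obtain ⟨r, hr, hball⟩ := Metric.isOpen_iff.mp hO (φ q)
    ⟨mem_extChartAt_target q, by simpa [φ] using hq⟩
  have hφ : ContMDiffOn 𝓘(ℝ, EuclideanSpace ℝ (Fin n)) (𝓡 n) 1 φ.symm φ.target :=
    contMDiffOn_extChartAt_symm q
  have hd : ∀ y ∈ Metric.ball (φ q) r, HasFDerivAt (g ∘ φ.symm) (0 : EuclideanSpace ℝ (Fin n) →L[ℝ] ℂ) y := by
    intro y hy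
    have h2 : MDifferentiableAt 𝓘(ℝ, EuclideanSpace ℝ (Fin n)) (𝓡 n) φ.symm y :=
      (hφ.contMDiffAt ((isOpen_extChartAt_target q).mem_nhds (hball hy).1)).mdifferentiableAt one_ne_zero
    exact (((h _ (hball hy).2).comp y h2.hasMFDerivAt).congr_mfderiv
      (ContinuousLinearMap.zero_comp _)).hasFDerivAt
  have hφc : ContinuousAt φ q := continuousAt_extChartAt q
  have hs : φ.source ∈ 𝓝 q := extChartAt_source_mem_nhds q
  filter_upwards [(hφc).preimage_mem_nhds (Metric.ball_mem_nhds _ hr),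
    hs] with q' hq' hq's
  have := Metric.isOpen_ball.is_const_of_fderiv_eq_zero (convex_ball (φ q) r).isPreconnected
    (fun y hy => (hd y hy).differentiableAt.differentiableWithinAt)
    (fun y hy => (hd y hy).fderiv) hq' (Metric.mem_ball_self hr)
  simpa only [Function.comp_apply, φ, (extChartAt (𝓡 n) q).left_inv hq's,
    extChartAt_to_inv] using this

/-- Two primitives differ by a locally constant function, so they have the same increment along an
arc in both domains. The arc `c` need only be continuous, as the arcs inside a homotopy are. -/
theorem IsPrimitiveOn.sub_eq_sub {δ : OneForm n M} {U U' : Set M} {g g' : M → ℂ}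
    (h : IsPrimitiveOn δ U g) (h' : IsPrimitiveOn δ U' g') {c : I → M} (hc : Continuous c)
    {a b : I} (hab : a ≤ b) (hU : ∀ t ∈ Icc a b, c t ∈ U) (hU' : ∀ t ∈ Icc a b, c t ∈ U') :
    g (c b) - g (c a) = g' (c b) - g' (c a) := by
  have hd : ∀ q ∈ U ∩ U', HasMFDerivAt (𝓡 n) 𝓘(ℝ, ℂ) (g - g') q 0 := fun q hq =>
    ((h.2 q hq.1).sub (h'.2 q hq.2)).congr_mfderiv (sub_self _)
  have : PreconnectedSpace (Icc a b) := isPreconnected_iff_preconnectedSpace.mp isPreconnected_Icc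
  have hl : IsLocallyConstant fun t : Icc a b => (g - g') (c t) := by
    rw [IsLocallyConstant.iff_eventually_eq]
    intro t
    exact (hc.comp continuous_subtype_val).continuousAt.eventually
      (eventually_eq_of_hasMFDerivAt_zero (h.1.inter h'.1) hd ⟨hU t t.2, hU' t t.2⟩)
  have h1 := hl.apply_eq_of_preconnectedSpace ⟨b, hab, le_rfl⟩ ⟨a, le_rfl, hab⟩
  simp only [Pi.sub_apply] at h1
  linear_combination h1

/-- A fine grid sends each small square of the homotopy into the domain of a primitive. The
intermediate loops are merely continuous, so increments of primitives replace integrals;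
neighbouring squares agree on common edges. -/
theorem IsClosedForm.integral_eq_of_homotopic {δ : OneForm n M} (hδ : IsClosedForm δ)
    {α β : Loop n x} (h : α.path.Homotopic β.path) :
    prim (pullback α δ) 0 = prim (pullback β δ) 0 := by
  obtain ⟨H⟩ := h
  have hex : ∀ p : M, ∃ (U : Set M) (g : M → ℂ), IsPrimitiveOn δ U g ∧ p ∈ U := fun p => by
    obtain ⟨U, g, h1, h2, h3⟩ := hδ.exists_primitive p
    exact ⟨U, g, ⟨h1, h3⟩, h2⟩
  choose U g hg hU using hex
  obtain ⟨t, ht0, htm, ⟨N, hN⟩, hcov⟩ :=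
    exists_monotone_Icc_subset_open_cover_unitInterval_prod_self
      (c := fun p => H ⁻¹' U p) (fun p => (hg p).1.preimage H.continuous)
      (fun z _ => mem_iUnion.mpr ⟨H z, hU _⟩)
  choose p hp using hcov
  have hle : ∀ i, t i ≤ t (i + 1) := fun i => htm i.le_succ
  have mem : ∀ i j a b, a ∈ Icc (t i) (t (i + 1)) → b ∈ Icc (t j) (t (j + 1)) →
      H (a, b) ∈ U (p i j) := fun i j a b ha hb => hp i j ⟨ha, hb⟩
  have hl : ∀ i, t i ∈ Icc (t i) (t (i + 1)) := fun i => ⟨le_rfl, hle i⟩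
  have hr : ∀ i, t (i + 1) ∈ Icc (t i) (t (i + 1)) := fun i => ⟨hle i, le_rfl⟩
  -- horizontal and vertical increments
  let hor : ℕ → ℕ → ℂ := fun i j => g (p i j) (H (t i, t (j + 1))) - g (p i j) (H (t i, t j))
  let ver : ℕ → ℕ → ℂ := fun i j => g (p i j) (H (t (i + 1), t j)) - g (p i j) (H (t i, t j))
  have hhor : ∀ i j, hor (i + 1) j =
      g (p i j) (H (t (i + 1), t (j + 1))) - g (p i j) (H (t (i + 1), t j)) := fun i j =>
    (hg (p (i + 1) j)).sub_eq_sub (hg (p i j)) (c := fun b => H (t (i + 1), b))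
      (H.continuous.comp (by fun_prop)) (hle j) (fun b hb => mem _ _ _ _ (hl _) hb)
      (fun b hb => mem _ _ _ _ (hr _) hb)
  have hver : ∀ i j, ver i (j + 1) =
      g (p i j) (H (t (i + 1), t (j + 1))) - g (p i j) (H (t i, t (j + 1))) := fun i j =>
    (hg (p i (j + 1))).sub_eq_sub (hg (p i j)) (c := fun a => H (a, t (j + 1)))
      (H.continuous.comp (by fun_prop)) (hle i) (fun a ha => mem _ _ _ _ ha (hl _))
      (fun a ha => mem _ _ _ _ ha (hr _))
  have hrow : ∀ i, ∑ j ∈ Finset.range N, hor i j = ∑ j ∈ Finset.range N, hor (i + 1) j := by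
    intro i
    -- The increments around one small square cancel. Summed over a row, the vertical ones telescope
    -- to the two outer sides, where the homotopy stays at the base point.
    have h1 : ∀ j, hor (i + 1) j - hor i j = ver i (j + 1) - ver i j := fun j => by
      rw [hhor, hver]
      simp only [hor, ver]
      ring
    have h2 : ver i N = 0 := by simp [ver, hN N le_rfl]
    have h3 : ver i 0 = 0 := by simp [ver, ht0]
    rw [eq_comm, ← sub_eq_zero, ← Finset.sum_sub_distrib, Finset.sum_congr rfl fun j _ => h1 j,
      Finset.sum_range_sub, h2, h3, sub_zero]
  have hall : ∀ i, ∑ j ∈ Finset.range N, hor 0 j = ∑ j ∈ Finset.range N, hor i j := by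
    intro i
    induction i with
    | zero => rfl
    | succ i ih => rw [ih, hrow]
  have hsum : ∀ (γ : Loop n x) (i : ℕ), (∀ b, H (t i, b) = γ.path b) →
      prim (pullback γ δ) 0 = ∑ j ∈ Finset.range N, hor i j := by
    intro γ i hγ
    have h1 := sum_integral_adjacent_intervals (f := pullback γ δ) (μ := volume)
      (a := fun j => (t j : ℝ)) fun j (_ : j < N) => 
        (isPiecewiseCont_pullback γ δ).mono (t j).2 (t (j + 1)).2
    rw [ht0, hN N le_rfl] at h1
    refine h1.symm.trans (Finset.sum_congr rfl fun j _ => ?_)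
    rw [(hg (p i j)).integral_pullback γ (t j).2.1 (hle j) (t (j + 1)).2.2]
    · simp only [hor, hγ, Path.extend_extends']
    · intro b hb
      have hb' : b ∈ I := ⟨(t j).2.1.trans hb.1, hb.2.trans (t (j + 1)).2.2⟩
      rw [Path.extend_apply _ hb', ← hγ]
      exact mem _ _ _ _ (hl i) ⟨hb.1, hb.2⟩
  rw [hsum α 0 (by simp [ht0]), hall N, hsum β N (by simp [hN N le_rfl])]

theorem expInt_mem_homotopyInvariant {δ : OneForm n M} (hδ : IsClosedForm δ) :
    expInt δ ∈ homotopyInvariant n x := fun α β h => by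
  rw [expInt_apply, expInt_apply, hδ.integral_eq_of_homotopic h]

end ExpIterInt

end

noncomputable section
namespace ExpIterInt
universe u

variable {n : ℕ} {M : Type u} [TopologicalSpace M]
  [ChartedSpace (EuclideanSpace ℝ (Fin n)) M] [IsManifold (𝓡 n) ∞ M]

/-! ### The group of transports -/

/-- Pairs of sequences of forms, the first of which takes values in `L`. -/
def Word (L : Submodule ℤ (OneForm n M)) : Type u :=
  {w : (ℕ → OneForm n M) × (ℕ → OneForm n M) // ∀ i, w.1 i ∈ L}

variable (x : M) (L : Submodule ℤ (OneForm n M))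

/-- The transports along a loop of all upper triangular connections with exponents in `L`. -/
def transportMatrix (γ : Loop n x) (w : Word L) : IncidenceAlgebra ℂ ℕ where
  toFun i j := if i ≤ j then transportAlong w.1.1 w.1.2 (j - i) i γ 0 else 0
  eq_zero_of_not_le' _ _ h := if_neg h

variable {x L}

theorem sum_Icc_eq_sum_antidiagonal {i j : ℕ} (h : i ≤ j) (F : ℕ → ℂ) :
    ∑ l ∈ Finset.Icc i j, F l =
      ∑ p ∈ Finset.HasAntidiagonal.antidiagonal (j - i), F (i + p.1) := by
  rw [Finset.Nat.sum_antidiagonal_eq_sum_range_succ_mk, ← Finset.Ico_add_one_right_eq_Icc,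
    Finset.sum_Ico_eq_sum_range, Nat.succ_eq_add_one, Nat.sub_add_comm h]

theorem transportMatrix_apply (γ : Loop n x) (w : Word L) {i j : ℕ} (h : i ≤ j) :
    transportMatrix x L γ w i j = transportAlong w.1.1 w.1.2 (j - i) i γ 0 := if_pos h

theorem sum_transportAlong_mul (α β : Loop n x) (w : Word L) {i j : ℕ} (h : i ≤ j) :
    (transportMatrix x L α w * transportMatrix x L β w) i j =
      ∑ p ∈ Finset.HasAntidiagonal.antidiagonal (j - i),
        transportAlong w.1.1 w.1.2 p.1 i α 0 * transportAlong w.1.1 w.1.2 p.2 (i + p.1) β 0 := by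
  rw [IncidenceAlgebra.mul_apply, sum_Icc_eq_sum_antidiagonal h]
  refine Finset.sum_congr rfl fun p hp => ?_
  have hp' := Finset.HasAntidiagonal.mem_antidiagonal.mp hp
  rw [transportMatrix_apply _ _ (by omega), transportMatrix_apply _ _ (by omega),
    show i + p.1 - i = p.1 by omega, show j - (i + p.1) = p.2 by omega]

theorem transportMatrix_concat (α β : Loop n x) :
    transportMatrix x L (α.concat β) = transportMatrix x L α * transportMatrix x L β := by
  ext w i j h
  rw [Pi.mul_apply, sum_transportAlong_mul α β w h, transportMatrix_apply _ _ h,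
    transportAlong_concat]

theorem transportMatrix_const : transportMatrix x L (Loop.const n x) = 1 := by
  ext w i j h
  rw [transportMatrix_apply _ _ h, transportAlong_const, Pi.one_apply,
    IncidenceAlgebra.one_apply]
  exact if_congr (by omega) rfl rfl

theorem transportMatrix_inverse_mul (α : Loop n x) :
    transportMatrix x L α.inverse * transportMatrix x L α = 1 := by
  ext w i j h
  rw [Pi.mul_apply, sum_transportAlong_mul _ _ w h, transportAlong_inverse, Pi.one_apply,
    IncidenceAlgebra.one_apply]
  exact if_congr (by omega) rfl rfl

theorem inverse_inverse {n : ℕ} {M : Type u} [TopologicalSpace M]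
    [ChartedSpace (EuclideanSpace ℝ (Fin n)) M] {x : M} (α : Loop n x) : α.inverse.inverse = α := by
  cases α
  simp [Loop.inverse]

/-- The transports along a loop, as a unit. -/
def transportUnit (x : M) (L : Submodule ℤ (OneForm n M)) (γ : Loop n x) :
    (Word L → IncidenceAlgebra ℂ ℕ)ˣ where
  val := transportMatrix x L γ
  inv := transportMatrix x L γ.inverse
  val_inv := by
    have h := transportMatrix_inverse_mul (L := L) γ.inverse
    rwa [inverse_inverse] at h
  inv_val := transportMatrix_inverse_mul γ

/-- The group of transports along loops at `x`. -/
def transportGroup (x : M) (L : Submodule ℤ (OneForm n M)) :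
    Subgroup (Word L → IncidenceAlgebra ℂ ℕ)ˣ where
  carrier := Set.range (transportUnit x L)
  mul_mem' := by
    rintro _ _ ⟨α, rfl⟩ ⟨β, rfl⟩
    exact ⟨α.concat β, Units.ext (transportMatrix_concat α β)⟩
  one_mem' := ⟨Loop.const n x, Units.ext transportMatrix_const⟩
  inv_mem' := by
    rintro _ ⟨α, rfl⟩
    exact ⟨α.inverse, Units.ext rfl⟩

/-- The class of a loop in the group of transports. -/
def toGroup (x : M) (L : Submodule ℤ (OneForm n M)) (γ : Loop n x) : transportGroup x L :=
  ⟨transportUnit x L γ, γ, rfl⟩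

theorem toGroup_surjective : Function.Surjective (toGroup x L) := by
  rintro ⟨_, γ, rfl⟩
  exact ⟨γ, rfl⟩

theorem toGroup_concat (α β : Loop n x) :
    toGroup x L (α.concat β) = toGroup x L α * toGroup x L β :=
  Subtype.ext (Units.ext (transportMatrix_concat α β))

theorem toGroup_const : toGroup x L (Loop.const n x) = 1 :=
  Subtype.ext (Units.ext transportMatrix_const)

theorem toGroup_inverse (α : Loop n x) : toGroup x L α.inverse = (toGroup x L α)⁻¹ :=
  Subtype.ext (Units.ext rfl)

variable (x L) in
/-- A function on the group of transports, as a function of loops. -/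
def ofGroup : (transportGroup x L → ℂ) →ₐ[ℂ] (Loop n x → ℂ) where
  toFun f γ := f (toGroup x L γ)
  map_one' := rfl
  map_mul' _ _ := rfl
  map_zero' := rfl
  map_add' _ _ := rfl
  commutes' _ := rfl

theorem ofGroup_apply (f : transportGroup x L → ℂ) (γ : Loop n x) :
    ofGroup x L f γ = f (toGroup x L γ) := rfl

theorem ofGroup_injective : Function.Injective (ofGroup x L) := fun f g h => by
  ext a
  obtain ⟨γ, rfl⟩ := toGroup_surjective a
  exact congrFun h γ

/-- The entries of transports as functions on the group. -/
def entry (x : M) {L : Submodule ℤ (OneForm n M)} (w : Word L) (i j : ℕ) (a : transportGroup x L) :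
    ℂ := (a : (Word L → IncidenceAlgebra ℂ ℕ)ˣ).val w i j

theorem entry_mul (w : Word L) (i j : ℕ) (a b : transportGroup x L) :
    entry x w i j (a * b) = ∑ l ∈ Finset.Icc i j, entry x w i l a * entry x w l j b := rfl

theorem entry_one (w : Word L) (i j : ℕ) :
    entry x w i j 1 = if i = j then 1 else 0 := rfl

theorem entry_toGroup (w : Word L) {i j : ℕ} (h : i ≤ j) (γ : Loop n x) :
    entry x w i j (toGroup x L γ) = transportAlong w.1.1 w.1.2 (j - i) i γ 0 :=
  transportMatrix_apply γ w h

theorem entry_eq_zero (w : Word L) {i j : ℕ} (h : j < i) : entry x w i j = 0 :=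
  funext fun a => IncidenceAlgebra.apply_eq_zero_of_not_le (not_le.mpr h) (a.1.val w)

theorem entry_self_mul (w : Word L) (i : ℕ) (a b : transportGroup x L) :
    entry x w i i (a * b) = entry x w i i a * entry x w i i b := by
  rw [entry_mul, Finset.Icc_self, Finset.sum_singleton]

/-- The diagonal entries as characters. -/
def diagChar (x : M) {L : Submodule ℤ (OneForm n M)} (w : Word L) (i : ℕ) :
    transportGroup x L →* ℂˣ :=
  MonoidHom.toHomUnits
    { toFun := entry x w i i
      map_one' := by rw [entry_one, if_pos rfl]
      map_mul' := entry_self_mul w i }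

theorem charFun_diagChar (w : Word L) (i : ℕ) : charFun (diagChar x w i) = entry x w i i := rfl

theorem ofGroup_entry_self (w : Word L) (i : ℕ) :
    ofGroup x L (entry x w i i) = expInt (w.1.1 i) := by
  ext γ
  rw [ofGroup_apply, entry_toGroup w le_rfl, expInt_apply, Nat.sub_self]
  rfl

/-! ### The Hopf algebra of exponential iterated integrals -/

variable (x L) in
/-- The functions on the group of transports that correspond to exponential iterated integrals. -/
def EBAlg : Subalgebra ℂ (transportGroup x L → ℂ) :=
  ((EB x L).toSubalgebra (one_mem_EB x L) fun _ _ => mul_mem_EB).comap (ofGroup x L)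

theorem mem_EBAlg {f : transportGroup x L → ℂ} : f ∈ EBAlg x L ↔ ofGroup x L f ∈ EB x L := Iff.rfl

theorem entry_mem (w : Word L) (i j : ℕ) : entry x w i j ∈ EBAlg x L := by
  rcases le_or_gt i j with h | h
  · have h1 : ofGroup x L (entry x w i j) =
        fun γ => transportAlong w.1.1 w.1.2 (j - i) i γ 0 := funext fun γ => entry_toGroup w h γ
    rw [mem_EBAlg, h1]
    exact transportAlong_mem _ _ w.2 _
  · rw [entry_eq_zero w h]
    exact Subalgebra.zero_mem _

/-- Every exponential iterated integral factors through the group of transports, as the entry in row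
0 and column `k` of its word. -/
theorem EB_eq_map_span : EB x L = (Submodule.span ℂ
    {f | ∃ (w : Word L) (i j : ℕ), f = entry x w i j}).map (ofGroup x L).toLinearMap := by
  apply le_antisymm
  · rw [EB_eq_span, Submodule.span_le]
    rintro _ ⟨k, δ, η, hδ, rfl⟩
    refine ⟨entry x (⟨(δ, η), hδ⟩ : Word L) 0 k, Submodule.subset_span ⟨_, _, _, rfl⟩, ?_⟩
    exact funext fun γ => entry_toGroup _ (Nat.zero_le k) γ
  · rw [Submodule.map_span_le]
    rintro _ ⟨w, i, j, rfl⟩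
    exact entry_mem w i j

theorem EBAlg_induction {p : (transportGroup x L → ℂ) → Prop}
    (he : ∀ (w : Word L) i j, p (entry x w i j)) (h0 : p 0)
    (hadd : ∀ f g, p f → p g → p (f + g)) (hsmul : ∀ (c : ℂ) f, p f → p (c • f))
    {f : transportGroup x L → ℂ} (hf : f ∈ EBAlg x L) : p f := by
  rw [mem_EBAlg, EB_eq_map_span] at hf
  obtain ⟨g, hg, hgf⟩ := hf
  obtain rfl := ofGroup_injective hgf
  refine Submodule.span_induction ?_ h0 (fun f g _ _ => hadd f g) (fun c f _ => hsmul c f) hg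
  rintro _ ⟨w, i, j, rfl⟩
  exact he w i j

theorem map_EBAlg :
    (Subalgebra.toSubmodule (EBAlg x L)).map (ofGroup x L).toLinearMap = EB x L := by
  apply le_antisymm
  · rintro _ ⟨f, hf, rfl⟩
    exact hf
  · rw [EB_eq_map_span, Submodule.map_span_le]
    rintro _ ⟨w, i, j, rfl⟩
    exact ⟨_, entry_mem w i j, rfl⟩

/-- Back substitution in a⁻¹a = 1: the entry at `(i, j)` of the inverse is determined by those in
earlier columns, up to division by a diagonal entry. -/
theorem entry_inv_mem (w : Word L) (i j : ℕ) : (fun a => entry x w i j a⁻¹) ∈ EBAlg x L := by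
  induction j using Nat.strong_induction_on with
  | _ j ih =>
    rcases lt_or_ge j i with h | h
    · have : (fun a => entry x w i j a⁻¹) = (0 : transportGroup x L → ℂ) := by
        rw [entry_eq_zero w h]
        rfl
      rw [this]
      exact Subalgebra.zero_mem _
    -- The diagonal entry is ∫e^δ with δ in `L`. Its inverse is the diagonal entry ∫e^(-δ) of the
    -- word with negated exponents.
    let w' : Word L := ⟨(fun l => -w.1.1 l, w.1.2), fun l => L.neg_mem (w.2 l)⟩
    have hw' : ∀ a : transportGroup x L, entry x w j j a * entry x w' j j a = 1 := by
      intro a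
      obtain ⟨γ, rfl⟩ := toGroup_surjective a
      have h1 := congrFun (ofGroup_entry_self (x := x) w j) γ
      have h2 := congrFun (ofGroup_entry_self (x := x) w' j) γ
      rw [ofGroup_apply, expInt_apply] at h1 h2
      rw [h1, h2, ← Complex.exp_add]
      simp [w', pullback_neg, prim]
    have key : (fun a => entry x w i j a⁻¹) =
        ((fun _ => if i = j then (1 : ℂ) else 0) - ∑ l ∈ Finset.Ico i j,
          (fun a => entry x w i l a⁻¹) * entry x w l j) * entry x w' j j := by
      ext a
      have h1 := entry_mul w i j a⁻¹ a
      rw [inv_mul_cancel, entry_one, ← Finset.Ico_add_one_right_eq_Icc,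
        Finset.sum_Ico_succ_top h] at h1
      simp only [Pi.mul_apply, Pi.sub_apply, Finset.sum_apply]
      rw [h1]
      linear_combination -(entry x w i j a⁻¹) * hw' a
    rw [key]
    refine Subalgebra.mul_mem _ (Subalgebra.sub_mem _ ?_ (Subalgebra.sum_mem _ fun l hl =>
      Subalgebra.mul_mem _ (ih l (Finset.mem_Ico.mp hl).2) (entry_mem w l j))) (entry_mem w' j j)
    exact Subalgebra.algebraMap_mem _ (if i = j then (1 : ℂ) else 0)

/-- The formula for the product of matrices is the coproduct of an entry, and `entry_inv_mem` is the
antipode. -/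
instance EBAlg_isHopfSubalgebra : IsHopfSubalgebra (EBAlg x L) := by
  refine isHopfSubalgebra_of_exists (fun f hf => ?_) fun f hf => ?_
  · refine EBAlg_induction (p := fun f => ∃ t : EBAlg x L ⊗[ℂ] EBAlg x L,
      ∀ a b, pairAt (EBAlg x L) a b t = f (a * b)) (fun w i j => ?_) ?_ (fun f g hf hg => ?_)
      (fun c f hf => ?_) hf
    · refine ⟨∑ l ∈ Finset.Icc i j, ⟨_, entry_mem w i l⟩ ⊗ₜ ⟨_, entry_mem w l j⟩, fun a b => ?_⟩
      rw [map_sum, entry_mul]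
      exact Finset.sum_congr rfl fun l _ => pairAt_tmul _ _ _ _ _
    · exact ⟨0, fun a b => by simp⟩
    · obtain ⟨s, hs⟩ := hf
      obtain ⟨t, ht⟩ := hg
      exact ⟨s + t, fun a b => by simp [hs, ht]⟩
    · obtain ⟨s, hs⟩ := hf
      exact ⟨c • s, fun a b => by simp [hs]⟩
  · refine EBAlg_induction (p := fun f => (fun a => f a⁻¹) ∈ EBAlg x L)
      entry_inv_mem ?_ (fun f g hf hg => ?_) (fun c f hf => ?_) hf
    · exact (EBAlg x L).zero_mem
    · exact (EBAlg x L).add_mem hf hg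
    · exact (EBAlg x L).smul_mem hf c

/-! ### The characters with exponents in `L` -/

variable (x L) in
/-- The characters `∫ e^δ` with `δ ∈ L`. -/
def expChars : Subgroup (transportGroup x L →* ℂˣ) where
  carrier := {χ | ∃ δ ∈ L, ofGroup x L (charFun χ) = expInt δ}
  mul_mem' := by
    rintro χ ψ ⟨δ, hδ, h⟩ ⟨δ', hδ', h'⟩
    refine ⟨δ + δ', L.add_mem hδ hδ', ?_⟩
    ext γ
    rw [map_mul, map_mul, h, h', Pi.mul_apply, expInt_apply, expInt_apply, expInt_apply,
      pullback_add, prim_add (isPiecewiseCont_pullback γ δ) (isPiecewiseCont_pullback γ δ')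
        ⟨le_rfl, zero_le_one⟩, Complex.exp_add]
  one_mem' := by
    refine ⟨0, L.zero_mem, ?_⟩
    ext γ
    rw [map_one, map_one, expInt_apply, pullback_zero]
    simp [prim]
  inv_mem' := by
    rintro χ ⟨δ, hδ, h⟩
    refine ⟨-δ, L.neg_mem hδ, ?_⟩
    ext γ
    have h1 : ((χ (toGroup x L γ) : ℂˣ) : ℂ) = expInt δ γ := congrFun h γ
    have h2 : prim (fun t => -pullback γ δ t) 0 = -prim (pullback γ δ) 0 :=
      intervalIntegral.integral_neg
    rw [expInt_apply, pullback_neg, h2, Complex.exp_neg, ← expInt_apply, ← h1]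
    simp [ofGroup_apply]

theorem diagChar_mem (w : Word L) (i : ℕ) : diagChar x w i ∈ expChars x L :=
  ⟨w.1.1 i, w.2 i, ofGroup_entry_self w i⟩

theorem exists_mem_expChars {δ : OneForm n M} (hδ : δ ∈ L) :
    ∃ χ ∈ expChars x L, ofGroup x L (charFun χ) = expInt δ :=
  let w : Word L := ⟨(fun _ => δ, fun _ => 0), fun _ => hδ⟩
  ⟨diagChar x w 0, diagChar_mem w 0, ofGroup_entry_self w 0⟩

theorem map_charAlg : (Subalgebra.toSubmodule (charAlg (expChars x L))).map
    (ofGroup x L).toLinearMap = Subalgebra.toSubmodule (expAlg x L) := by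
  have h : (charAlg (expChars x L)).map (ofGroup x L) = expAlg x L := by
    rw [charAlg, AlgHom.map_adjoin, expAlg]
    congr 1
    ext f
    constructor
    · rintro ⟨_, ⟨χ, ⟨δ, hδ, hχ⟩, rfl⟩, rfl⟩
      exact ⟨δ, hδ, hχ⟩
    · rintro ⟨δ, hδ, rfl⟩
      obtain ⟨χ, hχ, h⟩ := exists_mem_expChars (x := x) hδ
      exact ⟨_, ⟨χ, hχ, rfl⟩, h⟩
  rw [← h]
  rfl

theorem expInt_mem_EB {δ : OneForm n M} (hδ : δ ∈ L) : expInt δ ∈ EB x L :=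
  Submodule.subset_span ⟨0, _, _, fun _ => hδ, rfl⟩

theorem charAlg_le_EBAlg : charAlg (expChars x L) ≤ EBAlg x L := by
  refine Algebra.adjoin_le ?_
  rintro _ ⟨χ, ⟨δ, hδ, hχ⟩, rfl⟩
  rw [SetLike.mem_coe, mem_EBAlg, hχ]
  exact expInt_mem_EB hδ

/-- Column `j` is built upwards from the diagonal. Translating the entry in row `l` multiplies it by
the diagonal entry at `l`, modulo the entries of the same column in lower rows. For `d = 0` only the
zero entries below the diagonal occur. -/
theorem exists_isFlagged_entry (w : Word L) (j d : ℕ) :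
    ∃ N, IsFlagged (expChars x L) N ∧ N ≤ Subalgebra.toSubmodule (EBAlg x L) ∧
      ∀ l, j < l + d → entry x w l j ∈ N := by
  induction d with
  | zero =>
    refine ⟨_, .one, ?_, fun l hl => ?_⟩
    · rw [Submodule.span_singleton_le_iff_mem]
      exact (EBAlg x L).one_mem
    · rw [entry_eq_zero w (show j < l from hl)]
      exact Submodule.zero_mem _
  | succ d ih =>
    obtain ⟨N, hN, hle, hmem⟩ := ih
    by_cases hd : d ≤ j
    · refine ⟨_, hN.step (entry x w (j - d) j) _ (diagChar_mem w (j - d)) fun a => ?_,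
        sup_le hle ?_, fun l hl => ?_⟩
      · rw [charFun_diagChar]
        have : leftTranslate a (entry x w (j - d) j) -
            entry x w (j - d) (j - d) a • entry x w (j - d) j =
            ∑ l ∈ Finset.Ioc (j - d) j, entry x w (j - d) l a • entry x w l j := by
          ext b
          rw [Pi.sub_apply, leftTranslate_apply, entry_mul,
            Finset.Icc_eq_cons_Ioc (Nat.sub_le j d), Finset.sum_cons]
          simp
        rw [this]
        refine Submodule.sum_mem _ fun l hl => Submodule.smul_mem _ _ (hmem l ?_)
        have := (Finset.mem_Ioc.mp hl).1
        omega
      · rw [Submodule.span_singleton_le_iff_mem]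
        exact entry_mem w _ j
      · rcases eq_or_ne l (j - d) with rfl | h
        · exact Submodule.mem_sup_right (Submodule.mem_span_singleton_self _)
        · exact Submodule.mem_sup_left (hmem l (by omega))
    · exact ⟨N, hN, hle, fun l _ => hmem l (by omega)⟩

theorem EBAlg_isLocallyFlagged : IsLocallyFlagged (expChars x L) (EBAlg x L) := fun f hf => by
  refine EBAlg_induction (p := fun f => ∃ N, IsFlagged (expChars x L) N ∧ f ∈ N ∧
    N ≤ Subalgebra.toSubmodule (EBAlg x L)) (fun w i j => ?_) ?_ ?_ ?_ hf
  · obtain ⟨N, h1, h2, h3⟩ := exists_isFlagged_entry w j (j + 1)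
    exact ⟨N, h1, h3 i (by omega), h2⟩
  · refine ⟨_, .one, Submodule.zero_mem _, ?_⟩
    rw [Submodule.span_singleton_le_iff_mem]
    exact (EBAlg x L).one_mem
  · rintro f g ⟨N, h1, h2, h3⟩ ⟨N', h1', h2', h3'⟩
    exact ⟨_, h1.sup h1', Submodule.add_mem_sup h2 h2', sup_le h3 h3'⟩
  · rintro c f ⟨N, h1, h2, h3⟩
    exact ⟨N, h1, N.smul_mem c h2, h3⟩

end ExpIterInt

end

noncomputable section
namespace ExpIterInt
universe u

/-! ### Hopf subalgebras of invariant functions -/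

section Invariant

variable {G : Type u} [Group G] {V W : Subalgebra ℂ (G → ℂ)} [hV : IsHopfSubalgebra V]

/-- The functions in a Hopf algebra of functions on `G` that are invariant under an equivalence
relation compatible with the group structure form a Hopf algebra. -/
theorem isHopfSubalgebra_of_invariant (r : G → G → Prop) (hl : ∀ a b c, r a b → r (c * a) (c * b))
    (hr : ∀ a b c, r a b → r (a * c) (b * c)) (hi : ∀ a b, r a b → r a⁻¹ b⁻¹)
    (hW : ∀ f, f ∈ W ↔ f ∈ V ∧ ∀ a b, r a b → f a = f b) : IsHopfSubalgebra W := by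
  classical
  refine isHopfSubalgebra_of_exists (fun f hf => ?_) fun f hf => ?_
  · obtain ⟨hfV, hfr⟩ := (hW f).mp hf
    obtain ⟨S, hS⟩ := exists_sum_of_isHopfSubalgebra hfV
    have hSf : ∀ a, leftTranslate a f = ∑ p ∈ S, (p.1 : G → ℂ) a • (p.2 : G → ℂ) := fun a => by
      ext b
      simp [hS]
    -- The left translates of `f` span a finite-dimensional space of functions that are still
    -- invariant, because the relation is compatible with multiplication on the left.
    let N := Submodule.span ℂ (Set.range fun a => leftTranslate a f)
    have hNle : N ≤ Submodule.span ℂ ((S.image fun p => (p.2 : G → ℂ) : Finset (G → ℂ)) :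
        Set (G → ℂ)) := by
      refine Submodule.span_le.mpr ?_
      rintro _ ⟨a, rfl⟩
      simp only [hSf]
      exact Submodule.sum_mem _ fun p hp => Submodule.smul_mem _ _
        (Submodule.subset_span (Finset.mem_coe.mpr (Finset.mem_image_of_mem _ hp)))
    have : FiniteDimensional ℂ N := Submodule.finiteDimensional_of_le hNle
    have hNW : ∀ g ∈ N, g ∈ W := by
      intro g hg
      have : N ≤ Subalgebra.toSubmodule W := by
        refine Submodule.span_le.mpr ?_
        rintro _ ⟨a, rfl⟩
        refine (hW _).mpr ⟨?_, fun b c hbc => hfr _ _ (hl b c a hbc)⟩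
        simp only [hSf]
        exact Subalgebra.sum_mem _ fun p _ => Subalgebra.smul_mem _ p.2.2 _
      exact this hg
    let B := Module.finBasis ℂ N
    -- Coordinates on `N` are extended to all functions, so that they can be applied termwise to the
    -- coproduct over `V`. This puts the coordinates of the translates in `V`; compatibility with
    -- multiplication on the right makes them invariant.
    choose l hl' using fun j => LinearMap.exists_extend (B.coord j)
    have hlB : ∀ j (g : N), l j g = B.repr g j := fun j g => LinearMap.congr_fun (hl' j) g
    have hmem : ∀ j, (fun a => l j (leftTranslate a f)) ∈ W := by
      intro j
      refine (hW _).mpr ⟨?_, fun a b hab => ?_⟩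
      · have h1 : (fun a => l j (leftTranslate a f)) =
            ∑ p ∈ S, l j (p.2 : G → ℂ) • (p.1 : G → ℂ) := by
          ext a
          simp [hSf, mul_comm]
        rw [h1]
        exact Subalgebra.sum_mem _ fun p _ => Subalgebra.smul_mem _ p.1.2 _
      · have : leftTranslate a f = leftTranslate b f := funext fun c => hfr _ _ (hr a b c hab)
        simp only [this]
    refine ⟨∑ j, ⟨_, hmem j⟩ ⊗ₜ ⟨_, hNW _ (B j).2⟩, fun a b => ?_⟩
    have h1 : leftTranslate a f ∈ N := Submodule.subset_span ⟨a, rfl⟩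
    have h2 := congrArg (fun g : N => (g : G → ℂ) b) (B.sum_repr ⟨_, h1⟩)
    simp only [Submodule.coe_sum, Submodule.coe_smul, Finset.sum_apply, Pi.smul_apply,
      smul_eq_mul, leftTranslate_apply] at h2
    rw [map_sum, ← h2]
    refine Finset.sum_congr rfl fun j _ => ?_
    rw [pairAt_tmul]
    congr 1
    exact hlB j ⟨_, h1⟩
  · obtain ⟨hfV, hfr⟩ := (hW f).mp hf
    exact (hW _).mpr ⟨hV.inv ⟨f, hfV⟩, fun a b hab => hfr _ _ (hi a b hab)⟩

end Invariant

/-! ### Homotopy invariant functions on the group of transports. -/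

variable {n : ℕ} {M : Type u} [TopologicalSpace M]
  [ChartedSpace (EuclideanSpace ℝ (Fin n)) M] [IsManifold (𝓡 n) ∞ M]
  (x : M) (L : Submodule ℤ (OneForm n M))

/-- The functions on the group of transports that correspond to homotopy invariant exponential
iterated integrals. -/
def H0Alg : Subalgebra ℂ (transportGroup x L → ℂ) where
  carrier := {f | ofGroup x L f ∈ H0EB x L}
  mul_mem' {f g} hf hg := ⟨mul_mem_EB hf.1 hg.1, fun α β h => by
    rw [map_mul, Pi.mul_apply, Pi.mul_apply, hf.2 α β h, hg.2 α β h]⟩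
  add_mem' {f g} hf hg := by
    have := (H0EB x L).add_mem hf hg
    rwa [← map_add] at this
  algebraMap_mem' c := ⟨(EBAlg x L).algebraMap_mem c, fun _ _ _ => rfl⟩

variable {x L}

theorem mem_H0Alg {f : transportGroup x L → ℂ} : f ∈ H0Alg x L ↔ ofGroup x L f ∈ H0EB x L := Iff.rfl

/-- Elements of the group of transports are homotopic if they come from homotopic loops. -/
def GroupHomotopic (a b : transportGroup x L) : Prop :=
  ∃ α β : Loop n x, α.path.Homotopic β.path ∧ toGroup x L α = a ∧ toGroup x L β = b

instance H0Alg_isHopfSubalgebra : IsHopfSubalgebra (H0Alg x L) := by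
  refine isHopfSubalgebra_of_invariant (V := EBAlg x L) GroupHomotopic ?_ ?_ ?_ fun f => ?_
  · rintro _ _ c ⟨α, β, h, rfl, rfl⟩
    obtain ⟨γ, rfl⟩ := toGroup_surjective c
    exact ⟨γ.concat α, γ.concat β, (Path.Homotopic.refl γ.path).hcomp h, toGroup_concat _ _,
      toGroup_concat _ _⟩
  · rintro _ _ c ⟨α, β, h, rfl, rfl⟩
    obtain ⟨γ, rfl⟩ := toGroup_surjective c
    exact ⟨α.concat γ, β.concat γ, h.hcomp (Path.Homotopic.refl γ.path), toGroup_concat _ _,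
      toGroup_concat _ _⟩
  · rintro _ _ ⟨α, β, ⟨h⟩, rfl, rfl⟩
    exact ⟨α.inverse, β.inverse, ⟨h.symm₂⟩, toGroup_inverse _, toGroup_inverse _⟩
  · refine ⟨fun h => ⟨h.1, ?_⟩, fun h => ⟨h.1, fun α β hαβ => h.2 _ _ ⟨α, β, hαβ, rfl, rfl⟩⟩⟩
    rintro _ _ ⟨α, β, hαβ, rfl, rfl⟩
    exact h.2 α β hαβ

theorem H0Alg_le : H0Alg x L ≤ EBAlg x L := fun _ h => h.1

theorem map_H0Alg :
    (Subalgebra.toSubmodule (H0Alg x L)).map (ofGroup x L).toLinearMap = H0EB x L := by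
  apply le_antisymm
  · rintro _ ⟨f, hf, rfl⟩
    exact hf
  · intro f hf
    have h := hf.1
    rw [← map_EBAlg] at h
    obtain ⟨g, -, rfl⟩ := h
    exact ⟨g, hf, rfl⟩

/-- A flagged space found in the larger algebra is cut down to the invariant functions. These are
stable under translation because the coproduct stays inside them, so `IsFlagged.inf_of_stable`
applies. -/
theorem H0Alg_isLocallyFlagged : IsLocallyFlagged (expChars x L) (H0Alg x L) := fun f hf => by
  obtain ⟨N, h1, h2, -⟩ := EBAlg_isLocallyFlagged f (H0Alg_le hf)
  refine ⟨Subalgebra.toSubmodule (H0Alg x L) ⊓ N, h1.inf_of_stable (H0Alg x L).one_mem ?_,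
    ⟨hf, h2⟩, inf_le_left⟩
  intro g hg a
  obtain ⟨S, hS⟩ := exists_sum_of_isHopfSubalgebra (V := H0Alg x L) hg
  have : leftTranslate a g = ∑ p ∈ S, (p.1 : transportGroup x L → ℂ) a •
      (p.2 : transportGroup x L → ℂ) := by
    ext b
    simp [hS]
  rw [this]
  exact Submodule.sum_mem _ fun p _ => Submodule.smul_mem _ _ p.2.2

/-- Closedness of the exponents enters here, through the homotopy invariance of ∫e^δ. -/
theorem charAlg_le_H0Alg (hL : ∀ δ ∈ L, IsClosedForm δ) : charAlg (expChars x L) ≤ H0Alg x L := by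
  refine Algebra.adjoin_le ?_
  rintro _ ⟨χ, ⟨δ, hδ, hχ⟩, rfl⟩
  rw [SetLike.mem_coe, mem_H0Alg, hχ]
  exact ⟨expInt_mem_EB hδ, expInt_mem_homotopyInvariant (hL δ hδ)⟩

/-- A Hopf algebra of functions on the group of transports, as a Hopf algebra of functions on
loops. -/
abbrev loopHopfAlgebra (W : Subalgebra ℂ (transportGroup x L → ℂ)) [hW : IsHopfSubalgebra W]
    {V : Submodule ℂ (Loop n x → ℂ)}
    (h : (Subalgebra.toSubmodule W).map (ofGroup x L).toLinearMap = V) : LoopHopfAlgebra V where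
  carrier := W
  eval := (ofGroup x L).comp W.val
  eval_injective f g hfg := Subtype.ext (ofGroup_injective hfg)
  range_eval := by
    rw [← h]
    ext f
    constructor
    · rintro ⟨g, rfl⟩
      exact ⟨g, g.2, rfl⟩
    · rintro ⟨g, hg, rfl⟩
      exact ⟨⟨g, hg⟩, rfl⟩
  eval_comul f α β := by
    refine (pairAt_comul W f (toGroup x L α) (toGroup x L β)).trans ?_
    rw [← toGroup_concat]
    rfl
  counit_eq f := by
    rw [counit_apply, ← toGroup_const]
    rfl
  eval_antipode f α := by
    change ((HopfAlgebra.antipode ℂ f : W) : transportGroup x L → ℂ) (toGroup x L α) = _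
    rw [antipode_apply, ← toGroup_inverse]
    rfl

end ExpIterInt

end

/-! ### The theorem, transferred from functions on the group to functions on loops. -/

theorem mainTheorem4 {n : ℕ} {M : Type*} [TopologicalSpace M]
    [ChartedSpace (EuclideanSpace ℝ (Fin n)) M] [IsManifold (𝓡 n) ∞ M] (x : M)
    (L : Submodule ℤ (OneForm n M)) :
    ∃ (E : LoopHopfAlgebra (Subalgebra.toSubmodule (expAlg x L))) (A : LoopHopfAlgebra (EB x L)),
      IsProdiagonalizable E.carrier ∧
      (∃ φ : E.carrier →ₐc[ℂ] A.carrier,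
        (∀ e, A.eval (φ e) = E.eval e) ∧ SpecEpi φ ∧ HasProunipotentKernel φ) ∧
      ((∀ δ ∈ L, IsClosedForm δ) →
        ∃ (H : LoopHopfAlgebra (H0EB x L)) (ψ : E.carrier →ₐc[ℂ] H.carrier),
          (∀ e, H.eval (ψ e) = E.eval e) ∧ SpecEpi ψ ∧ HasProunipotentKernel ψ) := by
  refine ⟨loopHopfAlgebra (charAlg (expChars x L)) map_charAlg,
    loopHopfAlgebra (EBAlg x L) map_EBAlg, isProdiagonalizable_charAlg _,
    ⟨inclusionHom charAlg_le_EBAlg, fun _ => rfl, EBAlg_isLocallyFlagged.faithfullyFlat _,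
      EBAlg_isLocallyFlagged.hasProunipotentKernel _⟩, fun hL => ?_⟩
  exact ⟨loopHopfAlgebra (H0Alg x L) map_H0Alg, inclusionHom (charAlg_le_H0Alg hL), fun _ => rfl,
    H0Alg_isLocallyFlagged.faithfullyFlat _, H0Alg_isLocallyFlagged.hasProunipotentKernel _⟩
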